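/- Theorem 1.1. Let $N\ge 2$, $\mathbb{R}^N_+=\{x\in\mathbb{R}^N: x_N>0\}$, $H=\{x_N=0\}$, $\alpha\in(-1,0)$, and let $k,\ell\in\mathbb{R}$ satisfy $\ell+N+\alpha>0$ and $$k+N+\alpha-1<\sqrt{(N-1)(N+\alpha-1)},\qquad N(k+N+\alpha-1)<(\ell+N+\alpha)(N-1),\qquad \ell+1\le k+\frac{N+\alpha-1}{k+N+\alpha-1}.$$ For measurable $\Omega\subset\mathbb{R}^N_+$ put $\mu(\Omega)=\int_\Omega|x|^\ell x_N^\alpha\,dx$ and $P(\Omega)=\int_{\partial\Omega\cap\mathbb{R}^N_+}|x|^k x_N^\alpha\,\mathcal{H}_{N-1}(dx)$, where $\partial\Omega$ is the essential boundary (the points at which $\Omega$ has neither density $0$ nor density $1$). For $n\in\{1,2,\dots,\infty\}$, a set $\Omega\subset\mathbb{R}^N_+$ is a $C^n$-set if every $x^0\in\partial\Omega\cap\mathbb{R}^N_+$ has a ball $B_r(x^0)$ such that $B_r(x^0)\cap\Omega$ has exactly one connected component and $B_r(x^0)\cap\partial\Omega$ is the graph (over some hyperplane) of a $C^n$-function on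 an open set in $\mathbb{R}^{N-1}$. (i) The problem (P) of minimizing $P(\Omega)$ subject to $\mu(\Omega)=1$ has no minimizer, neither among the measurable smooth ($C^\infty$-)sets $\Omega\subset\mathbb{R}^N_+$ nor among the measurable sets $\Omega\subset\mathbb{R}^N_+$ of locally finite perimeter in $\mathbb{R}^N_+$. (ii) For every $R>0$ the half-ball $B_R^+=\{x\in\mathbb{R}^N_+:|x|<R\}$ is stable, in the following sense. A $C^n$-variation is a family of maps $\varphi_t:\mathbb{R}^N_+\to\mathbb{R}^N_+$, $|t|<\varepsilon$, with $\varphi_0=\mathrm{id}$, such that $(x,t)\mapsto\varphi_t(x)$ extends to a $C^n$ map on $\{x_N\ge0\}\times(-\varepsilon,\varepsilon)$ with $\varphi_t(H)\subset H$. It is measure-preserving for $\Omega$ if $\mu(\varphi_t(\Omega))$ is constant for small $t$. Let $p(t)=P(\varphi_t(\Omega))$. A $C^1$-set $\Omega$ is stationary if, for every measure-preserving $C^1$-variation, $p$ is finite near $0$ and $p'(0)=0$ whenever $p$ is differentiable at $0$. A $C^2$-set $\Omega$ is stable if it is stationary and if, for every measure-preserving $C^2$-variation, $p$ is finite and differentiable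 near $0$, twice differentiable at $0$, and $p''(0)\ge0$. -/

import Mathlib

open MeasureTheory Set Filter Topology
open scoped ENNReal

noncomputable section

namespace WeightedIso

/-! The space `ℝ^N` is `EuclideanSpace ℝ (Fin (n + 1))`, that is `N = n + 1`; the coordinate `x_N`
is `x (Fin.last n)`. -/

/-- The open half-space `ℝ^N_+ = {x_N > 0}`. -/
def halfSpace (n : ℕ) : Set (EuclideanSpace ℝ (Fin (n + 1))) :=
  {x | 0 < x (Fin.last n)}

/-- The closed half-space `{x_N ≥ 0}`. -/
def closedHalfSpace (n : ℕ) : Set (EuclideanSpace ℝ (Fin (n + 1))) :=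
  {x | 0 ≤ x (Fin.last n)}

/-- The hyperplane `H = {x_N = 0}`. -/
def hyperplane (n : ℕ) : Set (EuclideanSpace ℝ (Fin (n + 1))) :=
  {x | x (Fin.last n) = 0}

/-- The half-ball `B_R^+ = B_R ∩ ℝ^N_+`. -/
def halfBall (n : ℕ) (R : ℝ) : Set (EuclideanSpace ℝ (Fin (n + 1))) :=
  Metric.ball 0 R ∩ halfSpace n

/-- The density `|x|^s x_N^α` (only used on the open half-space). -/
def weight {n : ℕ} (s α : ℝ) (x : EuclideanSpace ℝ (Fin (n + 1))) : ℝ≥0∞ :=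
  ENNReal.ofReal (‖x‖ ^ s * x (Fin.last n) ^ α)

/-- The weighted measure `μ_{ℓ,α}(M) = ∫_M |x|^ℓ x_N^α dx` of a set `M ⊆ ℝ^N_+`. -/
def wMeasure {n : ℕ} (l α : ℝ) (M : Set (EuclideanSpace ℝ (Fin (n + 1)))) : ℝ≥0∞ :=
  ∫⁻ x in M, weight l α x

/-- The essential boundary of `M`: the points at which `M` has neither density `0` nor
density `1`. -/
def essBoundary {n : ℕ} (M : Set (EuclideanSpace ℝ (Fin (n + 1)))) :
    Set (EuclideanSpace ℝ (Fin (n + 1))) :=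
  {x | ¬ Tendsto (fun r : ℝ => volume (M ∩ Metric.ball x r) / volume (Metric.ball x r))
        (𝓝[>] 0) (𝓝 0) ∧
      ¬ Tendsto (fun r : ℝ => volume (M ∩ Metric.ball x r) / volume (Metric.ball x r))
        (𝓝[>] 0) (𝓝 1)}

/-- The relative weighted perimeter
`P_{μ_{k,α}}(M, ℝ^N_+) = ∫_{∂M ∩ ℝ^N_+} |x|^k x_N^α H_{N-1}(dx)`, where `∂M` is the essential
boundary and `H_{N-1}` the (Euclidean normalized) Hausdorff measure. -/
def wPerimeter {n : ℕ} (k α : ℝ) (M : Set (EuclideanSpace ℝ (Fin (n + 1)))) : ℝ≥0∞ :=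
  ∫⁻ x in essBoundary M ∩ halfSpace n, weight k α x ∂(μHE[n])

/-- The divergence of a vector field. -/
def divergence {n : ℕ} (X : EuclideanSpace ℝ (Fin (n + 1)) → EuclideanSpace ℝ (Fin (n + 1)))
    (x : EuclideanSpace ℝ (Fin (n + 1))) : ℝ :=
  ∑ i, fderiv ℝ X x (EuclideanSpace.single i 1) i

/-- `M` has locally finite perimeter in `ℝ^N_+`. -/
def LocallyFinitePerimeter {n : ℕ} (M : Set (EuclideanSpace ℝ (Fin (n + 1)))) : Prop :=
  ∀ K : Set (EuclideanSpace ℝ (Fin (n + 1))), IsCompact K → K ⊆ halfSpace n →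
    ∃ C : ℝ, ∀ X : EuclideanSpace ℝ (Fin (n + 1)) → EuclideanSpace ℝ (Fin (n + 1)),
      ContDiff ℝ 1 X → tsupport X ⊆ K → (∀ x, ‖X x‖ ≤ 1) → ∫ x in M, divergence X x ≤ C

/-- The Lebesgue measurable sets `M ⊆ ℝ^N_+` of locally finite perimeter. -/
def finitePerimeterSets (n : ℕ) : Set (Set (EuclideanSpace ℝ (Fin (n + 1)))) :=
  {M | M ⊆ halfSpace n ∧ NullMeasurableSet M volume ∧ LocallyFinitePerimeter M}

/-- `Ω ⊆ ℝ^N_+` is a `C^m`-set: every point `x₀` of its boundary inside `ℝ^N_+` has a ball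
`B_r(x₀)` such that `B_r(x₀) ∩ Ω` has exactly one connected component and `B_r(x₀) ∩ ∂Ω` is the
graph, in the direction of some unit vector `v`, of a `C^m`-function on an open subset of the
`(N-1)`-dimensional Euclidean space `v^⊥`. -/
def IsCSet {n : ℕ} (m : ℕ∞) (Ω : Set (EuclideanSpace ℝ (Fin (n + 1)))) : Prop :=
  Ω ⊆ halfSpace n ∧
  ∀ x₀ ∈ essBoundary Ω ∩ halfSpace n, ∃ r : ℝ, 0 < r ∧
    IsConnected (Metric.ball x₀ r ∩ Ω) ∧
    ∃ v : EuclideanSpace ℝ (Fin (n + 1)), ‖v‖ = 1 ∧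
      ∃ (U : Set (ℝ ∙ v)ᗮ) (f : (ℝ ∙ v)ᗮ → ℝ), IsOpen U ∧ ContDiffOn ℝ m f U ∧
        Metric.ball x₀ r ∩ essBoundary Ω =
          (fun y : (ℝ ∙ v)ᗮ => (y : EuclideanSpace ℝ (Fin (n + 1))) + f y • v) '' U

/-- The smooth (that is `C^∞`) sets `Ω ⊆ ℝ^N_+`. -/
def smoothSets (n : ℕ) : Set (Set (EuclideanSpace ℝ (Fin (n + 1)))) :=
  {Ω | NullMeasurableSet Ω volume ∧ IsCSet ⊤ Ω}

/-- `Ω` minimizes `P_{μ_{k,α}}` among the sets of the class `A` with `μ_{ℓ,α}`-measure `1`. -/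
def IsMinimizer {n : ℕ} (k l α : ℝ) (A : Set (Set (EuclideanSpace ℝ (Fin (n + 1)))))
    (Ω : Set (EuclideanSpace ℝ (Fin (n + 1)))) : Prop :=
  Ω ∈ A ∧ wMeasure l α Ω = 1 ∧
    ∀ M ∈ A, wMeasure l α M = 1 → wPerimeter k α Ω ≤ wPerimeter k α M

/-- A one-parameter family of `C^m`-variations `φ_t : ℝ^N_+ → ℝ^N_+`, `|t| < ε`, `φ_0 = id`. The
family is jointly `C^m` up to `H = {x_N = 0}`, and (the extension of) each `φ_t` maps `H` to `H`. -/
structure IsVariation {n : ℕ} (m : ℕ∞) (ε : ℝ)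
    (φ : ℝ → EuclideanSpace ℝ (Fin (n + 1)) → EuclideanSpace ℝ (Fin (n + 1))) : Prop where
  pos : 0 < ε
  contDiffOn : ContDiffOn ℝ m
    (fun q : ℝ × EuclideanSpace ℝ (Fin (n + 1)) => φ q.1 q.2)
    (Ioo (-ε) ε ×ˢ closedHalfSpace n)
  mapsTo_halfSpace : ∀ t ∈ Ioo (-ε) ε, MapsTo (φ t) (halfSpace n) (halfSpace n)
  mapsTo_hyperplane : ∀ t ∈ Ioo (-ε) ε, MapsTo (φ t) (hyperplane n) (hyperplane n)
  zero : ∀ x ∈ halfSpace n, φ 0 x = x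

/-- The variation is measure-preserving for `Ω`: `m(t) = μ_{ℓ,α}(φ_t(Ω))` is constant for
small `t`. -/
def IsMeasurePreserving {n : ℕ} (l α : ℝ)
    (φ : ℝ → EuclideanSpace ℝ (Fin (n + 1)) → EuclideanSpace ℝ (Fin (n + 1)))
    (Ω : Set (EuclideanSpace ℝ (Fin (n + 1)))) : Prop :=
  ∀ᶠ t in 𝓝 (0 : ℝ), wMeasure l α (φ t '' Ω) = wMeasure l α (φ 0 '' Ω)

/-- The perimeter function `p(t) = P_{μ_{k,α}}(φ_t(Ω))` of a variation, as a real number. -/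
def perimeterFun {n : ℕ} (k α : ℝ)
    (φ : ℝ → EuclideanSpace ℝ (Fin (n + 1)) → EuclideanSpace ℝ (Fin (n + 1)))
    (Ω : Set (EuclideanSpace ℝ (Fin (n + 1)))) (t : ℝ) : ℝ :=
  (wPerimeter k α (φ t '' Ω)).toReal

/-- A `C^1`-set `Ω` is stationary if `p'(0) = 0` for the measure-preserving `C^1`-variations of
`Ω`: `p` is finite near `0` and, if it has a derivative at `0` (which joint `C^1` regularity of the
variation alone does not guarantee), this derivative vanishes. -/
def IsStationary {n : ℕ} (k l α : ℝ) (Ω : Set (EuclideanSpace ℝ (Fin (n + 1)))) : Prop :=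
  IsCSet 1 Ω ∧
  ∀ (ε : ℝ) (φ : ℝ → EuclideanSpace ℝ (Fin (n + 1)) → EuclideanSpace ℝ (Fin (n + 1))),
    IsVariation 1 ε φ → IsMeasurePreserving l α φ Ω →
      (∀ᶠ t in 𝓝 (0 : ℝ), wPerimeter k α (φ t '' Ω) ≠ ⊤) ∧
      ∀ c : ℝ, HasDerivAt (perimeterFun k α φ Ω) c 0 → c = 0

/-- A `C^2`-set `Ω` is stable if it is stationary and, for every measure-preserving `C^2`-variation
of `Ω`, the function `p` is finite near `0`, twice differentiable at `0`, and `p''(0) ≥ 0`. -/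
def IsStable {n : ℕ} (k l α : ℝ) (Ω : Set (EuclideanSpace ℝ (Fin (n + 1)))) : Prop :=
  IsCSet 2 Ω ∧ IsStationary k l α Ω ∧
  ∀ (ε : ℝ) (φ : ℝ → EuclideanSpace ℝ (Fin (n + 1)) → EuclideanSpace ℝ (Fin (n + 1))),
    IsVariation 2 ε φ → IsMeasurePreserving l α φ Ω →
      (∀ᶠ t in 𝓝 (0 : ℝ), wPerimeter k α (φ t '' Ω) ≠ ⊤) ∧
      (∀ᶠ t in 𝓝 (0 : ℝ), DifferentiableAt ℝ (perimeterFun k α φ Ω) t) ∧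
      ∃ c : ℝ, HasDerivAt (deriv (perimeterFun k α φ Ω)) c 0 ∧ 0 ≤ c

end WeightedIso

end

/-!
Write `κ = k + n + α` and `λ = l + n + 1 + α`, where the dimension is `N = n + 1`. The hypotheses
give `κ > 0`, `λ > 0`, `(n + 1) κ < n λ` and `κ (λ - κ) ≤ n + α`.

*Nonexistence.* Small balls `B (s e_N, s ρ)` have weighted volume of order `s ^ λ ρ ^ (n + 1)` and
weighted perimeter of order `s ^ κ ρ ^ n`. If the volume is kept equal to `1` while `ρ → 0`, the
perimeter is of order `ρ ^ (n - (n + 1) κ / λ)`, which tends to `0`. These balls are admissible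
(`isCSet_ball`, `locallyFinitePerimeter_ball`), so a minimizer would have perimeter zero. A set whose
essential boundary is negligible in the half-space is null or conull there
(`null_or_conull_of_essBoundary_null`), so its weighted volume is `0` or `∞`
(`not_exists_isMinimizer`). The rigidity statement for general measurable sets is proved along
parallel lines, with a one-dimensional Baire category argument.

*Stability.* For small `t` a variation maps the half-ball to the region below a radial graph
`‖x‖ = exp (W t x)`, where `W t` is homogeneous of degree `0` and `W` is as smooth as the variation,
up to the hyperplane (`IsVariation.exists_radial_param`). The variation is a Lipschitz-small
perturbation of the identity; its degree-one homogeneous extension from the sphere has the same image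
of the half-ball, and the inverse of that extension provides `W`. In the cone coordinates
`(z, s) ↦ s (z, 1)`, with `ν` the measure on the hemisphere with density `x_N ^ α`, the area formula
for injective immersions gives
`P = ∫ exp (κ W) √(1 + ‖∇W‖ ^ 2) dν` and `μ = ∫ exp (λ W) / λ dν`.

Since `P ≥ ∫ exp (κ W) dν` with equality at `t = 0`, stationarity follows from the first derivative
of the volume. Differentiating twice under the integral, with `V = ∂_t W` at time `0`, gives
`p''(0) = R ^ κ ∫ (‖∇V‖ ^ 2 - κ (λ - κ) V ^ 2) dν` with `∫ V dν = 0`. This is nonnegative by the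
Poincaré inequality `(n + α) ∫ V ^ 2 dν ≤ ∫ ‖∇V‖ ^ 2 dν` (`poincare_hemisphere`). That inequality is
the spectral gap of the product measure `x_N ^ α exp (-‖x‖ ^ 2 / 2) dx` on the half-space, applied to
`‖x‖ V (x)`. The gap tensorizes, and its one-dimensional factors are the Gaussian and the half-line
density `t ^ α exp (-t ^ 2 / 2)`, each with gap at least `1`.
-/

namespace WeightedIso

/-! ### Cone coordinates on the half-space -/

/-- The last coordinate vector `e_N`. -/
noncomputable def eLast (n : ℕ) : EuclideanSpace ℝ (Fin (n + 1)) :=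
  EuclideanSpace.single (Fin.last n) 1

/-- The inclusion `z ↦ (z, 0)` of `ℝ^n` into `ℝ^{n+1}`. -/
noncomputable def emb (n : ℕ) : EuclideanSpace ℝ (Fin n) →L[ℝ] EuclideanSpace ℝ (Fin (n + 1)) :=
  LinearMap.toContinuousLinearMap
    { toFun := fun z => WithLp.toLp 2 (Fin.snoc (α := fun _ => ℝ) z.ofLp 0)
      map_add' := by
        intro x y
        ext i
        refine Fin.lastCases ?_ (fun j => ?_) i <;> simp
      map_smul' := by
        intro c x
        ext i
        refine Fin.lastCases ?_ (fun j => ?_) i <;> simp }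

variable {n : ℕ}

@[simp] lemma emb_last (z : EuclideanSpace ℝ (Fin n)) : emb n z (Fin.last n) = 0 := by
  simp [emb]

@[simp] lemma emb_castSucc (z : EuclideanSpace ℝ (Fin n)) (i : Fin n) :
    emb n z i.castSucc = z i := by
  simp [emb]

@[simp] lemma eLast_last : eLast n (Fin.last n) = 1 := by simp [eLast]

@[simp] lemma eLast_castSucc (i : Fin n) : eLast n i.castSucc = 0 := by
  simp [eLast]

@[simp] lemma norm_eLast : ‖eLast n‖ = 1 := by simp [eLast]

/-- The points `(z, 1)`, which parametrize the rays in the open half-space. -/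
noncomputable def vec (z : EuclideanSpace ℝ (Fin n)) : EuclideanSpace ℝ (Fin (n + 1)) :=
  emb n z + eLast n

@[simp] lemma vec_last (z : EuclideanSpace ℝ (Fin n)) : vec z (Fin.last n) = 1 := by simp [vec]

@[simp] lemma vec_castSucc (z : EuclideanSpace ℝ (Fin n)) (i : Fin n) :
    vec z i.castSucc = z i := by
  simp [vec]

lemma norm_emb_add_smul_sq (z : EuclideanSpace ℝ (Fin n)) (s : ℝ) :
    ‖emb n z + s • eLast n‖ ^ 2 = ‖z‖ ^ 2 + s ^ 2 := by
  rw [EuclideanSpace.norm_sq_eq, EuclideanSpace.norm_sq_eq, Fin.sum_univ_castSucc]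
  simp

@[simp] lemma norm_emb (z : EuclideanSpace ℝ (Fin n)) : ‖emb n z‖ = ‖z‖ := by
  have := norm_emb_add_smul_sq z 0
  simp only [zero_smul, add_zero, ne_eq, OfNat.ofNat_ne_zero, not_false_eq_true, zero_pow] at this
  exact (sq_eq_sq₀ (norm_nonneg _) (norm_nonneg _)).1 this

lemma norm_vec (z : EuclideanSpace ℝ (Fin n)) : ‖vec z‖ = √(1 + ‖z‖ ^ 2) := by
  have := norm_emb_add_smul_sq z 1
  rw [one_smul] at this
  rw [vec, ← Real.sqrt_sq (norm_nonneg _), this]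
  congr 1
  ring

lemma norm_vec_sq (z : EuclideanSpace ℝ (Fin n)) : ‖vec z‖ ^ 2 = 1 + ‖z‖ ^ 2 := by
  rw [norm_vec, Real.sq_sqrt (by positivity)]

lemma norm_vec_pos (z : EuclideanSpace ℝ (Fin n)) : 0 < ‖vec z‖ := by
  rw [norm_vec]; positivity

lemma continuous_vec : Continuous (vec : EuclideanSpace ℝ (Fin n) → _) := by
  unfold vec; fun_prop

lemma vec_mem_halfSpace (z : EuclideanSpace ℝ (Fin n)) : vec z ∈ halfSpace n := by
  simp [halfSpace]

lemma inner_emb_emb (z w : EuclideanSpace ℝ (Fin n)) : inner ℝ (emb n z) (emb n w) = inner ℝ z w := by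
  simp only [PiLp.inner_apply, Fin.sum_univ_castSucc]
  simp

lemma inner_emb_vec (z w : EuclideanSpace ℝ (Fin n)) : inner ℝ (emb n z) (vec w) = inner ℝ z w := by
  simp only [PiLp.inner_apply, Fin.sum_univ_castSucc]
  simp

/-- The measurable equivalence `(s, z) ↦ (z, s)` between `ℝ × ℝ^n` and `ℝ^{n+1}`. -/
noncomputable def heightEquiv (n : ℕ) :
    ℝ × EuclideanSpace ℝ (Fin n) ≃ᵐ EuclideanSpace ℝ (Fin (n + 1)) :=
  ((MeasurableEquiv.refl ℝ).prodCongr (MeasurableEquiv.toLp 2 (Fin n → ℝ)).symm).trans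
    ((MeasurableEquiv.piFinSuccAbove (fun _ => ℝ) (Fin.last n)).symm.trans
      (MeasurableEquiv.toLp 2 (Fin (n + 1) → ℝ)))

lemma heightEquiv_apply (p : ℝ × EuclideanSpace ℝ (Fin n)) :
    heightEquiv n p = emb n p.2 + p.1 • eLast n := by
  ext i
  refine Fin.lastCases ?_ (fun j => ?_) i
  · simp [heightEquiv, MeasurableEquiv.piFinSuccAbove, Fin.insertNthEquiv]
    rfl
  · simp [heightEquiv, MeasurableEquiv.piFinSuccAbove, Fin.insertNthEquiv]
    rfl

lemma measurePreserving_heightEquiv (n : ℕ) : MeasurePreserving (heightEquiv n) volume volume := by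
  have h1 : MeasurePreserving
      ((MeasurableEquiv.refl ℝ).prodCongr (MeasurableEquiv.toLp 2 (Fin n → ℝ)).symm)
      (volume : Measure (ℝ × EuclideanSpace ℝ (Fin n))) volume :=
    (MeasurePreserving.id volume).prod (EuclideanSpace.volume_preserving_symm_measurableEquiv_toLp _)
  have h2 := (volume_preserving_piFinSuccAbove (fun _ : Fin (n + 1) => ℝ) (Fin.last n)).symm
  have h3 := (EuclideanSpace.volume_preserving_symm_measurableEquiv_toLp (Fin (n + 1))).symm
  exact h1.trans (h2.trans h3)

/-- Fubini's theorem in the splitting `ℝ^{n+1} = ℝ^n × ℝ e_N`. -/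
lemma lintegral_height {g : EuclideanSpace ℝ (Fin (n + 1)) → ℝ≥0∞} (hg : Measurable g) :
    ∫⁻ x, g x = ∫⁻ s : ℝ, ∫⁻ z : EuclideanSpace ℝ (Fin n), g (emb n z + s • eLast n) := by
  rw [← (measurePreserving_heightEquiv n).lintegral_comp hg, Measure.volume_eq_prod,
    lintegral_prod (fun p => g (heightEquiv n p)) (hg.comp (heightEquiv n).measurable).aemeasurable]
  simp [heightEquiv_apply]

lemma lintegral_comp_smul {g : EuclideanSpace ℝ (Fin n) → ℝ≥0∞} (hg : Measurable g) {s : ℝ}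
    (hs : 0 < s) : ∫⁻ z, g z = ENNReal.ofReal (s ^ n) * ∫⁻ z, g (s • z) := by
  have h := Measure.map_addHaar_smul (volume : Measure (EuclideanSpace ℝ (Fin n))) hs.ne'
  have h2 : ∫⁻ z, g (s • z) = ∫⁻ z, g z ∂(Measure.map (s • ·) volume) :=
    (lintegral_map hg (measurable_const_smul s)).symm
  rw [h2, h, lintegral_smul_measure, finrank_euclideanSpace_fin, abs_of_pos (by positivity),
    smul_eq_mul, ← mul_assoc, ← ENNReal.ofReal_mul (by positivity), mul_inv_cancel₀ (by positivity)]
  simp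

lemma measurableSet_halfSpace : MeasurableSet (halfSpace n) := by
  have : Measurable fun x : EuclideanSpace ℝ (Fin (n + 1)) => x (Fin.last n) := by fun_prop
  exact measurableSet_lt measurable_const this

lemma isOpen_halfSpace : IsOpen (halfSpace n) :=
  isOpen_lt continuous_const (by fun_prop)

lemma convex_halfSpace : Convex ℝ (halfSpace n) := by
  intro x hx y hy a b ha hb hab
  simp only [halfSpace, mem_ofPred_eq, PiLp.add_apply, PiLp.smul_apply, smul_eq_mul] at *
  rcases ha.eq_or_lt with rfl | ha
  · have : b = 1 := by linarith
    simp [this, hy]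
  · positivity

/-- Integration over the half-space in the cone coordinates `x = s (z, 1)`. -/
lemma lintegral_halfSpace_cone {g : EuclideanSpace ℝ (Fin (n + 1)) → ℝ≥0∞} (hg : Measurable g) :
    ∫⁻ x in halfSpace n, g x =
      ∫⁻ z : EuclideanSpace ℝ (Fin n), ∫⁻ s in Ioi (0 : ℝ),
        ENNReal.ofReal (s ^ n) * g (s • vec z) := by
  rw [← lintegral_indicator measurableSet_halfSpace, lintegral_height (hg.indicator measurableSet_halfSpace)]
  have hm : Measurable fun p : ℝ × EuclideanSpace ℝ (Fin n) =>
      ENNReal.ofReal (p.1 ^ n) * g (p.1 • vec p.2) := by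
    have : Measurable fun p : ℝ × EuclideanSpace ℝ (Fin n) => p.1 • vec p.2 :=
      (continuous_fst.smul (continuous_vec.comp continuous_snd)).measurable
    exact (by fun_prop : Measurable fun p : ℝ × EuclideanSpace ℝ (Fin n) =>
      ENNReal.ofReal (p.1 ^ n)).mul (hg.comp this)
  rw [lintegral_lintegral_swap (f := fun z s => ENNReal.ofReal (s ^ n) * g (s • vec z))
    (hm.comp measurable_swap).aemeasurable, ← lintegral_indicator measurableSet_Ioi]
  refine lintegral_congr fun s => ?_
  by_cases hs : s ∈ Ioi (0 : ℝ)
  · rw [indicator_of_mem hs]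
    have hgm : Measurable fun z : EuclideanSpace ℝ (Fin n) => g (emb n z + s • eLast n) := by
      refine hg.comp (Continuous.measurable ?_)
      fun_prop
    have h1 : ∀ z : EuclideanSpace ℝ (Fin n),
        (halfSpace n).indicator g (emb n z + s • eLast n) = g (emb n z + s • eLast n) := by
      intro z
      refine indicator_of_mem ?_ _
      simpa [halfSpace] using hs
    simp_rw [h1]
    rw [lintegral_comp_smul hgm hs, lintegral_const_mul]
    · simp [vec, smul_add]
    · refine hg.comp (Continuous.measurable ?_)
      exact continuous_vec.const_smul s
  · rw [indicator_of_notMem hs]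
    have h1 : ∀ z : EuclideanSpace ℝ (Fin n),
        (halfSpace n).indicator g (emb n z + s • eLast n) = 0 := by
      intro z
      refine indicator_of_notMem ?_ _
      simpa [halfSpace] using hs
    simp [h1]

/-! ### The area formula for injective immersions -/

section Area

open scoped NNReal

/-- If `f` expands distances on `A` at most `C` times as much as `g` does, then the `d`-dimensional
measure of `f '' A` is at most `C ^ d` times that of `g '' A`. -/
lemma euclideanHausdorff_image_le_of_edist_le {X Y Z : Type*} [EMetricSpace Y] [MeasurableSpace Y]
    [BorelSpace Y] [EMetricSpace Z] [MeasurableSpace Z] [BorelSpace Z] {f : X → Y} {g : X → Z}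
    {A : Set X} {C : ℝ≥0} (d : ℕ)
    (h : ∀ x ∈ A, ∀ y ∈ A, edist (f x) (f y) ≤ C * edist (g x) (g y)) :
    μHE[d] (f '' A) ≤ (C : ℝ≥0∞) ^ d * μHE[d] (g '' A) := by
  rcases A.eq_empty_or_nonempty with rfl | ⟨a, ha⟩
  · simp
  have : Nonempty X := ⟨a⟩
  have hinv : ∀ x ∈ A, Function.invFunOn g A (g x) ∈ A ∧ g (Function.invFunOn g A (g x)) = g x :=
    fun x hx => ⟨Function.invFunOn_mem ⟨x, hx, rfl⟩, Function.invFunOn_eq ⟨x, hx, rfl⟩⟩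
  have hlip : LipschitzOnWith C (f ∘ Function.invFunOn g A) (g '' A) := by
    rintro _ ⟨x, hx, rfl⟩ _ ⟨y, hy, rfl⟩
    have := h _ (hinv x hx).1 _ (hinv y hy).1
    rwa [(hinv x hx).2, (hinv y hy).2] at this
  have himg : (f ∘ Function.invFunOn g A) '' (g '' A) = f '' A := by
    rw [image_image]
    refine image_congr fun x hx => ?_
    have := h _ (hinv x hx).1 _ hx
    rw [(hinv x hx).2, edist_self, mul_zero, nonpos_iff_eq_zero, edist_eq_zero] at this
    exact this
  have := hlip.hausdorffMeasure_image_le (d := (d : ℝ)) (by positivity)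
  rw [himg, ENNReal.rpow_natCast] at this
  simp only [Measure.euclideanHausdorffMeasure_def, Measure.smul_apply]
  rw [ENNReal.smul_def, ENNReal.smul_def, smul_eq_mul, smul_eq_mul, mul_left_comm]
  gcongr

variable {n : ℕ} {E : Type*} [NormedAddCommGroup E] [InnerProductSpace ℝ E] [MeasurableSpace E]
  [BorelSpace E]

/-- Near a point of strict differentiability with injective derivative `L`, the `n`-dimensional
measure of images is up to a factor close to `1` that of the images under `L`. -/
lemma exists_ball_hausdorff_image_bounds {f : EuclideanSpace ℝ (Fin n) → E}
    {L : EuclideanSpace ℝ (Fin n) →L[ℝ] E} {z : EuclideanSpace ℝ (Fin n)}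
    (hf : HasStrictFDerivAt f L z) (hL : Function.Injective L) {C : ℝ≥0} (hC : 1 < C) :
    ∃ ρ > 0, ∀ A ⊆ Metric.ball z ρ,
      μHE[n] (f '' A) ≤ (C : ℝ≥0∞) ^ n * (ENNReal.ofReal L.normDet * volume A) ∧
      ENNReal.ofReal L.normDet * volume A ≤ (C : ℝ≥0∞) ^ n * μHE[n] (f '' A) := by
  obtain ⟨K, hK, hanti⟩ := L.toLinearMap.exists_antilipschitzWith (LinearMap.ker_eq_bot.2 hL)
  have hC0 : (0 : ℝ) < C := lt_trans zero_lt_one (by exact_mod_cast hC)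
  have hC1 : (0 : ℝ) < C - 1 := sub_pos.2 (by exact_mod_cast hC)
  have hK0 : (0 : ℝ) < K := by exact_mod_cast hK
  -- with this error constant, `‖f x - f y - L (x - y)‖ ≤ (C - 1) / C * ‖L (x - y)‖`, so `f` and `L`
  -- distort distances by at most the factor `C` relative to each other
  set c : ℝ := (C - 1) / (C * K) with hc
  have hc0 : 0 < c := by positivity
  obtain ⟨s, hs, happ⟩ := hf.approximates_deriv_on_nhds (c := ⟨c, hc0.le⟩) (Or.inr hc0)
  obtain ⟨ρ, hρ, hball⟩ := Metric.mem_nhds_iff.1 hs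
  have hcK : c * K = (C - 1) / C := by rw [hc]; field_simp
  have key : ∀ x ∈ Metric.ball z ρ, ∀ y ∈ Metric.ball z ρ,
      ‖f x - f y - L (x - y)‖ ≤ (C - 1) / C * ‖L (x - y)‖ := by
    intro x hx y hy
    have h1 := happ x (hball hx) y (hball hy)
    have h2 := hanti.le_mul_dist x y
    rw [dist_eq_norm, dist_eq_norm] at h2
    change ‖x - y‖ ≤ K * ‖L x - L y‖ at h2
    rw [← map_sub] at h2
    calc _ ≤ c * ‖x - y‖ := h1
      _ ≤ c * (K * ‖L (x - y)‖) := by gcongr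
      _ = _ := by rw [← mul_assoc, hcK]
  have hvol : ∀ A : Set (EuclideanSpace ℝ (Fin n)),
      μHE[n] (L '' A) = ENNReal.ofReal L.normDet * volume A := by
    intro A
    have := L.toLinearMap.euclideanHausdorffMeasure_image_eq_normDet_mul_volume A
    rwa [finrank_euclideanSpace_fin] at this
  refine ⟨ρ, hρ, fun A hA => ?_⟩
  rw [← hvol A]
  have toE : ∀ {a b : E} {a' b' : E}, ‖a - b‖ ≤ C * ‖a' - b'‖ → edist a b ≤ C * edist a' b' := by
    intro a b a' b' h
    rw [edist_dist, edist_dist, dist_eq_norm, dist_eq_norm, ← ENNReal.ofReal_coe_nnreal,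
      ← ENNReal.ofReal_mul hC0.le]
    exact ENNReal.ofReal_le_ofReal h
  constructor
  · refine euclideanHausdorff_image_le_of_edist_le n fun x hx y hy => toE ?_
    have h := key x (hA hx) y (hA hy)
    rw [← map_sub]
    have h3 := norm_le_norm_add_norm_sub' (f x - f y) (L (x - y))
    have h4 : (C - 1 : ℝ) / C ≤ C - 1 := div_le_self hC1.le (by linarith)
    nlinarith [norm_nonneg (L (x - y))]
  · refine euclideanHausdorff_image_le_of_edist_le n fun x hx y hy => toE ?_
    have h := key x (hA hx) y (hA hy)
    rw [← map_sub]
    have h3 := norm_le_norm_add_norm_sub (f x - f y) (L (x - y))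
    have h4 : (C - 1 : ℝ) / C = 1 - 1 / C := by field_simp
    rw [h4] at h
    have h5 : 1 / (C : ℝ) * ‖L (x - y)‖ ≤ ‖f x - f y‖ := by linarith
    rw [div_mul_eq_mul_div, one_mul, div_le_iff₀ hC0] at h5
    linarith

/-- **Area formula** for an injective immersion of `ℝ^n`. -/
theorem lintegral_range_immersion {f : EuclideanSpace ℝ (Fin n) → E}
    {f' : EuclideanSpace ℝ (Fin n) → EuclideanSpace ℝ (Fin n) →L[ℝ] E}
    (hf : ∀ z, HasStrictFDerivAt f (f' z) z) (hinj : Function.Injective f)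
    (hinj' : ∀ z, Function.Injective (f' z)) {g : E → ℝ≥0∞} (hg : Measurable g) :
    ∫⁻ y in range f, g y ∂μHE[n] =
      ∫⁻ z, ENNReal.ofReal (f' z).normDet * g (f z) := by
  have hcont : Continuous f := continuous_iff_continuousAt.2 fun z => (hf z).continuousAt
  have hemb : MeasurableEmbedding f := hcont.measurableEmbedding hinj
  set η : Measure (EuclideanSpace ℝ (Fin n)) := (μHE[n] : Measure E).comap f with hη
  have hηapp : ∀ A : Set (EuclideanSpace ℝ (Fin n)), η A = μHE[n] (f '' A) :=
    fun A => hemb.comap_apply _ A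
  have : IsLocallyFiniteMeasure η := by
    refine ⟨fun z => ?_⟩
    obtain ⟨ρ, hρ, h⟩ := exists_ball_hausdorff_image_bounds (hf z) (hinj' z) (C := 2) (by norm_num)
    refine ⟨Metric.ball z ρ, Metric.ball_mem_nhds _ hρ, ?_⟩
    rw [hηapp]
    refine (h _ subset_rfl).1.trans_lt ?_
    refine ENNReal.mul_lt_top (by finiteness) (ENNReal.mul_lt_top ENNReal.ofReal_lt_top ?_)
    exact measure_ball_lt_top
  have hac : η ≪ volume := by
    refine Measure.AbsolutelyContinuous.mk fun A _ hA => ?_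
    refine measure_null_of_locally_null _ fun z _ => ?_
    obtain ⟨ρ, hρ, h⟩ := exists_ball_hausdorff_image_bounds (hf z) (hinj' z) (C := 2) (by norm_num)
    refine ⟨A ∩ Metric.ball z ρ, inter_mem_nhdsWithin _ (Metric.ball_mem_nhds _ hρ), ?_⟩
    rw [hηapp]
    refine le_antisymm ((h _ inter_subset_right).1.trans ?_) zero_le
    rw [measure_mono_null inter_subset_left hA]
    simp
  -- the density of the pulled back measure is the limit of the ratios over small balls
  have hder : η.rnDeriv volume =ᵐ[volume]
      fun z => ENNReal.ofReal (f' z).normDet := by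
    filter_upwards [Besicovitch.ae_tendsto_rnDeriv η volume] with z hz
    set J := ENNReal.ofReal (f' z).normDet with hJ
    set Λ := η.rnDeriv volume z
    have hbd : ∀ C : ℝ≥0, 1 < C → Λ ≤ (C : ℝ≥0∞) ^ n * J ∧ J ≤ (C : ℝ≥0∞) ^ n * Λ := by
      intro C hC
      obtain ⟨ρ, hρ, h⟩ := exists_ball_hausdorff_image_bounds (hf z) (hinj' z) hC
      have hev : ∀ᶠ r in 𝓝[>] (0 : ℝ),
          η (Metric.closedBall z r) / volume (Metric.closedBall z r) ≤ (C : ℝ≥0∞) ^ n * J ∧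
          J ≤ (C : ℝ≥0∞) ^ n * (η (Metric.closedBall z r) / volume (Metric.closedBall z r)) := by
        filter_upwards [Ioo_mem_nhdsGT hρ] with r hr
        have hA : Metric.closedBall z r ⊆ Metric.ball z ρ := Metric.closedBall_subset_ball hr.2
        have h0 : volume (Metric.closedBall z r) ≠ 0 := (Metric.measure_closedBall_pos _ _ hr.1).ne'
        have ht : volume (Metric.closedBall z r) ≠ ∞ := measure_closedBall_lt_top.ne
        obtain ⟨h1, h2⟩ := h _ hA
        rw [← hηapp] at h1 h2
        constructor
        · rw [ENNReal.div_le_iff h0 ht, mul_assoc]; exact h1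
        · rw [← mul_div_assoc, ENNReal.le_div_iff_mul_le (Or.inl h0) (Or.inl ht)]; exact h2
      refine ⟨le_of_tendsto hz (hev.mono fun r hr => hr.1), ?_⟩
      refine ge_of_tendsto (ENNReal.Tendsto.const_mul hz (Or.inr (by finiteness)))
        (hev.mono fun r hr => hr.2)
    have hlim : ∀ x : ℝ≥0∞, Tendsto (fun C : ℝ≥0 => (C : ℝ≥0∞) ^ n * x) (𝓝[>] 1) (𝓝 x) := by
      intro x
      have h1 : Tendsto (fun C : ℝ≥0 => (C : ℝ≥0∞) ^ n) (𝓝[>] 1) (𝓝 1) := by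
        have : Continuous fun C : ℝ≥0 => (C : ℝ≥0∞) ^ n := by
          simp_rw [← ENNReal.coe_pow]
          exact ENNReal.continuous_coe.comp (continuous_pow n)
        have h2 := (this.tendsto 1).mono_left (nhdsWithin_le_nhds (s := Ioi 1))
        simpa using h2
      simpa using ENNReal.Tendsto.mul_const h1 (Or.inl one_ne_zero)
    have hne : (𝓝[>] (1 : ℝ≥0)).NeBot := inferInstance
    refine le_antisymm (ge_of_tendsto (hlim J) ?_) (ge_of_tendsto (hlim Λ) ?_)
    · filter_upwards [self_mem_nhdsWithin] with C hC using (hbd C hC).1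
    · filter_upwards [self_mem_nhdsWithin] with C hC using (hbd C hC).2
  have hmap : η.map f = (μHE[n] : Measure E).restrict (range f) := hemb.map_comap _
  rw [← hmap, lintegral_map hg hcont.measurable, ← Measure.withDensity_rnDeriv_eq η volume hac,
    lintegral_withDensity_eq_lintegral_mul (g := fun z => g (f z)) _
      (Measure.measurable_rnDeriv _ _) (hg.comp hcont.measurable)]
  refine lintegral_congr_ae ?_
  filter_upwards [hder] with z hz
  simp [hz]

end Area

/-! ### The area of radial graphs -/

section RadialGraph

variable {n : ℕ}

/-- The derivative of `z ↦ h (z, 1)` when `h` has the value `a` and the gradient `p`. -/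
noncomputable def radialDeriv (a : ℝ) (p z : EuclideanSpace ℝ (Fin n)) :
    EuclideanSpace ℝ (Fin n) →L[ℝ] EuclideanSpace ℝ (Fin (n + 1)) :=
  a • emb n + (innerSL ℝ p).smulRight (vec z)

lemma radialDeriv_apply (a : ℝ) (p z w : EuclideanSpace ℝ (Fin n)) :
    radialDeriv a p z w = a • emb n w + inner ℝ p w • vec z := by
  simp [radialDeriv]

lemma radialDeriv_injective {a : ℝ} (ha : a ≠ 0) (p z : EuclideanSpace ℝ (Fin n)) :
    Function.Injective (radialDeriv a p z) := by
  rw [injective_iff_map_eq_zero]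
  intro w hw
  rw [radialDeriv_apply] at hw
  have h1 : inner ℝ p w = 0 := by
    have := congrArg (fun x : EuclideanSpace ℝ (Fin (n + 1)) => x (Fin.last n)) hw
    simpa using this
  rw [h1, zero_smul, add_zero, smul_eq_zero] at hw
  have := norm_emb w
  rw [hw.resolve_left ha, norm_zero] at this
  exact norm_eq_zero.1 this.symm

lemma normDet_radialDeriv_sq {a : ℝ} (ha : a ≠ 0) (p z : EuclideanSpace ℝ (Fin n)) :
    (radialDeriv a p z).normDet ^ 2 =
      a ^ (2 * n) * ((1 + inner ℝ z p / a) ^ 2 + ‖p‖ ^ 2 / a ^ 2) := by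
  have h := (radialDeriv a p z).toLinearMap.normDet_sq_eq_det_gram
    (EuclideanSpace.basisFun (Fin n) ℝ)
  simp only [RCLike.ofReal_real_eq_id, id] at h
  rw [h]
  set A : Matrix (Fin n) (Fin 2) ℝ := Matrix.of fun i j => if j = 0 then z i else p i with hA
  set B : Matrix (Fin 2) (Fin n) ℝ := Matrix.of fun j i =>
    if j = 0 then p i / a else z i / a + ‖vec z‖ ^ 2 * p i / a ^ 2 with hB
  have hgram : (Matrix.gram ℝ fun x => (radialDeriv a p z).toLinearMap
      (EuclideanSpace.basisFun (Fin n) ℝ x)) = (a ^ 2) • (1 + A * B) := by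
    ext i j
    have hz : ∀ x y : EuclideanSpace ℝ (Fin n), inner ℝ (emb n x) (emb n y) = inner ℝ x y :=
      inner_emb_emb
    simp only [Matrix.gram_apply, ContinuousLinearMap.coe_coe, radialDeriv_apply,
      EuclideanSpace.basisFun_apply, inner_add_left, inner_add_right, inner_smul_left,
      inner_smul_right, hz, inner_emb_vec, real_inner_comm (emb n _) (vec _),
      real_inner_self_eq_norm_sq, Matrix.smul_apply, Matrix.add_apply, Matrix.mul_apply,
      Fin.sum_univ_two, hA, hB, Matrix.of_apply, Matrix.one_apply]
    simp only [EuclideanSpace.inner_single_left, EuclideanSpace.inner_single_right]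
    simp [eq_comm]
    split_ifs <;> field_simp <;> ring
  have e1 : ∑ i, p i * z i = inner ℝ z p := by
    simp [PiLp.inner_apply]
  have e2 : ∑ i, p i * p i = ‖p‖ ^ 2 := by
    rw [EuclideanSpace.norm_sq_eq]; simp [sq]
  have e3 : ∑ i, z i * z i = ‖z‖ ^ 2 := by
    rw [EuclideanSpace.norm_sq_eq]; simp [sq]
  have h00 : (B * A) 0 0 = inner ℝ z p / a := by
    rw [← e1, Finset.sum_div, Matrix.mul_apply]
    exact Finset.sum_congr rfl fun i _ => by simp [hA, hB]; ring
  have h01 : (B * A) 0 1 = ‖p‖ ^ 2 / a := by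
    rw [← e2, Finset.sum_div, Matrix.mul_apply]
    exact Finset.sum_congr rfl fun i _ => by simp [hA, hB]; ring
  have h10 : (B * A) 1 0 = ‖z‖ ^ 2 / a + ‖vec z‖ ^ 2 * inner ℝ z p / a ^ 2 := by
    rw [← e1, ← e3, Finset.sum_div, Finset.mul_sum, Finset.sum_div, ← Finset.sum_add_distrib,
      Matrix.mul_apply]
    exact Finset.sum_congr rfl fun i _ => by simp [hA, hB]; ring
  have h11 : (B * A) 1 1 = inner ℝ z p / a + ‖vec z‖ ^ 2 * ‖p‖ ^ 2 / a ^ 2 := by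
    rw [← e1, ← e2, Finset.sum_div, Finset.mul_sum, Finset.sum_div, ← Finset.sum_add_distrib,
      Matrix.mul_apply]
    exact Finset.sum_congr rfl fun i _ => by simp [hA, hB]; ring
  rw [hgram, Matrix.det_smul, Fintype.card_fin, Matrix.det_one_add_mul_comm, Matrix.det_fin_two]
  simp only [Matrix.add_apply, h00, h01, h10, h11, norm_vec_sq]
  simp only [Matrix.one_apply_eq, ne_eq, one_ne_zero, zero_ne_one, not_false_eq_true, Matrix.one_apply_ne]
  rw [pow_mul]
  field_simp
  ring

end RadialGraph

/-! ### Weighted measure and area of the region below a radial graph -/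

section RadialIntegrals

variable {n : ℕ}

/-- The direction `(z, 1) / |(z, 1)|`, which parametrizes the open upper hemisphere by `ℝ^n`. -/
noncomputable def dir (z : EuclideanSpace ℝ (Fin n)) : EuclideanSpace ℝ (Fin (n + 1)) :=
  ‖vec z‖⁻¹ • vec z

lemma norm_dir (z : EuclideanSpace ℝ (Fin n)) : ‖dir z‖ = 1 := by
  rw [dir, norm_smul, norm_inv, norm_norm, inv_mul_cancel₀ (norm_vec_pos z).ne']

lemma dir_mem_halfSpace (z : EuclideanSpace ℝ (Fin n)) : dir z ∈ halfSpace n := by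
  simp [halfSpace, dir, norm_vec_pos z]

lemma continuous_dir : Continuous (dir : EuclideanSpace ℝ (Fin n) → _) :=
  (continuous_vec.norm.inv₀ fun z => (norm_vec_pos z).ne').smul continuous_vec

/-- The image in the chart `dir` of the measure `θ_N^α dH_n(θ)` on the open upper hemisphere. -/
noncomputable def sphereMeasure (n : ℕ) (α : ℝ) : Measure (EuclideanSpace ℝ (Fin n)) :=
  volume.withDensity fun z => ENNReal.ofReal (‖vec z‖ ^ (-(n + 1 + α)))

lemma measurable_norm_vec_rpow (r : ℝ) :
    Measurable fun z : EuclideanSpace ℝ (Fin n) => ‖vec z‖ ^ r :=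
  (continuous_vec.norm.measurable).pow_const r

lemma isFiniteMeasure_sphereMeasure {α : ℝ} (hα : -1 < α) :
    IsFiniteMeasure (sphereMeasure n α) := by
  refine isFiniteMeasure_withDensity_ofReal ?_
  have h := integrable_rpow_neg_one_add_norm_sq (E := EuclideanSpace ℝ (Fin n)) (μ := volume)
    (r := n + 1 + α) (by rw [finrank_euclideanSpace_fin]; linarith)
  refine (h.congr (Eventually.of_forall fun z => ?_)).2
  simp only
  rw [← norm_vec_sq, ← Real.rpow_natCast, ← Real.rpow_mul (norm_nonneg _)]
  congr 1
  push_cast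
  ring

lemma lintegral_sphereMeasure (α : ℝ) {g : EuclideanSpace ℝ (Fin n) → ℝ≥0∞} (hg : Measurable g) :
    ∫⁻ z, g z ∂(sphereMeasure n α) =
      ∫⁻ z, ENNReal.ofReal (‖vec z‖ ^ (-(n + 1 + α))) * g z := by
  rw [sphereMeasure, lintegral_withDensity_eq_lintegral_mul _ _ hg]
  · rfl
  · exact (measurable_norm_vec_rpow _).ennreal_ofReal

lemma measurable_weight (s α : ℝ) :
    Measurable (weight s α : EuclideanSpace ℝ (Fin (n + 1)) → ℝ≥0∞) := by
  unfold weight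
  have h : Measurable fun x : EuclideanSpace ℝ (Fin (n + 1)) => x (Fin.last n) := by fun_prop
  exact ((measurable_norm.pow_const s).mul (h.pow_const α)).ennreal_ofReal

/-- The function `W` is positively homogeneous of degree `0` on the half-space. -/
def IsHomog (W : EuclideanSpace ℝ (Fin (n + 1)) → ℝ) : Prop :=
  ∀ x ∈ halfSpace n, ∀ c : ℝ, 0 < c → W (c • x) = W x

lemma smul_mem_halfSpace {x : EuclideanSpace ℝ (Fin (n + 1))} (hx : x ∈ halfSpace n) {c : ℝ}
    (hc : 0 < c) : c • x ∈ halfSpace n := by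
  simp only [halfSpace, mem_ofPred_eq, PiLp.smul_apply, smul_eq_mul] at *
  positivity

lemma IsHomog.vec_eq {W : EuclideanSpace ℝ (Fin (n + 1)) → ℝ} (hW : IsHomog W)
    (z : EuclideanSpace ℝ (Fin n)) : W (vec z) = W (dir z) :=
  (hW _ (vec_mem_halfSpace z) _ (inv_pos.2 (norm_vec_pos z))).symm

/-- The weighted measure of the region below a radial graph. -/
lemma wMeasure_radial {l α : ℝ} (hl : 0 < l + n + 1 + α)
    {W : EuclideanSpace ℝ (Fin (n + 1)) → ℝ} (hW : IsHomog W)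
    (hWm : Measurable fun z : EuclideanSpace ℝ (Fin n) => W (dir z))
    (hS : MeasurableSet {x | x ∈ halfSpace n ∧ ‖x‖ < Real.exp (W x)}) :
    wMeasure l α {x | x ∈ halfSpace n ∧ ‖x‖ < Real.exp (W x)} =
      ∫⁻ z, ENNReal.ofReal (Real.exp ((l + n + 1 + α) * W (dir z)) / (l + n + 1 + α))
        ∂(sphereMeasure n α) := by
  set S := {x | x ∈ halfSpace n ∧ ‖x‖ < Real.exp (W x)} with hSdef
  have hSU : S ∩ halfSpace n = S := inter_eq_left.2 fun x hx => hx.1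
  rw [wMeasure, ← hSU, ← setLIntegral_indicator hS,
    lintegral_halfSpace_cone ((measurable_weight l α).indicator hS), lintegral_sphereMeasure]
  swap
  · exact (((hWm.const_mul _).exp).div_const _).ennreal_ofReal
  refine lintegral_congr fun z => ?_
  set q := ‖vec z‖ with hq
  have hq0 : 0 < q := norm_vec_pos z
  set b : ℝ := Real.exp (W (dir z)) / q with hb
  have hb0 : 0 < b := by positivity
  have h1 : ∀ s ∈ Ioi (0 : ℝ), ENNReal.ofReal (s ^ n) * S.indicator (weight l α) (s • vec z) =
      (Iio b).indicator (fun s => ENNReal.ofReal (q ^ l * s ^ (l + n + α))) s := by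
    intro s hs
    have hs0 : 0 < s := hs
    have hmem : s • vec z ∈ S ↔ s ∈ Iio b := by
      rw [hSdef, mem_ofPred_eq, hW _ (vec_mem_halfSpace z) s hs0, hW.vec_eq, norm_smul,
        Real.norm_of_nonneg hs0.le, mem_Iio, hb, lt_div_iff₀ hq0]
      exact and_iff_right (smul_mem_halfSpace (vec_mem_halfSpace z) hs0)
    by_cases h : s ∈ Iio b
    · rw [indicator_of_mem h, indicator_of_mem (hmem.2 h), weight, ← ENNReal.ofReal_mul (by positivity)]
      congr 1
      rw [norm_smul, Real.norm_of_nonneg hs0.le, PiLp.smul_apply, vec_last, smul_eq_mul, mul_one,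
        Real.mul_rpow hs0.le hq0.le, Real.rpow_add hs0, Real.rpow_add hs0, Real.rpow_natCast]
      ring
    · rw [indicator_of_notMem h, indicator_of_notMem (fun h' => h (hmem.1 h')), mul_zero]
  rw [setLIntegral_congr_fun measurableSet_Ioi h1, setLIntegral_indicator measurableSet_Iio,
    inter_comm, Ioi_inter_Iio]
  have hlt : (-1 : ℝ) < l + n + α := by linarith
  have hint : IntervalIntegrable (fun s => q ^ l * s ^ (l + n + α)) volume 0 b :=
    (intervalIntegral.intervalIntegrable_rpow' hlt).const_mul _
  rw [Measure.restrict_congr_set Ioo_ae_eq_Ioc, ← ofReal_integral_eq_lintegral_ofReal,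
    ← intervalIntegral.integral_of_le hb0.le, intervalIntegral.integral_const_mul,
    integral_rpow (Or.inl hlt), ← ENNReal.ofReal_mul (by positivity)]
  · congr 1
    rw [Real.zero_rpow (by linarith), sub_zero, hb, Real.div_rpow (Real.exp_pos _).le hq0.le,
      ← Real.exp_mul]
    have e1 : l + n + α + 1 = l + (n + 1 + α) := by ring
    rw [e1, Real.rpow_add hq0 l, Real.rpow_neg hq0.le]
    have e2 : W (dir z) * (l + (n + 1 + α)) = (l + n + 1 + α) * W (dir z) := by ring
    rw [e2]
    have hql : 0 < q ^ l := by positivity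
    have hqn : 0 < q ^ ((n : ℝ) + 1 + α) := by positivity
    have e3 : l + ((n : ℝ) + 1 + α) = l + n + 1 + α := by ring
    rw [e3]
    field_simp
  · exact (intervalIntegrable_iff_integrableOn_Ioc_of_le hb0.le).1 hint
  · filter_upwards [ae_restrict_mem measurableSet_Ioc] with s hs
    have := hs.1
    positivity

/-- A gradient of a function homogeneous of degree `0` is orthogonal to the position vector and
homogeneous of degree `-1`. -/
lemma IsHomog.inner_gradient_eq_zero {W : EuclideanSpace ℝ (Fin (n + 1)) → ℝ} (hW : IsHomog W)
    {x G : EuclideanSpace ℝ (Fin (n + 1))} (hx : x ∈ halfSpace n)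
    (hG : HasFDerivAt W (innerSL ℝ G) x) : inner ℝ G x = 0 := by
  have h1 : HasDerivAt (fun c : ℝ => W (c • x)) (innerSL ℝ G x) 1 := by
    have h2 : HasDerivAt (fun c : ℝ => c • x) ((1 : ℝ) • x) 1 := (hasDerivAt_id 1).smul_const x
    rw [one_smul] at h2
    have hG' : HasFDerivAt W (innerSL ℝ G) ((1 : ℝ) • x) := by rwa [one_smul]
    exact hG'.comp_hasDerivAt (1 : ℝ) h2
  have h3 : HasDerivAt (fun c : ℝ => W (c • x)) 0 1 := by
    refine (hasDerivAt_const (1 : ℝ) (W x)).congr_of_eventuallyEq ?_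
    filter_upwards [lt_mem_nhds (zero_lt_one : (0 : ℝ) < 1)] with c hc
    exact hW x hx c hc
  simpa using h1.unique h3

lemma IsHomog.gradient_smul {W : EuclideanSpace ℝ (Fin (n + 1)) → ℝ} (hW : IsHomog W)
    {x G G' : EuclideanSpace ℝ (Fin (n + 1))} (hx : x ∈ halfSpace n) {c : ℝ} (hc : 0 < c)
    (hG : HasFDerivAt W (innerSL ℝ G) x) (hG' : HasFDerivAt W (innerSL ℝ G') (c • x)) :
    c • G' = G := by
  have h1 : HasFDerivAt (fun y => W (c • y)) (innerSL ℝ (c • G')) x := by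
    have h2 : HasFDerivAt (fun y : EuclideanSpace ℝ (Fin (n + 1)) => c • y)
      (c • ContinuousLinearMap.id ℝ _) x := (hasFDerivAt_id x).const_smul c
    refine (HasFDerivAt.comp x hG' h2).congr_fderiv ?_
    ext y
    simp
  have h3 : HasFDerivAt (fun y => W (c • y)) (innerSL ℝ G) x := by
    refine hG.congr_of_eventuallyEq ?_
    filter_upwards [isOpen_halfSpace.mem_nhds hx] with y hy
    exact hW y hy c hc
  have := h1.unique h3
  exact ext_inner_right ℝ fun v => by simpa [real_inner_smul_left] using DFunLike.congr_fun this v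

lemma inner_eLast (x : EuclideanSpace ℝ (Fin (n + 1))) :
    inner ℝ x (eLast n) = x (Fin.last n) := by
  simp [eLast, EuclideanSpace.inner_single_right]

/-- The radial graph `|x| = e^{W(x)}` is the image of the chart `z ↦ e^{W} |(z, 1)|⁻¹ (z, 1)`. -/
lemma range_radial_chart {W : EuclideanSpace ℝ (Fin (n + 1)) → ℝ} (hW : IsHomog W) :
    range (fun z : EuclideanSpace ℝ (Fin n) => (Real.exp (W (vec z)) / ‖vec z‖) • vec z) =
      {x | x ∈ halfSpace n ∧ ‖x‖ = Real.exp (W x)} := by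
  ext x
  constructor
  · rintro ⟨z, rfl⟩
    have hc : 0 < Real.exp (W (vec z)) / ‖vec z‖ := div_pos (Real.exp_pos _) (norm_vec_pos z)
    refine ⟨smul_mem_halfSpace (vec_mem_halfSpace z) hc, ?_⟩
    simp only
    rw [hW _ (vec_mem_halfSpace z) _ hc, norm_smul, Real.norm_of_nonneg hc.le,
      div_mul_cancel₀ _ (norm_vec_pos z).ne']
  · rintro ⟨hx, hn⟩
    have hs : 0 < x (Fin.last n) := hx
    set s := x (Fin.last n) with hsdef
    set z : EuclideanSpace ℝ (Fin n) := WithLp.toLp 2 fun i => x i.castSucc / s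
    have hxz : s • vec z = x := by
      ext i
      refine Fin.lastCases ?_ (fun j => ?_) i
      · simp [hsdef]
      · simp [z]
        field_simp
    refine ⟨z, ?_⟩
    have h1 : W (vec z) = W x := by rw [← hxz, hW _ (vec_mem_halfSpace z) s hs]
    have h2 : ‖x‖ = s * ‖vec z‖ := by rw [← hxz, norm_smul, Real.norm_of_nonneg hs.le]
    simp only
    rw [h1, ← hn, h2, mul_div_cancel_right₀ _ (norm_vec_pos z).ne', hxz]

/-- The weighted area of a radial graph `|x| = e^{W(x)}`. -/
theorem lintegral_radial_graph (k α : ℝ) {W : EuclideanSpace ℝ (Fin (n + 1)) → ℝ} (hW : IsHomog W)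
    {G : EuclideanSpace ℝ (Fin (n + 1)) → EuclideanSpace ℝ (Fin (n + 1))}
    (hG : ∀ x ∈ halfSpace n, HasStrictFDerivAt W (innerSL ℝ (G x)) x)
    (hGm : Measurable fun z : EuclideanSpace ℝ (Fin n) => G (dir z)) :
    ∫⁻ x in {x | x ∈ halfSpace n ∧ ‖x‖ = Real.exp (W x)}, weight k α x ∂(μHE[n]) =
      ∫⁻ z, ENNReal.ofReal (Real.exp ((k + n + α) * W (dir z)) * √(1 + ‖G (dir z)‖ ^ 2))
        ∂(sphereMeasure n α) := by
  have hWm : Measurable fun z : EuclideanSpace ℝ (Fin n) => W (dir z) := by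
    refine Continuous.measurable (continuous_iff_continuousAt.2 fun z => ?_)
    exact (hG _ (dir_mem_halfSpace z)).continuousAt.comp continuous_dir.continuousAt
  set h : EuclideanSpace ℝ (Fin n) → ℝ := fun z => Real.exp (W (vec z)) / ‖vec z‖ with hh
  have hpos : ∀ z, 0 < h z := fun z => div_pos (Real.exp_pos _) (norm_vec_pos z)
  -- `g z` collects the first `n` components of the gradient of `W` at `(z, 1)`
  set g : EuclideanSpace ℝ (Fin n) → EuclideanSpace ℝ (Fin n) :=
    fun z => WithLp.toLp 2 fun i => G (vec z) i.castSucc with hg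
  have hgi : ∀ z w, inner ℝ (G (vec z)) (emb n w) = inner ℝ (g z) w := by
    intro z w
    simp [PiLp.inner_apply, Fin.sum_univ_castSucc, hg]
  have hzero : ∀ z, inner ℝ (G (vec z)) (vec z) = 0 := fun z =>
    hW.inner_gradient_eq_zero (vec_mem_halfSpace z) (hG _ (vec_mem_halfSpace z)).hasFDerivAt
  have hlast : ∀ z, G (vec z) (Fin.last n) = - inner ℝ z (g z) := by
    intro z
    have h1 := hzero z
    rw [show vec z = emb n z + eLast n from rfl, inner_add_right] at h1
    have h2 : inner ℝ (G (emb n z + eLast n)) (eLast n) = G (emb n z + eLast n) (Fin.last n) :=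
      inner_eLast _
    have h3 := hgi z z
    rw [show vec z = emb n z + eLast n from rfl] at h3
    rw [h2, h3, real_inner_comm] at h1
    rw [show vec z = emb n z + eLast n from rfl]
    linarith
  have hGnorm : ∀ z, ‖G (vec z)‖ ^ 2 = ‖g z‖ ^ 2 + (inner ℝ z (g z)) ^ 2 := by
    intro z
    rw [EuclideanSpace.norm_sq_eq, Fin.sum_univ_castSucc, hlast, EuclideanSpace.norm_sq_eq]
    simp [hg]
  set p : EuclideanSpace ℝ (Fin n) → EuclideanSpace ℝ (Fin n) :=
    fun z => h z • (g z - (‖vec z‖ ^ 2)⁻¹ • z) with hp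
  have hvec : ∀ z : EuclideanSpace ℝ (Fin n), HasStrictFDerivAt vec (emb n) z := fun z =>
    (emb n).hasStrictFDerivAt.add_const _
  have hder : ∀ z, HasStrictFDerivAt h (innerSL ℝ (p z)) z := by
    intro z
    have h1 : HasStrictFDerivAt (fun y => W (vec y)) (innerSL ℝ (g z)) z := by
      refine ((hG _ (vec_mem_halfSpace z)).comp z (hvec z)).congr_fderiv ?_
      ext w
      simp [hgi]
    have h2 : HasStrictFDerivAt (fun y : EuclideanSpace ℝ (Fin n) => (1 + ‖y‖ ^ 2)) (2 • innerSL ℝ z) z :=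
      (hasStrictFDerivAt_norm_sq z).const_add 1
    have h3 := h2.sqrt (by positivity)
    have h4 := h1.exp.mul
      ((hasStrictDerivAt_inv (by positivity)).comp_hasStrictFDerivAt z h3)
    have h5 : h = fun y => Real.exp (W (vec y)) * (√(1 + ‖y‖ ^ 2))⁻¹ := by
      ext y
      simp only [hh]
      rw [norm_vec, div_eq_mul_inv]
    rw [h5]
    refine h4.congr_fderiv ?_
    ext w
    have hq := norm_vec_pos z
    simp only [hp, hh, add_apply, smul_apply, smul_eq_mul,
      innerSL_apply_apply, inner_smul_left, inner_sub_left, ← norm_vec]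
    simp
    field_simp
    ring
  set f : EuclideanSpace ℝ (Fin n) → EuclideanSpace ℝ (Fin (n + 1)) := fun z => h z • vec z with hf
  have hfder : ∀ z, HasStrictFDerivAt f (radialDeriv (h z) (p z) z) z := fun z =>
    (hder z).smul (hvec z)
  have hfinj : Function.Injective f := by
    intro z w hzw
    have h1 : h z = h w := by
      have := congrArg (fun x : EuclideanSpace ℝ (Fin (n + 1)) => x (Fin.last n)) hzw
      simpa [hf] using this
    ext i
    have := congrArg (fun x : EuclideanSpace ℝ (Fin (n + 1)) => x i.castSucc) hzw
    simpa [hf, h1, (hpos w).ne'] using this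
  rw [← range_radial_chart hW, lintegral_range_immersion hfder hfinj
    (fun z => radialDeriv_injective (hpos z).ne' _ _) (measurable_weight k α),
    lintegral_sphereMeasure]
  swap
  · exact (((hWm.const_mul _).exp).mul
      (((hGm.norm.pow_const 2).const_add 1).sqrt)).ennreal_ofReal
  refine lintegral_congr fun z => ?_
  set q := ‖vec z‖ with hq
  have hq0 : 0 < q := norm_vec_pos z
  have hGd : ‖G (dir z)‖ ^ 2 = q ^ 2 * ‖G (vec z)‖ ^ 2 := by
    have := hW.gradient_smul (vec_mem_halfSpace z) (inv_pos.2 hq0)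
      (hG _ (vec_mem_halfSpace z)).hasFDerivAt (hG _ (dir_mem_halfSpace z)).hasFDerivAt
    rw [← this, norm_smul, norm_inv, Real.norm_of_nonneg hq0.le, mul_pow, inv_pow,
      mul_inv_cancel_left₀ (by positivity)]
  have hJ : (radialDeriv (h z) (p z) z).normDet = h z ^ n * (q⁻¹ * √(1 + ‖G (dir z)‖ ^ 2)) := by
    rw [← sq_eq_sq₀ (LinearMap.normDet_nonneg _) (by have := hpos z; positivity),
      normDet_radialDeriv_sq (hpos z).ne', mul_pow, mul_pow, Real.sq_sqrt (by positivity), hGd,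
      hGnorm, ← pow_mul, mul_comm n 2]
    congr 1
    have hn := norm_vec_sq z
    rw [← hq] at hn
    have e1 : inner ℝ z (p z) / h z = inner ℝ z (g z) - ‖z‖ ^ 2 / q ^ 2 := by
      have := hpos z
      simp only [hp, ← hq, inner_smul_right, inner_sub_right, real_inner_self_eq_norm_sq]
      field_simp
    have e2 : ‖p z‖ ^ 2 / h z ^ 2 = ‖g z‖ ^ 2 - 2 * inner ℝ z (g z) / q ^ 2 + ‖z‖ ^ 2 / q ^ 4 := by
      have := hpos z
      simp only [hp, ← hq]
      rw [norm_smul, mul_pow, Real.norm_eq_abs, sq_abs, mul_div_cancel_left₀ _ (by positivity),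
        norm_sub_sq_real, inner_smul_right, norm_smul, Real.norm_of_nonneg (by positivity),
        real_inner_comm]
      field_simp
    rw [e1, e2]
    have hz : ‖z‖ ^ 2 = q ^ 2 - 1 := by rw [hn]; ring
    rw [hz]
    field_simp
    ring
  have hlast1 : f z (Fin.last n) = h z := by simp [hf]
  have hnorm1 : ‖f z‖ = Real.exp (W (dir z)) := by
    rw [hf, norm_smul, Real.norm_of_nonneg (hpos z).le, hh, div_mul_cancel₀ _ hq0.ne', hW.vec_eq]
  have hhz : h z = Real.exp (W (dir z)) / q := by rw [hh, ← hW.vec_eq]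
  rw [weight, hnorm1, hlast1, hJ, ← ENNReal.ofReal_mul (by have := hpos z; positivity),
    ← ENNReal.ofReal_mul (by positivity)]
  congr 1
  have e3 : h z ^ n * h z ^ α = Real.exp ((n + α) * W (dir z)) * q ^ (-((n : ℝ) + α)) := by
    rw [← Real.rpow_natCast, ← Real.rpow_add (hpos z), hhz, Real.div_rpow (Real.exp_pos _).le hq0.le,
      ← Real.exp_mul, Real.rpow_neg hq0.le, mul_comm (W _)]
    rfl
  have e4 : q ^ (-((n : ℝ) + α)) * q⁻¹ = q ^ (-((n : ℝ) + 1 + α)) := by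
    rw [← Real.rpow_neg_one, ← Real.rpow_add hq0]
    congr 1
    ring
  have e5 : Real.exp ((k + n + α) * W (dir z)) =
      Real.exp (W (dir z)) ^ k * Real.exp ((n + α) * W (dir z)) := by
    rw [← Real.exp_mul, ← Real.exp_add]
    congr 1
    ring
  rw [e5, ← e4]
  calc _ = (h z ^ n * h z ^ α) * (q⁻¹ * √(1 + ‖G (dir z)‖ ^ 2) * Real.exp (W (dir z)) ^ k) := by ring
    _ = _ := by rw [e3]; ring

end RadialIntegrals

/-! ### Points of density and the essential boundary -/

section EssBoundary

variable {n : ℕ}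

/-- The points of density `1` of `M`. -/
def densOne (M : Set (EuclideanSpace ℝ (Fin (n + 1)))) : Set (EuclideanSpace ℝ (Fin (n + 1))) :=
  {x | Tendsto (fun r : ℝ => volume (M ∩ Metric.ball x r) / volume (Metric.ball x r))
    (𝓝[>] 0) (𝓝 1)}

/-- The points of density `0` of `M`. -/
def densZero (M : Set (EuclideanSpace ℝ (Fin (n + 1)))) : Set (EuclideanSpace ℝ (Fin (n + 1))) :=
  {x | Tendsto (fun r : ℝ => volume (M ∩ Metric.ball x r) / volume (Metric.ball x r))
    (𝓝[>] 0) (𝓝 0)}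

variable {M : Set (EuclideanSpace ℝ (Fin (n + 1)))} {x : EuclideanSpace ℝ (Fin (n + 1))}

lemma volume_ball_ne_zero (x : EuclideanSpace ℝ (Fin (n + 1))) {r : ℝ} (hr : 0 < r) :
    volume (Metric.ball x r) ≠ 0 := (Metric.measure_ball_pos _ _ hr).ne'

lemma volume_ball_ne_top (x : EuclideanSpace ℝ (Fin (n + 1))) {r : ℝ} :
    volume (Metric.ball x r) ≠ ∞ := measure_ball_lt_top.ne

lemma density_compl (hM : NullMeasurableSet M) {r : ℝ} (hr : 0 < r) :
    volume (M ∩ Metric.ball x r) / volume (Metric.ball x r) +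
      volume (Mᶜ ∩ Metric.ball x r) / volume (Metric.ball x r) = 1 := by
  rw [← ENNReal.add_div, inter_comm M, inter_comm Mᶜ, ← sdiff_eq, measure_inter_add_sdiff₀ _ hM,
    ENNReal.div_self (volume_ball_ne_zero x hr) (volume_ball_ne_top x)]

lemma densZero_compl (hM : NullMeasurableSet M) : densZero Mᶜ = densOne M := by
  have key : ∀ (A : Set (EuclideanSpace ℝ (Fin (n + 1)))) (x) (_ : NullMeasurableSet A), ∀ᶠ r in 𝓝[>] (0 : ℝ),
      volume (Aᶜ ∩ Metric.ball x r) / volume (Metric.ball x r) =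
        1 - volume (A ∩ Metric.ball x r) / volume (Metric.ball x r) := by
    intro A x hA
    filter_upwards [self_mem_nhdsWithin] with r hr
    have h := density_compl (x := x) hA hr
    refine ENNReal.eq_sub_of_add_eq ?_ (by rw [add_comm]; exact h)
    refine ne_top_of_le_ne_top ENNReal.one_ne_top ?_
    rw [← h]
    exact le_self_add
  ext x
  constructor
  · intro h
    have h1 : Tendsto (fun r : ℝ => 1 - volume (Mᶜ ∩ Metric.ball x r) / volume (Metric.ball x r))
        (𝓝[>] 0) (𝓝 (1 - 0)) := ENNReal.Tendsto.sub tendsto_const_nhds h (Or.inl ENNReal.one_ne_top)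
    rw [tsub_zero] at h1
    refine h1.congr' ?_
    filter_upwards [key Mᶜ x hM.compl] with r hr
    rw [← hr, compl_compl]
  · intro h
    have h1 : Tendsto (fun r : ℝ => 1 - volume (M ∩ Metric.ball x r) / volume (Metric.ball x r))
        (𝓝[>] 0) (𝓝 (1 - 1)) := ENNReal.Tendsto.sub tendsto_const_nhds h (Or.inl ENNReal.one_ne_top)
    rw [tsub_self] at h1
    refine h1.congr' ?_
    filter_upwards [key M x hM] with r hr using hr.symm

lemma densOne_compl (hM : NullMeasurableSet M) : densOne Mᶜ = densZero M := by
  rw [← densZero_compl hM.compl, compl_compl]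

lemma disjoint_densZero_densOne : Disjoint (densZero M) (densOne M) :=
  disjoint_left.2 fun _ h0 h1 => zero_ne_one (tendsto_nhds_unique h0 h1)

lemma density_congr {M' : Set (EuclideanSpace ℝ (Fin (n + 1)))} (h : M =ᵐ[volume] M')
    (x : EuclideanSpace ℝ (Fin (n + 1))) (r : ℝ) :
    volume (M ∩ Metric.ball x r) = volume (M' ∩ Metric.ball x r) :=
  measure_congr (h.inter (ae_eq_refl _))

lemma essBoundary_congr {M' : Set (EuclideanSpace ℝ (Fin (n + 1)))} (h : M =ᵐ[volume] M') :
    essBoundary M = essBoundary M' := by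
  simp only [essBoundary, density_congr h]

/-- Lebesgue's density theorem. -/
lemma ae_mem_iff_mem_densOne (hM : NullMeasurableSet M) : ∀ᵐ x, x ∈ M ↔ x ∈ densOne M := by
  obtain ⟨M', hM', hMM'⟩ := hM
  have h1 := Besicovitch.ae_tendsto_measure_inter_div_of_measurableSet
    (volume : Measure (EuclideanSpace ℝ (Fin (n + 1)))) hM'
  have h2 : ∀ᵐ x, x ∈ M ↔ x ∈ M' := by
    filter_upwards [hMM'] with x hx
    exact iff_of_eq hx
  filter_upwards [h1, h2] with x hx hx2
  have h3 : ∀ r, volume (M' ∩ Metric.closedBall x r) / volume (Metric.closedBall x r) =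
      volume (M ∩ Metric.ball x r) / volume (Metric.ball x r) := by
    intro r
    have hball : (Metric.closedBall x r : Set _) =ᵐ[volume] Metric.ball x r :=
      (ae_eq_of_subset_of_measure_ge Metric.ball_subset_closedBall
        (Measure.addHaar_closedBall_eq_addHaar_ball _ _ _).le
        Metric.isOpen_ball.measurableSet.nullMeasurableSet measure_closedBall_lt_top.ne).symm
    rw [measure_congr hball, measure_congr (hMM'.symm.inter hball)]
  simp only [h3] at hx
  rw [hx2]
  constructor
  · intro h
    rw [indicator_of_mem h] at hx
    exact hx
  · intro h
    by_contra hne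
    rw [indicator_of_notMem hne] at hx
    exact zero_ne_one (tendsto_nhds_unique hx h)

lemma mem_densOne_of_mem_interior (hx : x ∈ interior M) : x ∈ densOne M := by
  obtain ⟨ρ, hρ, hb⟩ := Metric.mem_nhds_iff.1 (mem_interior_iff_mem_nhds.1 hx)
  refine tendsto_const_nhds.congr' ?_
  filter_upwards [Ioo_mem_nhdsGT hρ] with r hr
  rw [inter_eq_self_of_subset_right ((Metric.ball_subset_ball hr.2.le).trans hb),
    ENNReal.div_self (volume_ball_ne_zero x hr.1) (volume_ball_ne_top x)]

lemma mem_densZero_of_notMem_closure (hx : x ∉ closure M) : x ∈ densZero M := by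
  obtain ⟨ρ, hρ, hb⟩ := Metric.mem_nhds_iff.1 (isClosed_closure.isOpen_compl.mem_nhds hx)
  refine tendsto_const_nhds.congr' ?_
  filter_upwards [Ioo_mem_nhdsGT hρ] with r hr
  have : M ∩ Metric.ball x r = ∅ := by
    refine disjoint_iff_inter_eq_empty.1 (disjoint_left.2 fun y hy hy' => ?_)
    exact hb (Metric.ball_subset_ball hr.2.le hy') (subset_closure hy)
  rw [this, measure_empty, ENNReal.zero_div]

lemma essBoundary_subset_frontier : essBoundary M ⊆ frontier M := fun _ hx =>
  ⟨by_contra fun h => hx.1 (mem_densZero_of_notMem_closure h),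
    fun h => hx.2 (mem_densOne_of_mem_interior h)⟩

/-- A point belongs to the essential boundary of `M` as soon as both `M` and its complement occupy
a fixed proportion of all small balls around it. -/
lemma mem_essBoundary_of_balls {c : ℝ} (hc : 0 < c)
    (h : ∀ᶠ r in 𝓝[>] (0 : ℝ), (∃ y, Metric.ball y (c * r) ⊆ M ∩ Metric.ball x r) ∧
      ∃ y, Metric.ball y (c * r) ⊆ Metric.ball x r \ M) : x ∈ essBoundary M := by
  set C := ENNReal.ofReal (c ^ (n + 1)) with hC
  have hC0 : C ≠ 0 := by simpa [hC] using by positivity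
  have hball : ∀ (y : EuclideanSpace ℝ (Fin (n + 1))) {r : ℝ}, 0 < r →
      volume (Metric.ball y (c * r)) = C * volume (Metric.ball x r) := by
    intro y r hr
    rw [Measure.addHaar_ball_mul volume y hc.le r, Measure.addHaar_ball_center volume x,
      finrank_euclideanSpace_fin]
  constructor
  · intro ht
    refine hC0 (le_antisymm (ge_of_tendsto ht ?_) zero_le)
    filter_upwards [h, self_mem_nhdsWithin] with r hr hr0
    obtain ⟨⟨y, hy⟩, -⟩ := hr
    rw [ENNReal.le_div_iff_mul_le (Or.inl (volume_ball_ne_zero x hr0)) (Or.inl (volume_ball_ne_top x)),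
      ← hball y hr0]
    exact measure_mono hy
  · intro ht
    have ht' : Tendsto (fun r : ℝ => volume (M ∩ Metric.ball x r) / volume (Metric.ball x r) + C)
        (𝓝[>] 0) (𝓝 (1 + C)) := ht.add tendsto_const_nhds
    have hle : 1 + C ≤ 1 := by
      refine le_of_tendsto ht' ?_
      filter_upwards [h, self_mem_nhdsWithin] with r hr hr0
      obtain ⟨-, ⟨y, hy⟩⟩ := hr
      have h0 := volume_ball_ne_zero x hr0
      have hC1 : C = volume (Metric.ball y (c * r)) / volume (Metric.ball x r) := by
        rw [hball y hr0, ENNReal.mul_div_cancel_right h0 (volume_ball_ne_top x)]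
      rw [hC1, ← ENNReal.add_div, ENNReal.div_le_iff h0 (volume_ball_ne_top x), one_mul,
        ← measure_union _ Metric.isOpen_ball.measurableSet]
      · exact measure_mono (union_subset inter_subset_right (hy.trans sdiff_subset))
      · exact disjoint_left.2 fun z hz hz' => (hy hz').2 hz.1
    have := (ENNReal.add_le_add_iff_left ENNReal.one_ne_top).1 (hle.trans (add_zero 1).ge)
    exact hC0 (le_antisymm this zero_le)

lemma volume_preimage_inter_ball
    (e : EuclideanSpace ℝ (Fin (n + 1)) ≃ₗᵢ[ℝ] EuclideanSpace ℝ (Fin (n + 1)))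
    (M : Set (EuclideanSpace ℝ (Fin (n + 1)))) (x : EuclideanSpace ℝ (Fin (n + 1))) (r : ℝ) :
    volume (e ⁻¹' M ∩ Metric.ball x r) = volume (M ∩ Metric.ball (e x) r) := by
  have h1 : e ⁻¹' M ∩ Metric.ball x r = e ⁻¹' (M ∩ Metric.ball (e x) r) := by
    ext y
    simp
  rw [h1]
  exact e.measurePreserving.measure_preimage_equiv (f := e.toHomeomorph.toMeasurableEquiv) _

lemma volume_ball_isometry
    (e : EuclideanSpace ℝ (Fin (n + 1)) ≃ₗᵢ[ℝ] EuclideanSpace ℝ (Fin (n + 1)))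
    (x : EuclideanSpace ℝ (Fin (n + 1))) (r : ℝ) :
    volume (Metric.ball (e x) r) = volume (Metric.ball x r) := by
  rw [Measure.addHaar_ball_center volume (e x), Measure.addHaar_ball_center volume x]

lemma essBoundary_preimage
    (e : EuclideanSpace ℝ (Fin (n + 1)) ≃ₗᵢ[ℝ] EuclideanSpace ℝ (Fin (n + 1)))
    (M : Set (EuclideanSpace ℝ (Fin (n + 1)))) :
    essBoundary (e ⁻¹' M) = e ⁻¹' essBoundary M := by
  ext x
  simp only [essBoundary, mem_preimage, mem_ofPred_eq, volume_preimage_inter_ball,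
    volume_ball_isometry]

end EssBoundary

/-! ### Sets whose essential boundary is negligible -/

section Trivial

/-- Let `T` be the set of points of `J` that are interior to neither `A` nor `B`. If all points of `T`
near one of its points lie in `A`, then some point of `A` is the end of an interval contained in
`B`. -/
lemma false_of_boundary_subset {J A B T O : Set ℝ} (hJo : IsOpen J)
    (hd : Disjoint A B) (hT : T = J \ (interior A ∪ interior B)) (hO : IsOpen O) {t : ℝ}
    (ht : t ∈ T) (htO : t ∈ O) (hOT : O ∩ T ⊆ A)
    (hl : ∀ h ∈ A, ∀ s < h, ¬ Ioo s h ⊆ B) (hr : ∀ h ∈ A, ∀ s > h, ¬ Ioo h s ⊆ B) : False := by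
  have htJ : t ∈ J := by rw [hT] at ht; exact ht.1
  obtain ⟨δ, hδ, hball⟩ := Metric.mem_nhds_iff.1 ((hO.inter hJo).mem_nhds ⟨htO, htJ⟩)
  have htA : t ∉ interior A := by rw [hT] at ht; exact fun h => ht.2 (Or.inl h)
  obtain ⟨s, hs, hsA⟩ : ∃ s ∈ Metric.ball t δ, s ∉ A := by
    by_contra! hcon
    exact htA (mem_interior_iff_mem_nhds.2 (mem_of_superset (Metric.ball_mem_nhds t hδ) hcon))
  have hsub : uIcc s t ⊆ O ∩ J := fun y hy => hball <| by
    rw [Real.ball_eq_Ioo] at hs ⊢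
    exact (ordConnected_Ioo.uIcc_subset hs ⟨by linarith, by linarith⟩) hy
  have hsT : s ∉ T := fun h => hsA (hOT ⟨(hball hs).1, h⟩)
  have hsB : s ∈ interior B := by
    by_contra hcon
    rw [hT] at hsT
    refine hsT ⟨(hball hs).2, fun h => h.elim (fun h => hsA (interior_subset h)) hcon⟩
  have hclosed : IsClosed (T ∩ uIcc s t) := by
    have : T ∩ uIcc s t = uIcc s t \ (interior A ∪ interior B) := by
      ext y
      rw [hT]
      constructor
      · rintro ⟨⟨_, h1⟩, h2⟩; exact ⟨h2, h1⟩
      · rintro ⟨h2, h1⟩; exact ⟨⟨(hsub h2).2, h1⟩, h2⟩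
    rw [this]
    exact isCompact_uIcc.isClosed.sdiff (isOpen_interior.union isOpen_interior)
  have hcomp : IsCompact (T ∩ uIcc s t) := isCompact_uIcc.of_isClosed_subset hclosed inter_subset_right
  have hne : (T ∩ uIcc s t).Nonempty := ⟨t, ht, right_mem_uIcc⟩
  have hpre : ∀ I : Set ℝ, IsPreconnected I → s ∈ I → I ⊆ uIcc s t → Disjoint I T → I ⊆ B := by
    intro I hI hsI hIsub hIT
    have hcov : I ⊆ interior B ∪ interior A := by
      intro y hy
      by_contra hcon
      refine disjoint_left.1 hIT hy ?_
      rw [hT]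
      exact ⟨(hsub (hIsub hy)).2, fun h => hcon h.symm⟩
    refine (hI.subset_left_of_subset_union isOpen_interior isOpen_interior
      (hd.symm.mono interior_subset interior_subset) hcov ⟨s, hsI, hsB⟩).trans interior_subset
  rcases lt_trichotomy s t with hst | hst | hst
  · obtain ⟨h, ⟨hhT, hhI⟩, hmin⟩ := hcomp.exists_isLeast hne
    rw [uIcc_of_le hst.le] at *
    have hsh : s < h := lt_of_le_of_ne hhI.1 fun he => hsT (he ▸ hhT)
    refine hl h (hOT ⟨(hsub hhI).1, hhT⟩) s hsh ?_
    refine Ioo_subset_Ico_self.trans (hpre (Ico s h) isPreconnected_Ico ⟨le_rfl, hsh⟩ ?_ ?_)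
    · exact fun y hy => ⟨hy.1, hy.2.le.trans hhI.2⟩
    · exact disjoint_left.2 fun y hy hyT =>
        absurd (hmin ⟨hyT, hy.1, hy.2.le.trans hhI.2⟩) (not_le.2 hy.2)
  · rw [← hst] at ht
    exact hsT ht
  · obtain ⟨h, ⟨hhT, hhI⟩, hmax⟩ := hcomp.exists_isGreatest hne
    rw [uIcc_of_ge hst.le] at *
    have hsh : h < s := lt_of_le_of_ne hhI.2 fun he => hsT (he ▸ hhT)
    refine hr h (hOT ⟨(hsub hhI).1, hhT⟩) s hsh ?_
    refine Ioo_subset_Ioc_self.trans (hpre (Ioc h s) isPreconnected_Ioc ⟨hsh, le_rfl⟩ ?_ ?_)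
    · exact fun y hy => ⟨hhI.1.trans hy.1.le, hy.2⟩
    · exact disjoint_left.2 fun y hy hyT =>
        absurd (hmax ⟨hyT, hhI.1.trans hy.1.le, hy.2⟩) (not_le.2 hy.1)

/-- If an open interval is split into two countable unions of relatively closed sets and neither
set has a one-sided neighbourhood ending at a point of the other one, then one of them is empty.
This follows from Baire's theorem on the set of points that are interior to neither set. -/
lemma eq_empty_or_eq_empty_of_no_jumps {J A B : Set ℝ} (hJo : IsOpen J) (hJ : IsPreconnected J)
    (hAB : A ∪ B = J) (hd : Disjoint A B) {a b : ℕ → Set ℝ} (hac : ∀ k, IsClosed (a k))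
    (hbc : ∀ k, IsClosed (b k)) (ha : A = J ∩ ⋃ k, a k) (hb : B = J ∩ ⋃ k, b k)
    (hAl : ∀ h ∈ A, ∀ s < h, ¬ Ioo s h ⊆ B) (hAr : ∀ h ∈ A, ∀ s > h, ¬ Ioo h s ⊆ B)
    (hBl : ∀ h ∈ B, ∀ s < h, ¬ Ioo s h ⊆ A) (hBr : ∀ h ∈ B, ∀ s > h, ¬ Ioo h s ⊆ A) :
    A = ∅ ∨ B = ∅ := by
  by_contra! hcon
  obtain ⟨⟨x, hx⟩, ⟨y, hy⟩⟩ := hcon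
  set T := J \ (interior A ∪ interior B) with hT
  have hTne : T.Nonempty := by
    by_contra hemp
    rw [not_nonempty_iff_eq_empty, hT, sdiff_eq_empty] at hemp
    have hxJ : x ∈ J := hAB ▸ Or.inl hx
    have hyJ : y ∈ J := hAB ▸ Or.inr hy
    have hxA : x ∈ interior A := (hemp hxJ).resolve_right
      fun h => disjoint_left.1 hd hx (interior_subset h)
    have := hJ.subset_left_of_subset_union isOpen_interior isOpen_interior
      (hd.mono interior_subset interior_subset) hemp ⟨x, hxJ, hxA⟩
    exact disjoint_left.1 hd (interior_subset (this hyJ)) hy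
  have hlc : IsLocallyClosed T :=
    hJo.isLocallyClosed.inter (isOpen_interior.union isOpen_interior).isClosed_compl.isLocallyClosed
  have : LocallyCompactSpace T := hlc.locallyCompactSpace
  have : Nonempty T := hTne.to_subtype
  let f : ℕ ⊕ ℕ → Set T := fun i => Subtype.val ⁻¹' (Sum.elim a b i)
  have hfc : ∀ i, IsClosed (f i) := by
    rintro (i | i)
    · exact (hac i).preimage continuous_subtype_val
    · exact (hbc i).preimage continuous_subtype_val
  have hfU : ⋃ i, f i = univ := by
    refine eq_univ_of_forall fun t => ?_
    have htJ : (t : ℝ) ∈ A ∪ B := hAB ▸ t.2.1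
    rcases htJ with h | h
    · rw [ha] at h
      obtain ⟨k, hk⟩ := mem_iUnion.1 h.2
      exact mem_iUnion.2 ⟨Sum.inl k, hk⟩
    · rw [hb] at h
      obtain ⟨k, hk⟩ := mem_iUnion.1 h.2
      exact mem_iUnion.2 ⟨Sum.inr k, hk⟩
  obtain ⟨i, t, ht⟩ := nonempty_interior_of_iUnion_of_closed hfc hfU
  obtain ⟨V, hV, hVo, htV⟩ := mem_interior.1 ht
  obtain ⟨O, hO, rfl⟩ := isOpen_induced_iff.1 hVo
  rcases i with i | i
  · refine false_of_boundary_subset hJo hd hT hO t.2 htV ?_ hAl hAr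
    intro s hs
    rw [ha]
    exact ⟨hs.2.1, mem_iUnion.2 ⟨i, hV (show (⟨s, hs.2⟩ : T) ∈ _ from hs.1)⟩⟩
  · refine false_of_boundary_subset hJo hd.symm
      (by rw [union_comm]) hO t.2 htV ?_ hBl hBr
    intro s hs
    rw [hb]
    exact ⟨hs.2.1, mem_iUnion.2 ⟨i, hV (show (⟨s, hs.2⟩ : T) ∈ _ from hs.1)⟩⟩

end Trivial

section Lines

variable {n : ℕ}

/-- The point of `ℝ^{n+1}` with horizontal part `y` and last coordinate `s`. -/
noncomputable def pt (y : EuclideanSpace ℝ (Fin n)) (s : ℝ) : EuclideanSpace ℝ (Fin (n + 1)) :=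
  emb n y + s • eLast n

lemma continuous_pt : Continuous fun p : EuclideanSpace ℝ (Fin n) × ℝ => pt p.1 p.2 := by
  unfold pt; fun_prop

lemma dist_pt_sq (y y' : EuclideanSpace ℝ (Fin n)) (s s' : ℝ) :
    dist (pt y s) (pt y' s') ^ 2 = dist y y' ^ 2 + (s - s') ^ 2 := by
  rw [dist_eq_norm, dist_eq_norm, ← norm_emb_add_smul_sq]
  congr 2
  simp only [pt, map_sub, sub_smul]
  abel

/-- The points around which `Mᶜ` has relative volume at most `δ` at all scales below
`1 / (k + 1)`. -/
def mostlyIn (M : Set (EuclideanSpace ℝ (Fin (n + 1)))) (δ : ℝ≥0∞) (k : ℕ) :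
    Set (EuclideanSpace ℝ (Fin (n + 1))) :=
  {x | ∀ r : ℝ, 0 < r → r < 1 / (k + 1) →
    volume (Mᶜ ∩ Metric.ball x r) ≤ δ * volume (Metric.ball x r)}

lemma isClosed_volume_inter_ball_le (A : Set (EuclideanSpace ℝ (Fin (n + 1)))) (r : ℝ) (c : ℝ≥0∞) :
    IsClosed {x | volume (A ∩ Metric.ball x r) ≤ c} := by
  rw [← isOpen_compl_iff, Metric.isOpen_iff]
  intro x hx
  have hx' : c < volume (A ∩ Metric.ball x r) := not_le.1 hx
  have hmono : Monotone fun m : ℕ => A ∩ Metric.ball x (r - 1 / ((m : ℝ) + 1)) := by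
    intro i j hij
    refine inter_subset_inter_right _ (Metric.ball_subset_ball ?_)
    gcongr
  have hU : ⋃ m : ℕ, A ∩ Metric.ball x (r - 1 / ((m : ℝ) + 1)) = A ∩ Metric.ball x r := by
    rw [← inter_iUnion]
    congr 1
    ext y
    simp only [mem_iUnion, Metric.mem_ball]
    constructor
    · rintro ⟨m, hm⟩
      have : 0 < 1 / ((m : ℝ) + 1) := by positivity
      linarith
    · intro hy
      obtain ⟨m, hm⟩ := exists_nat_one_div_lt (sub_pos.2 hy)
      exact ⟨m, by linarith⟩
  rw [← hU, hmono.measure_iUnion] at hx'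
  obtain ⟨m, hm⟩ := lt_iSup_iff.1 hx'
  refine ⟨1 / ((m : ℝ) + 1), by positivity, fun y hy => ?_⟩
  refine not_le.2 (hm.trans_le (measure_mono (inter_subset_inter_right _ ?_)))
  refine Metric.ball_subset_ball' ?_
  rw [dist_comm]
  have := Metric.mem_ball.1 hy
  linarith

lemma isClosed_mostlyIn (M : Set (EuclideanSpace ℝ (Fin (n + 1)))) (δ : ℝ≥0∞) (k : ℕ) :
    IsClosed (mostlyIn M δ k) := by
  have : mostlyIn M δ k = ⋂ r : ℝ, ⋂ _ : 0 < r, ⋂ _ : r < 1 / ((k : ℝ) + 1),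
      {x | volume (Mᶜ ∩ Metric.ball x r) ≤
        δ * volume (Metric.ball (0 : EuclideanSpace ℝ (Fin (n + 1))) r)} := by
    ext x
    simp only [mostlyIn, mem_iInter, mem_ofPred_eq, Measure.addHaar_ball_center volume x]
  rw [this]
  exact isClosed_iInter fun r => isClosed_iInter fun _ => isClosed_iInter fun _ =>
    isClosed_volume_inter_ball_le _ _ _

lemma exists_mem_mostlyIn {M : Set (EuclideanSpace ℝ (Fin (n + 1)))} (hM : NullMeasurableSet M)
    {δ : ℝ≥0∞} (hδ : 0 < δ) {x : EuclideanSpace ℝ (Fin (n + 1))} (hx : x ∈ densOne M) :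
    ∃ k, x ∈ mostlyIn M δ k := by
  rw [← densZero_compl hM] at hx
  have h1 := (tendsto_order.1 hx).2 δ hδ
  obtain ⟨ρ, hρ, hb⟩ := mem_nhdsGT_iff_exists_Ioo_subset.1 h1
  obtain ⟨k, hk⟩ := exists_nat_one_div_lt (show (0 : ℝ) < ρ from hρ)
  refine ⟨k, fun r hr hrk => ?_⟩
  have h2 : volume (Mᶜ ∩ Metric.ball x r) / volume (Metric.ball x r) < δ := hb ⟨hr, hrk.trans hk⟩
  rw [ENNReal.div_lt_iff (Or.inl (volume_ball_ne_zero x hr)) (Or.inl (volume_ball_ne_top x))] at h2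
  exact h2.le

lemma notMem_densZero_of_mem_mostlyIn {M : Set (EuclideanSpace ℝ (Fin (n + 1)))}
    (hM : NullMeasurableSet M) {δ : ℝ≥0∞} (hδ : δ < 1) {x : EuclideanSpace ℝ (Fin (n + 1))} {k : ℕ}
    (hx : x ∈ mostlyIn M δ k) : x ∉ densZero M := by
  intro h
  rw [← densOne_compl hM] at h
  refine absurd (le_of_tendsto h ?_) (not_le.2 hδ)
  have hk : (0 : ℝ) < 1 / (k + 1) := by positivity
  filter_upwards [Ioo_mem_nhdsGT hk] with r hr
  rw [ENNReal.div_le_iff (volume_ball_ne_zero x hr.1) (volume_ball_ne_top x)]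
  exact hx r hr.1 hr.2

/-- The proportion `δ` is too small for `Mᶜ` to occupy, in a ball of radius `3 r`, a cylinder of
height comparable to `r` over half of a ball of radius `r` in `ℝ^n`. -/
def IsSmallProportion (n : ℕ) (δ : ℝ≥0∞) : Prop :=
  ∀ r : ℝ, 0 < r → ∀ (x : EuclideanSpace ℝ (Fin (n + 1))) (y : EuclideanSpace ℝ (Fin n)),
    δ * volume (Metric.ball x (3 * r)) < ENNReal.ofReal (r / 4) * volume (Metric.closedBall y r)

lemma exists_isSmallProportion (n : ℕ) : ∃ δ, 0 < δ ∧ δ < 1 ∧ IsSmallProportion n δ := by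
  set Ω := volume (Metric.ball (0 : EuclideanSpace ℝ (Fin (n + 1))) 1) with hΩ
  set ω := volume (Metric.closedBall (0 : EuclideanSpace ℝ (Fin n)) 1) with hω
  have hω0 : ω ≠ 0 := (Metric.measure_closedBall_pos _ _ one_pos).ne'
  have hΩt : Ω ≠ ∞ := measure_ball_lt_top.ne
  have hlim : Tendsto (fun δ : ℝ≥0∞ => δ * (ENNReal.ofReal (3 ^ (n + 1)) * Ω)) (𝓝[>] 0) (𝓝 0) := by
    have := ENNReal.Tendsto.mul_const (b := ENNReal.ofReal (3 ^ (n + 1)) * Ω)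
      (tendsto_id.mono_left nhdsWithin_le_nhds : Tendsto (id : ℝ≥0∞ → ℝ≥0∞) (𝓝[>] 0) (𝓝 0))
      (Or.inr (by finiteness))
    simpa using this
  have hpos : 0 < ENNReal.ofReal (1 / 4) * ω := by
    refine ENNReal.mul_pos ?_ hω0
    simp
  have hev := ((tendsto_order.1 hlim).2 _ hpos).and
    (Ioo_mem_nhdsGT (zero_lt_one : (0 : ℝ≥0∞) < 1))
  obtain ⟨δ, h1, h2⟩ := hev.exists
  refine ⟨δ, h2.1, h2.2, fun r hr x y => ?_⟩
  rw [Measure.addHaar_ball volume x (by positivity : (0 : ℝ) ≤ 3 * r),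
    Measure.addHaar_closedBall' volume y hr.le, finrank_euclideanSpace_fin,
    finrank_euclideanSpace_fin, mul_pow, ENNReal.ofReal_mul (by positivity)]
  have hr' : ENNReal.ofReal (r ^ (n + 1)) ≠ 0 := by simpa using by positivity
  calc _ = ENNReal.ofReal (r ^ (n + 1)) * (δ * (ENNReal.ofReal (3 ^ (n + 1)) * Ω)) := by ring
    _ < ENNReal.ofReal (r ^ (n + 1)) * (ENNReal.ofReal (1 / 4) * ω) :=
      (ENNReal.mul_lt_mul_iff_right hr' ENNReal.ofReal_ne_top).2 h1
    _ = _ := by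
      rw [← mul_assoc, ← mul_assoc, ← ENNReal.ofReal_mul (by positivity),
        ← ENNReal.ofReal_mul (by positivity)]
      congr 2
      ring

/-- The base points `y` of vertical lines that carry, at a height `h ∈ [a, a + σ]`, a point around
which `M` is dense at all scales below `1 / (k + 1)`, although almost all of the segment from that
point up to the height `a + 2 σ` lies outside `M`. -/
def upperCusps (M : Set (EuclideanSpace ℝ (Fin (n + 1)))) (δ : ℝ≥0∞) (k : ℕ) (a σ : ℝ) :
    Set (EuclideanSpace ℝ (Fin n)) :=
  {y | ∃ h ∈ Icc a (a + σ), pt y h ∈ mostlyIn M δ k ∧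
    ∀ᵐ s ∂(volume.restrict (Ioo h (a + 2 * σ))), pt y s ∉ M}

/-- Upward cusps are negligible: near a point of density of the set of their base points, all the
segments above the highest of the tips lie outside `M`, and they occupy a fixed proportion of a ball
around that tip. -/
lemma volume_upperCusps {M : Set (EuclideanSpace ℝ (Fin (n + 1)))} (hM : MeasurableSet M)
    {δ : ℝ≥0∞} (hδ : IsSmallProportion n δ) (k : ℕ) (a : ℝ) {σ : ℝ} (hσ : 0 < σ) :
    volume (upperCusps M δ k a σ) = 0 := by
  by_contra hne
  set A := upperCusps M δ k a σ with hA
  obtain ⟨y₀, hy₀, hlim⟩ : ∃ y₀ ∈ A, Tendsto (fun r =>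
      volume (A ∩ Metric.closedBall y₀ r) / volume (Metric.closedBall y₀ r)) (𝓝[>] 0) (𝓝 1) :=
    Measure.exists_mem_of_measure_ne_zero_of_ae hne (Besicovitch.ae_tendsto_measure_inter_div volume A)
  have hhalf : (1 / 2 : ℝ≥0∞) < 1 := by norm_num
  have hk : (0 : ℝ) < 1 / (k + 1) := by positivity
  have hev1 := (tendsto_order.1 hlim).1 _ hhalf
  have hev2 : ∀ᶠ r in 𝓝[>] (0 : ℝ), r ∈ Ioo 0 σ := Ioo_mem_nhdsGT hσ
  have hev3 : ∀ᶠ r in 𝓝[>] (0 : ℝ), r ∈ Ioo 0 (1 / ((k : ℝ) + 1) / 3) :=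
    Ioo_mem_nhdsGT (by positivity)
  obtain ⟨r, hr1, hr2, hr3⟩ := (hev1.and (hev2.and hev3)).exists
  have hr0 : 0 < r := hr2.1
  rw [ENNReal.lt_div_iff_mul_lt (Or.inl (Metric.measure_closedBall_pos _ _ hr0).ne')
    (Or.inl measure_closedBall_lt_top.ne)] at hr1
  set H : Set ℝ := {h | ∃ y ∈ Metric.closedBall y₀ r, h ∈ Icc a (a + σ) ∧ pt y h ∈ mostlyIn M δ k ∧
    ∀ᵐ s ∂(volume.restrict (Ioo h (a + 2 * σ))), pt y s ∉ M} with hH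
  have hHne : H.Nonempty := by
    obtain ⟨h, h1, h2⟩ := hy₀
    exact ⟨h, y₀, Metric.mem_closedBall_self hr0.le, h1, h2⟩
  have hHb : BddAbove H := ⟨a + σ, fun h hh => by obtain ⟨y, -, h1, -⟩ := hh; exact h1.2⟩
  -- The tip chosen is nearly the highest. Above all base points in the ball of radius `r` the slab
  -- `I` then lies above the tip of the line, hence outside `M`, and it is within `3 r` of the tip.
  obtain ⟨h₁, hh₁, hlt⟩ := exists_lt_of_lt_csSup hHne (sub_lt_self (sSup H) (by positivity : 0 < r / 10))
  obtain ⟨y₁, hy₁, hh₁I, hin, -⟩ := hh₁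
  set I : Set ℝ := Ioo (h₁ + r / 10) (h₁ + r) with hI
  set φ : EuclideanSpace ℝ (Fin n) → ℝ≥0∞ := fun y =>
    ∫⁻ s, (Mᶜ ∩ Metric.ball (pt y₁ h₁) (3 * r)).indicator (fun _ => 1) (pt y s) with hφ
  have hmeas : MeasurableSet (Mᶜ ∩ Metric.ball (pt y₁ h₁) (3 * r)) :=
    hM.compl.inter Metric.isOpen_ball.measurableSet
  have hind : Measurable ((Mᶜ ∩ Metric.ball (pt y₁ h₁) (3 * r)).indicator (fun _ => (1 : ℝ≥0∞))) :=
    measurable_const.indicator hmeas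
  have hjoint : Measurable fun p : EuclideanSpace ℝ (Fin n) × ℝ =>
      (Mᶜ ∩ Metric.ball (pt y₁ h₁) (3 * r)).indicator (fun _ => (1 : ℝ≥0∞)) (pt p.1 p.2) :=
    hind.comp continuous_pt.measurable
  have hφm : Measurable φ := hjoint.lintegral_prod_right'
  have hvol : volume (Mᶜ ∩ Metric.ball (pt y₁ h₁) (3 * r)) = ∫⁻ y, φ y := by
    rw [← setLIntegral_one, ← lintegral_indicator hmeas, lintegral_height hind,
      lintegral_lintegral_swap (f := fun s y => (Mᶜ ∩ Metric.ball (pt y₁ h₁) (3 * r)).indicator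
        (fun _ => (1 : ℝ≥0∞)) (emb n y + s • eLast n)) (hjoint.comp measurable_swap).aemeasurable]
    rfl
  have hle : ∀ y ∈ A ∩ Metric.closedBall y₀ r, ENNReal.ofReal (9 / 10 * r) ≤ φ y := by
    rintro y ⟨⟨h, hhI, hmost, hae⟩, hy⟩
    have hhs : h ≤ sSup H := le_csSup hHb ⟨y, hy, hhI, hmost, hae⟩
    have hsub : I ⊆ Ioo h (a + 2 * σ) := fun s hs =>
      ⟨by linarith [hs.1], by linarith [hs.2, hh₁I.2, hr2.2]⟩
    have hvI : volume I = ENNReal.ofReal (9 / 10 * r) := by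
      rw [hI, Real.volume_Ioo]
      congr 1
      ring
    rw [← hvI, ← lintegral_indicator_one measurableSet_Ioo]
    refine lintegral_mono_ae ?_
    have hae' := ae_restrict_of_ae_restrict_of_subset hsub hae
    rw [ae_restrict_iff' measurableSet_Ioo] at hae'
    filter_upwards [hae'] with s hs
    by_cases hsI : s ∈ I
    · rw [indicator_of_mem hsI, indicator_of_mem]
      · rfl
      refine ⟨hs hsI, ?_⟩
      have h1 := dist_pt_sq y y₁ s h₁
      have h2 : dist y y₁ ≤ 2 * r := by
        have := dist_triangle_right y y₁ y₀
        rw [Metric.mem_closedBall] at hy hy₁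
        linarith
      have h3 : (s - h₁) ^ 2 ≤ r ^ 2 := by
        have := hsI.1; have := hsI.2
        nlinarith
      rw [Metric.mem_ball]
      refine lt_of_pow_lt_pow_left₀ 2 (by positivity) ?_
      rw [h1]
      nlinarith [dist_nonneg (x := y) (y := y₁)]
    · rw [indicator_of_notMem hsI]
      exact zero_le
  -- Markov: more than half of the base points have at least `9 r / 10` of `Mᶜ` above them, against
  -- the smallness of `Mᶜ` around the tip
  have hmark := mul_meas_ge_le_lintegral (μ := volume) hφm (ENNReal.ofReal (9 / 10 * r))
  have h3r : 3 * r < 1 / ((k : ℝ) + 1) := by linarith [hr3.2]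
  have hupper := hin (3 * r) (by positivity) h3r
  rw [hvol] at hupper
  have hsmall := hδ r hr0 (pt y₁ h₁) y₀
  refine absurd hsmall (not_lt.2 ?_)
  calc ENNReal.ofReal (r / 4) * volume (Metric.closedBall y₀ r)
      ≤ ENNReal.ofReal (9 / 10 * r) * (1 / 2 * volume (Metric.closedBall y₀ r)) := by
        rw [← mul_assoc]
        gcongr
        have h2 : (1 / 2 : ℝ≥0∞) = ENNReal.ofReal (1 / 2) := by
          rw [ENNReal.ofReal_div_of_pos two_pos]; simp
        rw [h2, ← ENNReal.ofReal_mul (by positivity)]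
        exact ENNReal.ofReal_le_ofReal (by linarith)
    _ ≤ ENNReal.ofReal (9 / 10 * r) * volume (A ∩ Metric.closedBall y₀ r) := by gcongr
    _ ≤ ENNReal.ofReal (9 / 10 * r) * volume {y | ENNReal.ofReal (9 / 10 * r) ≤ φ y} := by
        gcongr
        exact hle
    _ ≤ ∫⁻ y, φ y := hmark
    _ ≤ _ := hupper

/-- The horizontal part of a point of `ℝ^{n+1}`. -/
noncomputable def hor (x : EuclideanSpace ℝ (Fin (n + 1))) : EuclideanSpace ℝ (Fin n) :=
  WithLp.toLp 2 fun i => x i.castSucc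

lemma pt_hor (x : EuclideanSpace ℝ (Fin (n + 1))) : pt (hor x) (x (Fin.last n)) = x := by
  ext i
  refine Fin.lastCases ?_ (fun j => ?_) i <;> simp [pt, hor]

@[simp] lemma hor_pt (y : EuclideanSpace ℝ (Fin n)) (s : ℝ) : hor (pt y s) = y := by
  ext i
  simp [pt, hor]

lemma lipschitzWith_hor : LipschitzWith 1 (hor : EuclideanSpace ℝ (Fin (n + 1)) → _) := by
  refine LipschitzWith.of_dist_le_mul fun x y => ?_
  rw [NNReal.coe_one, one_mul]
  refine (sq_le_sq₀ dist_nonneg dist_nonneg).1 ?_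
  have h := dist_pt_sq (hor x) (hor y) (x (Fin.last n)) (y (Fin.last n))
  rw [pt_hor, pt_hor] at h
  rw [h]
  nlinarith [sq_nonneg (x (Fin.last n) - y (Fin.last n))]

lemma volume_image_hor {Z : Set (EuclideanSpace ℝ (Fin (n + 1)))} (hZ : μHE[n] Z = 0) :
    volume (hor '' Z) = 0 := by
  have h := euclideanHausdorff_image_le_of_edist_le (f := hor) (g := id) (A := Z) (C := 1) n
    (fun x _ y _ => lipschitzWith_hor x y)
  rw [image_id, hZ, mul_zero, nonpos_iff_eq_zero,
    EuclideanSpace.euclideanHausdorffMeasure_eq_volume] at h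
  exact h

lemma quasiMeasurePreserving_hor :
    Measure.QuasiMeasurePreserving (hor : EuclideanSpace ℝ (Fin (n + 1)) → _) := by
  have h1 : (hor : EuclideanSpace ℝ (Fin (n + 1)) → _) = Prod.snd ∘ (heightEquiv n).symm := by
    ext x : 1
    have : heightEquiv n (x (Fin.last n), hor x) = x := by
      rw [heightEquiv_apply]
      exact pt_hor x
    simp only [Function.comp]
    conv_rhs => rw [← this, MeasurableEquiv.symm_apply_apply]
  rw [h1]
  exact Measure.quasiMeasurePreserving_snd.comp
    ((measurePreserving_heightEquiv n).symm).quasiMeasurePreserving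

lemma ae_ae_pt {p : EuclideanSpace ℝ (Fin (n + 1)) → Prop} (hp : ∀ᵐ x, p x) :
    ∀ᵐ y : EuclideanSpace ℝ (Fin n), ∀ᵐ s : ℝ, p (pt y s) := by
  have h1 : ∀ᵐ q : ℝ × EuclideanSpace ℝ (Fin n), p (pt q.2 q.1) := by
    have := (measurePreserving_heightEquiv n).quasiMeasurePreserving.ae hp
    simpa only [heightEquiv_apply, pt] using this
  have h2 : ∀ᵐ q : EuclideanSpace ℝ (Fin n) × ℝ, p (pt q.1 q.2) :=
    Measure.measurePreserving_swap.quasiMeasurePreserving.ae h1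
  exact Measure.ae_ae_of_ae_prod h2

/-- The reflection in the hyperplane `{x_N = 0}`. -/
noncomputable def flipLast (n : ℕ) :
    EuclideanSpace ℝ (Fin (n + 1)) ≃ₗᵢ[ℝ] EuclideanSpace ℝ (Fin (n + 1)) :=
  (ℝ ∙ eLast n)ᗮ.reflection

lemma flipLast_pt (y : EuclideanSpace ℝ (Fin n)) (s : ℝ) : flipLast n (pt y s) = pt y (-s) := by
  have h1 : flipLast n (emb n y) = emb n y := by
    refine Submodule.reflection_mem_subspace_eq_self ?_
    rw [Submodule.mem_orthogonal_singleton_iff_inner_left, inner_eLast, emb_last]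
  have h2 : flipLast n (eLast n) = - eLast n :=
    Submodule.reflection_orthogonalComplement_singleton_eq_neg _
  rw [pt, pt, map_add, map_smul, h1, h2]
  simp

lemma mostlyIn_preimage (e : EuclideanSpace ℝ (Fin (n + 1)) ≃ₗᵢ[ℝ] EuclideanSpace ℝ (Fin (n + 1)))
    (M : Set (EuclideanSpace ℝ (Fin (n + 1)))) (δ : ℝ≥0∞) (k : ℕ) :
    mostlyIn (e ⁻¹' M) δ k = e ⁻¹' mostlyIn M δ k := by
  ext x
  simp only [mostlyIn, mem_preimage, mem_ofPred_eq, ← preimage_compl, volume_preimage_inter_ball,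
    volume_ball_isometry]

lemma ae_no_jump_up {M : Set (EuclideanSpace ℝ (Fin (n + 1)))} (hM : MeasurableSet M)
    {δ : ℝ≥0∞} (hδ : IsSmallProportion n δ) :
    ∀ᵐ y : EuclideanSpace ℝ (Fin n), ∀ h k, pt y h ∈ mostlyIn M δ k → ∀ s > h,
      ¬ ∀ᵐ t ∂(volume.restrict (Ioo h s)), pt y t ∉ M := by
  have h1 : ∀ᵐ y : EuclideanSpace ℝ (Fin n), ∀ k : ℕ, ∀ a σ : ℚ, 0 < (σ : ℝ) →
      y ∉ upperCusps M δ k a σ := by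
    refine ae_all_iff.2 fun k => ae_all_iff.2 fun a => ae_all_iff.2 fun σ => ?_
    by_cases hσ : 0 < (σ : ℝ)
    · filter_upwards [measure_eq_zero_iff_ae_notMem.1 (volume_upperCusps hM hδ k a hσ)] with y hy _
      exact hy
    · exact Eventually.of_forall fun y hσ' => absurd hσ' hσ
  filter_upwards [h1] with y hy h k hk s hs hae
  obtain ⟨σ, hσ0, hσ⟩ := exists_rat_btwn (show (0 : ℝ) < (s - h) / 2 by linarith)
  obtain ⟨a, ha1, ha2⟩ := exists_rat_btwn (show h - σ < h by linarith)
  refine hy k a σ hσ0 ⟨h, ⟨ha2.le, by linarith⟩, hk, ?_⟩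
  exact ae_restrict_of_ae_restrict_of_subset (Ioo_subset_Ioo_right (by linarith)) hae

lemma ae_no_jump_down {M : Set (EuclideanSpace ℝ (Fin (n + 1)))} (hM : MeasurableSet M)
    {δ : ℝ≥0∞} (hδ : IsSmallProportion n δ) :
    ∀ᵐ y : EuclideanSpace ℝ (Fin n), ∀ h k, pt y h ∈ mostlyIn M δ k → ∀ s < h,
      ¬ ∀ᵐ t ∂(volume.restrict (Ioo s h)), pt y t ∉ M := by
  have hM' : MeasurableSet (flipLast n ⁻¹' M) := hM.preimage (flipLast n).continuous.measurable
  filter_upwards [ae_no_jump_up hM' hδ] with y hy h k hk s hs hae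
  refine hy (-h) k ?_ (-s) (neg_lt_neg hs) ?_
  · rw [mostlyIn_preimage, mem_preimage, flipLast_pt, neg_neg]
    exact hk
  · rw [ae_restrict_iff' measurableSet_Ioo] at hae ⊢
    have := (Measure.measurePreserving_neg (volume : Measure ℝ)).quasiMeasurePreserving.ae hae
    filter_upwards [this] with t ht htI
    rw [mem_preimage, flipLast_pt]
    exact ht ⟨by linarith [htI.2], by linarith [htI.1]⟩

/-- If the essential boundary of `M` is `H_n`-negligible in the open convex set `O`, then almost
every vertical line stays in `O` within the points of density one, or within the points of density
zero. -/
lemma ae_line_subset {M O : Set (EuclideanSpace ℝ (Fin (n + 1)))} (hM : MeasurableSet M)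
    (hO : IsOpen O) (hOc : Convex ℝ O) (hZ : μHE[n] (essBoundary M ∩ O) = 0) :
    ∀ᵐ y : EuclideanSpace ℝ (Fin n), (∀ s, pt y s ∈ O → pt y s ∈ densOne M) ∨
      ∀ s, pt y s ∈ O → pt y s ∈ densZero M := by
  obtain ⟨δ, hδ0, hδ1, hδ⟩ := exists_isSmallProportion n
  have hMn := hM.nullMeasurableSet (μ := volume)
  filter_upwards [ae_no_jump_up hM hδ, ae_no_jump_down hM hδ, ae_no_jump_up hM.compl hδ,
    ae_no_jump_down hM.compl hδ, ae_ae_pt (ae_mem_iff_mem_densOne hMn),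
    ae_ae_pt (ae_mem_iff_mem_densOne hMn.compl),
    measure_eq_zero_iff_ae_notMem.1 (volume_image_hor hZ)] with y h1 h2 h3 h4 h5 h6 h7
  rw [densOne_compl hMn] at h6
  have hcont : Continuous fun s => pt y s := continuous_pt.comp (by fun_prop : Continuous fun s : ℝ => (y, s))
  set J : Set ℝ := {s | pt y s ∈ O} with hJ
  have hJo : IsOpen J := hO.preimage hcont
  have hJc : IsPreconnected J := by
    refine Convex.isPreconnected ?_
    intro s hs t ht a b ha hb hab
    have : pt y (a • s + b • t) = a • pt y s + b • pt y t := by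
      have : y = (a + b) • y := by rw [hab, one_smul]
      conv_lhs => rw [this]
      simp only [pt, map_add, map_smul, add_smul, smul_add, smul_eq_mul, mul_smul]
      abel
    rw [hJ, mem_ofPred_eq, this]
    exact hOc hs ht ha hb hab
  set A : Set ℝ := {s | s ∈ J ∧ pt y s ∈ densOne M} with hA
  set B : Set ℝ := {s | s ∈ J ∧ pt y s ∈ densZero M} with hB
  -- the line avoids the essential boundary
  have hcover : ∀ s ∈ J, pt y s ∈ densOne M ∨ pt y s ∈ densZero M := by
    intro s hs
    by_contra! hcon
    exact h7 ⟨pt y s, ⟨⟨hcon.2, hcon.1⟩, hs⟩, hor_pt y s⟩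
  have hAB : A ∪ B = J := by
    ext s
    constructor
    · rintro (h | h) <;> exact h.1
    · intro h
      exact (hcover s h).imp (fun h' => ⟨h, h'⟩) fun h' => ⟨h, h'⟩
  have hd : Disjoint A B := disjoint_left.2 fun s hs hs' =>
    disjoint_left.1 disjoint_densZero_densOne hs'.2 hs.2
  have hAU : A = J ∩ ⋃ k, {s | pt y s ∈ mostlyIn M δ k} := by
    ext s
    refine and_congr_right fun hs => ?_
    rw [mem_iUnion]
    refine ⟨fun h => exists_mem_mostlyIn hMn hδ0 h, fun ⟨k, hk⟩ => ?_⟩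
    exact (hcover s hs).resolve_right (notMem_densZero_of_mem_mostlyIn hMn hδ1 hk)
  have hBU : B = J ∩ ⋃ k, {s | pt y s ∈ mostlyIn Mᶜ δ k} := by
    ext s
    refine and_congr_right fun hs => ?_
    rw [mem_iUnion, ← densOne_compl hMn]
    refine ⟨fun h => exists_mem_mostlyIn hMn.compl hδ0 h, fun ⟨k, hk⟩ => ?_⟩
    have := notMem_densZero_of_mem_mostlyIn hMn.compl hδ1 hk
    rw [densZero_compl hMn] at this
    rw [densOne_compl hMn]
    exact (hcover s hs).resolve_left this
  have hAae : ∀ I : Set ℝ, MeasurableSet I → I ⊆ A → ∀ᵐ t ∂(volume.restrict I), pt y t ∉ Mᶜ := by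
    intro I hI hIA
    rw [ae_restrict_iff' hI]
    filter_upwards [h5] with t ht htI
    exact not_not.2 (ht.2 (hIA htI).2)
  have hBae : ∀ I : Set ℝ, MeasurableSet I → I ⊆ B → ∀ᵐ t ∂(volume.restrict I), pt y t ∉ M := by
    intro I hI hIB
    rw [ae_restrict_iff' hI]
    filter_upwards [h6] with t ht htI
    exact ht.2 (hIB htI).2
  have hAk : ∀ h ∈ A, ∃ k, pt y h ∈ mostlyIn M δ k := fun h hh => exists_mem_mostlyIn hMn hδ0 hh.2
  have hBk : ∀ h ∈ B, ∃ k, pt y h ∈ mostlyIn Mᶜ δ k := fun h hh =>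
    exists_mem_mostlyIn hMn.compl hδ0 (by rw [densOne_compl hMn]; exact hh.2)
  -- a one-sided interval of the other type ending at a point of `A` or `B` would be a cusp
  have hfin := eq_empty_or_eq_empty_of_no_jumps hJo hJc hAB hd
    (fun k => (isClosed_mostlyIn M δ k).preimage hcont)
    (fun k => (isClosed_mostlyIn Mᶜ δ k).preimage hcont) hAU hBU
    (fun h hh s hs hsub => by
      obtain ⟨k, hk⟩ := hAk h hh
      exact h2 h k hk s hs (hBae _ measurableSet_Ioo hsub))
    (fun h hh s hs hsub => by
      obtain ⟨k, hk⟩ := hAk h hh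
      exact h1 h k hk s hs (hBae _ measurableSet_Ioo hsub))
    (fun h hh s hs hsub => by
      obtain ⟨k, hk⟩ := hBk h hh
      exact h4 h k hk s hs (hAae _ measurableSet_Ioo hsub))
    (fun h hh s hs hsub => by
      obtain ⟨k, hk⟩ := hBk h hh
      exact h3 h k hk s hs (hAae _ measurableSet_Ioo hsub))
  rcases hfin with h | h
  · refine Or.inr fun s hs => (hcover s hs).resolve_left fun h' => ?_
    have : s ∈ A := ⟨hs, h'⟩
    rw [h] at this
    exact this
  · refine Or.inl fun s hs => (hcover s hs).resolve_right fun h' => ?_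
    have : s ∈ B := ⟨hs, h'⟩
    rw [h] at this
    exact this

lemma volume_inter_ball_add_smul_eLast {M O : Set (EuclideanSpace ℝ (Fin (n + 1)))}
    (hM : MeasurableSet M) (hO : IsOpen O) (hOc : Convex ℝ O)
    (hZ : μHE[n] (essBoundary M ∩ O) = 0) {x : EuclideanSpace ℝ (Fin (n + 1))} {τ r : ℝ}
    (hx : Metric.ball x r ⊆ O) (hx' : Metric.ball (x + τ • eLast n) r ⊆ O) :
    volume (M ∩ Metric.ball (x + τ • eLast n) r) = volume (M ∩ Metric.ball x r) := by
  set v := τ • eLast n with hv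
  have hmp := measurePreserving_add_right (volume : Measure (EuclideanSpace ℝ (Fin (n + 1)))) v
  have h1 : volume (M ∩ Metric.ball (x + v) r) =
      volume ((fun y => y + v) ⁻¹' M ∩ Metric.ball x r) := by
    rw [← hmp.measure_preimage (hM.inter Metric.isOpen_ball.measurableSet).nullMeasurableSet,
      preimage_inter]
    congr 2
    ext y
    simp
  rw [h1]
  refine measure_congr ?_
  have hae := ae_mem_iff_mem_densOne hM.nullMeasurableSet
  filter_upwards [quasiMeasurePreserving_hor.ae (ae_line_subset hM hO hOc hZ), hae,
    hmp.quasiMeasurePreserving.ae hae] with y h2 h3 h4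
  refine propext (and_congr_left fun hy => ?_)
  have hyO : pt (hor y) (y (Fin.last n)) ∈ O := by rw [pt_hor]; exact hx hy
  have hyv : pt (hor y) (y (Fin.last n) + τ) = y + v := by
    conv_rhs => rw [← pt_hor y]
    rw [pt, pt, add_smul, add_assoc]
  have hyvO : pt (hor y) (y (Fin.last n) + τ) ∈ O := by
    rw [hyv]
    refine hx' ?_
    simpa using hy
  change y + v ∈ M ↔ y ∈ M
  rw [h3, h4]
  rcases h2 with h2 | h2
  · have e1 := h2 _ hyO
    have e2 := h2 _ hyvO
    rw [pt_hor] at e1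
    rw [hyv] at e2
    exact iff_of_true e2 e1
  · have e1 := h2 _ hyO
    have e2 := h2 _ hyvO
    rw [pt_hor] at e1
    rw [hyv] at e2
    exact iff_of_false (disjoint_left.1 disjoint_densZero_densOne e2)
      (disjoint_left.1 disjoint_densZero_densOne e1)

/-- A measurable set whose essential boundary in a convex open set `O` is `H_n`-negligible is
null or conull in `O`: by the previous lemma, applied after a rotation, `M` occupies equal volumes in
small balls around any two points of `O`. -/
theorem null_or_conull_of_essBoundary_null {M O : Set (EuclideanSpace ℝ (Fin (n + 1)))}
    (hM : NullMeasurableSet M) (hO : IsOpen O) (hOc : Convex ℝ O)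
    (hZ : μHE[n] (essBoundary M ∩ O) = 0) : volume (O ∩ M) = 0 ∨ volume (O \ M) = 0 := by
  wlog hMm : MeasurableSet M generalizing M
  · obtain ⟨M', hM', hMM'⟩ := hM
    rw [essBoundary_congr hMM'] at hZ
    have := this hM'.nullMeasurableSet hZ hM'
    rwa [measure_congr ((ae_eq_refl O).inter hMM'), measure_congr ((ae_eq_refl O).diff hMM')]
  by_contra! hcon
  have hae := ae_mem_iff_mem_densOne hM
  obtain ⟨x₁, hx₁O, hx₁⟩ : ∃ x ∈ O, x ∈ densOne M := by
    obtain ⟨x, hx, h⟩ := Measure.exists_mem_of_measure_ne_zero_of_ae hcon.1 (ae_restrict_of_ae hae)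
    exact ⟨x, hx.1, h.1 hx.2⟩
  obtain ⟨x₀, hx₀O, hx₀⟩ : ∃ x ∈ O, x ∈ densZero M := by
    have hae' := ae_mem_iff_mem_densOne hM.compl
    rw [densOne_compl hM] at hae'
    obtain ⟨x, hx, h⟩ := Measure.exists_mem_of_measure_ne_zero_of_ae hcon.2 (ae_restrict_of_ae hae')
    exact ⟨x, hx.1, h.1 hx.2⟩
  have hne : x₁ - x₀ ≠ 0 := sub_ne_zero.2 fun h =>
    disjoint_left.1 disjoint_densZero_densOne hx₀ (h ▸ hx₁)
  set τ := ‖x₁ - x₀‖ with hτ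
  have hτ0 : 0 < τ := norm_pos_iff.2 hne
  -- the reflection that carries the direction `e_N` to that of `x₁ - x₀`
  set e := (ℝ ∙ (τ • eLast n - (x₁ - x₀)))ᗮ.reflection with he
  have hev : e (τ • eLast n) = x₁ - x₀ := by
    refine Submodule.reflection_sub ?_
    rw [norm_smul, norm_eLast, mul_one, Real.norm_of_nonneg hτ0.le]
  have hhalf : (1 / 2 : ℝ≥0∞) < 1 := by norm_num
  have hev1 := (tendsto_order.1 hx₁).1 _ hhalf
  have hev0 := (tendsto_order.1 hx₀).2 (1 / 2) (by norm_num)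
  have hball : ∀ x ∈ O, ∀ᶠ r in 𝓝[>] (0 : ℝ), Metric.ball x r ⊆ O := by
    intro x hx
    obtain ⟨ρ, hρ, hb⟩ := Metric.mem_nhds_iff.1 (hO.mem_nhds hx)
    filter_upwards [Ioo_mem_nhdsGT hρ] with r hr using (Metric.ball_subset_ball hr.2.le).trans hb
  obtain ⟨r, ⟨hr1, hr0⟩, hrb1, hrb0⟩ :=
    ((hev1.and hev0).and ((hball x₁ hx₁O).and (hball x₀ hx₀O))).exists
  have hZ' : μHE[n] (essBoundary (e ⁻¹' M) ∩ e ⁻¹' O) = 0 := by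
    rw [essBoundary_preimage, ← preimage_inter, e.isometry.euclideanHausdorffMeasure_preimage]
    exact measure_mono_null inter_subset_left hZ
  have hsymm : ∀ x, e (e.symm x) = x := e.apply_symm_apply
  have hpre : ∀ x, e ⁻¹' Metric.ball x r = Metric.ball (e.symm x) r := by
    intro x
    exact e.preimage_ball x r
  have hx1 : e.symm x₀ + τ • eLast n = e.symm x₁ := by
    apply e.injective
    rw [map_add, hev, hsymm, hsymm, add_sub_cancel]
  have hfin := volume_inter_ball_add_smul_eLast (hMm.preimage e.continuous.measurable)
    (hO.preimage e.continuous) (hOc.linear_preimage e.toLinearEquiv.toLinearMap) hZ'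
    (x := e.symm x₀) (τ := τ) (r := r)
    (by rw [← hpre]; exact preimage_mono hrb0) (by rw [hx1, ← hpre]; exact preimage_mono hrb1)
  rw [hx1, volume_preimage_inter_ball, volume_preimage_inter_ball, hsymm, hsymm] at hfin
  rw [hfin, Measure.addHaar_ball_center volume x₁] at hr1
  rw [Measure.addHaar_ball_center volume x₀] at hr0
  exact lt_asymm hr1 hr0

end Lines

/-! ### Level sets, balls and half-balls -/

section Level

variable {n : ℕ}

/-- A regular point of the level set `{F = 0}` is in the essential boundary of `{F < 0}`. -/
lemma mem_essBoundary_of_hasFDerivAt {F : EuclideanSpace ℝ (Fin (n + 1)) → ℝ}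
    {L : EuclideanSpace ℝ (Fin (n + 1)) →L[ℝ] ℝ} {x : EuclideanSpace ℝ (Fin (n + 1))}
    {M : Set (EuclideanSpace ℝ (Fin (n + 1)))} (hF : HasFDerivAt F L x) (hL : L ≠ 0)
    (h0 : F x = 0) (hM : ∀ᶠ y in 𝓝 x, (F y < 0 → y ∈ M) ∧ (0 < F y → y ∉ M)) :
    x ∈ essBoundary M := by
  obtain ⟨v, hv⟩ : ∃ v, L v = 1 := by
    obtain ⟨u, hu⟩ := DFunLike.ne_iff.1 hL
    have hu' : L u ≠ 0 := by simpa using hu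
    exact ⟨(L u)⁻¹ • u, by rw [map_smul, smul_eq_mul, inv_mul_cancel₀ hu']⟩
  set A := ‖v‖ + 1 with hA
  have hA0 : 0 < A := by positivity
  set c : ℝ := min (1 / 2) (1 / (8 * A * (‖L‖ + 1))) with hc
  have hc0 : 0 < c := by positivity
  have hcL : ‖L‖ * c ≤ 1 / (8 * A) := by
    have h1 : c ≤ 1 / (8 * A * (‖L‖ + 1)) := min_le_right _ _
    calc ‖L‖ * c ≤ (‖L‖ + 1) * (1 / (8 * A * (‖L‖ + 1))) := by gcongr; linarith
      _ = 1 / (8 * A) := by field_simp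
  have hη : (0 : ℝ) < 1 / (8 * A) := by positivity
  obtain ⟨ρ, hρ, hb⟩ := Metric.eventually_nhds_iff_ball.1 ((hF.isLittleO.def hη).and hM)
  refine mem_essBoundary_of_balls hc0 ?_
  filter_upwards [Ioo_mem_nhdsGT hρ] with r hr
  set s := r / (2 * A) with hs
  have hr0 := hr.1
  have hs0 : 0 < s := by positivity
  have hsv : ‖s • v‖ < r / 2 := by
    rw [norm_smul, Real.norm_of_nonneg hs0.le, hs, div_mul_eq_mul_div, div_lt_div_iff₀ (by positivity) two_pos]
    have : ‖v‖ < A := by rw [hA]; linarith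
    nlinarith [mul_lt_mul_of_pos_left this hr0]
  have key : ∀ σ : ℝ, |σ| = 1 → ∀ y ∈ Metric.ball (x + (σ * s) • v) (c * r),
      y ∈ Metric.ball x r ∧ |F y - σ * s| < s := by
    intro σ hσ y hy
    set w := y - (x + (σ * s) • v) with hw
    have hwn : ‖w‖ < c * r := by rwa [Metric.mem_ball, dist_eq_norm] at hy
    have hyx : y - x = (σ * s) • v + w := by rw [hw]; abel
    have hσs : ‖(σ * s) • v‖ < r / 2 := by
      rw [mul_smul, norm_smul, Real.norm_eq_abs, hσ, one_mul]; exact hsv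
    have hyr : ‖y - x‖ < r := by
      rw [hyx]
      have h1 := norm_add_le ((σ * s) • v) w
      have h2 : c * r ≤ 1 / 2 * r := by gcongr; exact min_le_left _ _
      linarith
    have hball : y ∈ Metric.ball x r := by rwa [Metric.mem_ball, dist_eq_norm]
    refine ⟨hball, ?_⟩
    have h3 := (hb y (Metric.ball_subset_ball hr.2.le hball)).1
    rw [h0, sub_zero, hyx, map_add, map_smul, hv, smul_eq_mul, mul_one, ← hyx, Real.norm_eq_abs] at h3
    have h4 : |L w| ≤ ‖L‖ * (c * r) := (L.le_opNorm w).trans (by gcongr)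
    have h5 : 1 / (8 * A) * ‖y - x‖ ≤ 1 / (8 * A) * r := by gcongr
    have h6 : ‖L‖ * (c * r) ≤ 1 / (8 * A) * r := by rw [← mul_assoc]; gcongr
    have h7 : 1 / (8 * A) * r = s / 4 := by rw [hs]; field_simp; norm_num
    have h8 : |F y - σ * s| ≤ |F y - (σ * s + L w)| + |L w| := by
      have := abs_add_le (F y - (σ * s + L w)) (L w)
      rwa [show F y - (σ * s + L w) + L w = F y - σ * s by ring] at this
    linarith
  constructor
  · refine ⟨x + ((-1) * s) • v, fun y hy => ?_⟩
    obtain ⟨h1, h2⟩ := key (-1) (by simp) y hy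
    refine ⟨(hb y (Metric.ball_subset_ball hr.2.le h1)).2.1 ?_, h1⟩
    have := (abs_lt.1 h2).2
    linarith
  · refine ⟨x + (1 * s) • v, fun y hy => ?_⟩
    obtain ⟨h1, h2⟩ := key 1 (by simp) y hy
    refine ⟨h1, (hb y (Metric.ball_subset_ball hr.2.le h1)).2.2 ?_⟩
    have := (abs_lt.1 h2).1
    linarith

lemma hasFDerivAt_norm_sub_sq (a x : EuclideanSpace ℝ (Fin (n + 1))) (R : ℝ) :
    HasFDerivAt (fun y => ‖y - a‖ ^ 2 - R ^ 2) (2 • innerSL ℝ (x - a)) x := by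
  have h := (hasStrictFDerivAt_norm_sq (x - a)).hasFDerivAt.comp x ((hasFDerivAt_id x).sub_const a)
  exact (h.sub_const (R ^ 2)).congr_fderiv (by ext; simp)

lemma innerSL_ne_zero {x : EuclideanSpace ℝ (Fin (n + 1))} (hx : x ≠ 0) :
    2 • innerSL ℝ x ≠ 0 := by
  intro h
  have := DFunLike.congr_fun h x
  simp at this
  exact hx this

/-- A set that near `x` coincides with the ball `B_R(a)`, where `|x - a| = R`, has `x` in its
essential boundary. -/
lemma mem_essBoundary_of_sphere {M : Set (EuclideanSpace ℝ (Fin (n + 1)))}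
    {a x : EuclideanSpace ℝ (Fin (n + 1))} {R : ℝ} (hR : 0 < R) (hx : x ∈ Metric.sphere a R)
    (hM : ∀ᶠ y in 𝓝 x, y ∈ M ↔ y ∈ Metric.ball a R) : x ∈ essBoundary M := by
  have hxR : ‖x - a‖ = R := by rw [← dist_eq_norm]; exact hx
  refine mem_essBoundary_of_hasFDerivAt (hasFDerivAt_norm_sub_sq a x R) (innerSL_ne_zero ?_) ?_ ?_
  · exact norm_pos_iff.1 (hxR ▸ hR)
  · simp [hxR]
  · filter_upwards [hM] with y hy
    rw [hy, Metric.mem_ball, dist_eq_norm]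
    constructor
    · intro h
      exact lt_of_pow_lt_pow_left₀ 2 hR.le (by linarith)
    · intro h h'
      have := pow_lt_pow_left₀ h' (norm_nonneg _) two_ne_zero
      linarith

lemma essBoundary_ball (a : EuclideanSpace ℝ (Fin (n + 1))) {R : ℝ} (hR : 0 < R) :
    essBoundary (Metric.ball a R) = Metric.sphere a R := by
  refine subset_antisymm ?_ fun x hx => mem_essBoundary_of_sphere hR hx (Eventually.of_forall fun _ => Iff.rfl)
  exact essBoundary_subset_frontier.trans (frontier_ball a hR.ne').subset

lemma essBoundary_halfBall_inter {R : ℝ} (hR : 0 < R) :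
    essBoundary (halfBall n R) ∩ halfSpace n = Metric.sphere 0 R ∩ halfSpace n := by
  ext x
  refine and_congr_left fun hx => ⟨fun h => ?_, fun h => ?_⟩
  · rw [← frontier_ball (0 : EuclideanSpace ℝ (Fin (n + 1))) hR.ne']
    have h1 := essBoundary_subset_frontier h
    refine ⟨closure_mono inter_subset_left h1.1, fun h2 => h1.2 ?_⟩
    rw [halfBall, interior_inter, isOpen_halfSpace.interior_eq]
    exact ⟨h2, hx⟩
  · refine mem_essBoundary_of_sphere hR h ?_
    filter_upwards [isOpen_halfSpace.mem_nhds hx] with y hy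
    exact and_iff_left hy

/-- A small piece of a sphere is the graph of a smooth function. -/
lemma exists_graph_sphere {a x₀ : EuclideanSpace ℝ (Fin (n + 1))} {R r : ℝ} (hR : 0 < R)
    (hx₀ : x₀ ∈ Metric.sphere a R) (hrR : r ≤ R) (m : ℕ∞) :
    ∃ v : EuclideanSpace ℝ (Fin (n + 1)), ‖v‖ = 1 ∧
      ∃ (U : Set (ℝ ∙ v)ᗮ) (f : (ℝ ∙ v)ᗮ → ℝ), IsOpen U ∧ ContDiffOn ℝ m f U ∧
        Metric.ball x₀ r ∩ Metric.sphere a R =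
          (fun y : (ℝ ∙ v)ᗮ => (y : EuclideanSpace ℝ (Fin (n + 1))) + f y • v) '' U := by
  have hxR : ‖x₀ - a‖ = R := by rw [← dist_eq_norm]; exact hx₀
  set v := R⁻¹ • (x₀ - a) with hv
  have hv1 : ‖v‖ = 1 := by
    rw [hv, norm_smul, hxR, norm_inv, Real.norm_of_nonneg hR.le, inv_mul_cancel₀ hR.ne']
  have hxv : x₀ - a = R • v := by rw [hv, smul_inv_smul₀ hR.ne']
  set p : (ℝ ∙ v)ᗮ := (ℝ ∙ v)ᗮ.orthogonalProjectionOnto a with hp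
  have hdecomp : ∀ x : EuclideanSpace ℝ (Fin (n + 1)),
      (((ℝ ∙ v)ᗮ.orthogonalProjectionOnto x : (ℝ ∙ v)ᗮ) : EuclideanSpace ℝ (Fin (n + 1))) +
        inner ℝ v x • v = x := by
    intro x
    have h1 := (ℝ ∙ v).starProjection_add_starProjection_orthogonal x
    rw [Submodule.starProjection_unit_singleton ℝ hv1] at h1
    exact (add_comm _ _).trans h1
  have hpyth : ∀ (y : (ℝ ∙ v)ᗮ) (s : ℝ),
      ‖(y : EuclideanSpace ℝ (Fin (n + 1))) + s • v - a‖ ^ 2 = ‖y - p‖ ^ 2 + (s - inner ℝ v a) ^ 2 := by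
    intro y s
    have h1 : (y : EuclideanSpace ℝ (Fin (n + 1))) + s • v - a =
        ((y - p : (ℝ ∙ v)ᗮ) : EuclideanSpace ℝ (Fin (n + 1))) + (s - inner ℝ v a) • v := by
      conv_lhs => rw [← hdecomp a]
      rw [Submodule.coe_sub, sub_smul]
      abel
    have h2 : inner ℝ ((y - p : (ℝ ∙ v)ᗮ) : EuclideanSpace ℝ (Fin (n + 1))) ((s - inner ℝ v a) • v) = 0 := by
      rw [inner_smul_right, Submodule.mem_orthogonal_singleton_iff_inner_left.1 (y - p).2, mul_zero]
    rw [h1, sq, norm_add_sq_eq_norm_sq_add_norm_sq_real h2, norm_smul, hv1, Submodule.coe_norm,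
      mul_one, ← sq, ← sq, Real.norm_eq_abs, sq_abs]
  set f : (ℝ ∙ v)ᗮ → ℝ := fun y => inner ℝ v a + √(R ^ 2 - ‖y - p‖ ^ 2) with hf
  have hfc : Continuous f := by rw [hf]; fun_prop
  set U : Set (ℝ ∙ v)ᗮ := {y | ‖y - p‖ < R ∧
    (y : EuclideanSpace ℝ (Fin (n + 1))) + f y • v ∈ Metric.ball x₀ r} with hU
  refine ⟨v, hv1, U, f, ?_, ?_, ?_⟩
  · refine (isOpen_lt (continuous_id.sub continuous_const).norm continuous_const).inter
      (Metric.isOpen_ball.preimage ?_)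
    fun_prop
  · intro y hy
    have hpos : R ^ 2 - ‖y - p‖ ^ 2 ≠ 0 := by
      have := pow_lt_pow_left₀ hy.1 (norm_nonneg _) two_ne_zero
      linarith
    have h1 : ContDiffAt ℝ m (fun y : (ℝ ∙ v)ᗮ => R ^ 2 - ‖y - p‖ ^ 2) y :=
      contDiffAt_const.sub ((contDiffAt_id.sub contDiffAt_const).norm_sq ℝ)
    exact (contDiffAt_const.add (h1.sqrt hpos)).contDiffWithinAt
  · ext x
    constructor
    · rintro ⟨hxb, hxs⟩
      set y : (ℝ ∙ v)ᗮ := (ℝ ∙ v)ᗮ.orthogonalProjectionOnto x with hy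
      have hxy := hdecomp x
      rw [← hy] at hxy
      have hn := hpyth y (inner ℝ v x)
      rw [hxy, ← dist_eq_norm, Metric.mem_sphere.1 hxs] at hn
      have hpos : 0 < inner ℝ v x - inner ℝ v a := by
        have h1 : ‖x - x₀‖ ^ 2 < R ^ 2 := by
          refine pow_lt_pow_left₀ ?_ (norm_nonneg _) two_ne_zero
          rw [← dist_eq_norm]
          exact (Metric.mem_ball.1 hxb).trans_le hrR
        have h2 : x - x₀ = (x - a) - R • v := by rw [← hxv]; abel
        have h3 : ‖x - a‖ = R := by rw [← dist_eq_norm]; exact hxs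
        rw [h2, norm_sub_sq_real, h3, norm_smul, hv1, inner_smul_right, real_inner_comm,
          inner_sub_right, Real.norm_of_nonneg hR.le, mul_one] at h1
        nlinarith
      have hfy : f y = inner ℝ v x := by
        have : R ^ 2 - ‖y - p‖ ^ 2 = (inner ℝ v x - inner ℝ v a) ^ 2 := by linarith
        rw [hf]
        simp only
        rw [this, Real.sqrt_sq hpos.le]
        ring
      refine ⟨y, ⟨?_, ?_⟩, ?_⟩
      · refine lt_of_pow_lt_pow_left₀ 2 hR.le ?_
        nlinarith [pow_pos hpos 2]
      · rw [hfy, hxy]; exact hxb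
      · simp only
        rw [hfy, hxy]
    · rintro ⟨y, hy, rfl⟩
      refine ⟨hy.2, ?_⟩
      have hnn : 0 ≤ R ^ 2 - ‖y - p‖ ^ 2 := by
        have := pow_lt_pow_left₀ hy.1 (norm_nonneg _) two_ne_zero
        linarith
      have hn := hpyth y (f y)
      rw [hf] at hn
      simp only [add_sub_cancel_left] at hn
      rw [Real.sq_sqrt hnn, add_sub_cancel] at hn
      rw [Metric.mem_sphere, dist_eq_norm]
      exact (sq_eq_sq₀ (norm_nonneg _) hR.le).1 hn

lemma isConnected_ball_inter {x a : EuclideanSpace ℝ (Fin (n + 1))} {R r : ℝ} (hR : 0 < R)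
    (hr : 0 < r) (hx : x ∈ Metric.sphere a R) : IsConnected (Metric.ball x r ∩ Metric.ball a R) := by
  refine ⟨?_, ((convex_ball x r).inter (convex_ball a R)).isPreconnected⟩
  have h1 : x ∈ closure (Metric.ball a R) := by
    rw [closure_ball a hR.ne']
    exact Metric.sphere_subset_closedBall hx
  exact mem_closure_iff.1 h1 _ Metric.isOpen_ball (Metric.mem_ball_self hr)

lemma isCSet_ball {a : EuclideanSpace ℝ (Fin (n + 1))} {R : ℝ} (hR : 0 < R)
    (ha : Metric.ball a R ⊆ halfSpace n) (m : ℕ∞) : IsCSet m (Metric.ball a R) := by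
  refine ⟨ha, fun x₀ hx₀ => ?_⟩
  rw [essBoundary_ball a hR] at hx₀ ⊢
  exact ⟨R, hR, isConnected_ball_inter hR hR hx₀.1, exists_graph_sphere hR hx₀.1 le_rfl m⟩

lemma isCSet_halfBall {R : ℝ} (hR : 0 < R) (m : ℕ∞) : IsCSet m (halfBall n R) := by
  refine ⟨inter_subset_right, fun x₀ hx₀ => ?_⟩
  rw [essBoundary_halfBall_inter hR] at hx₀
  obtain ⟨ρ, hρ, hb⟩ := Metric.mem_nhds_iff.1 (isOpen_halfSpace.mem_nhds hx₀.2)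
  have hr : 0 < min ρ R := lt_min hρ hR
  have hsub : Metric.ball x₀ (min ρ R) ⊆ halfSpace n :=
    (Metric.ball_subset_ball (min_le_left _ _)).trans hb
  refine ⟨min ρ R, hr, ?_, ?_⟩
  · have : Metric.ball x₀ (min ρ R) ∩ halfBall n R = Metric.ball x₀ (min ρ R) ∩ Metric.ball 0 R := by
      ext x
      exact ⟨fun h => ⟨h.1, h.2.1⟩, fun h => ⟨h.1, h.2, hsub h.1⟩⟩
    rw [this]
    exact isConnected_ball_inter hR hr hx₀.1
  · have : Metric.ball x₀ (min ρ R) ∩ essBoundary (halfBall n R) =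
        Metric.ball x₀ (min ρ R) ∩ Metric.sphere 0 R := by
      ext x
      refine and_congr_right fun hx => ?_
      have := Set.ext_iff.1 (essBoundary_halfBall_inter (n := n) hR) x
      exact ⟨fun h => (this.1 ⟨h, hsub hx⟩).1, fun h => (this.2 ⟨h, hsub hx⟩).1⟩
    rw [this]
    exact exists_graph_sphere hR hx₀.1 (min_le_right _ _) m

end Level

/-! ### Balls have locally finite perimeter -/

section FinitePerimeter

variable {n : ℕ}

/-- The `i`-th partial derivative of the `i`-th component integrates over a ball to at most the rate
at which translation moves volume across the sphere. -/
lemma abs_integral_ball_partial_le (a : EuclideanSpace ℝ (Fin (n + 1))) {R : ℝ} (hR : 0 < R) :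
    ∃ C : ℝ, ∀ X : EuclideanSpace ℝ (Fin (n + 1)) → EuclideanSpace ℝ (Fin (n + 1)),
      ContDiff ℝ 1 X → HasCompactSupport X → (∀ x, ‖X x‖ ≤ 1) → ∀ i,
        ∫ x in Metric.ball a R, fderiv ℝ X x (EuclideanSpace.single i 1) i ≤ C := by
  set ω := (volume (Metric.ball (0 : EuclideanSpace ℝ (Fin (n + 1))) 1)).toReal with hω
  set V : ℝ → ℝ := fun h => (R + h) ^ (n + 1) * ω with hV
  have hvol : ∀ h, 0 ≤ h → volume.real (Metric.ball a (R + h)) = V h := by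
    intro h hh
    rw [Measure.real, Measure.addHaar_ball volume a (by positivity), finrank_euclideanSpace_fin,
      ENNReal.toReal_mul, ENNReal.toReal_ofReal (by positivity)]
  have hVd : HasDerivAt V ((n + 1) * R ^ n * ω) 0 := by
    have := (((hasDerivAt_id (0 : ℝ)).const_add R).pow (n + 1)).mul_const ω
    simpa [hV] using this
  refine ⟨2 * ((n + 1) * R ^ n * ω), fun X hX hXc hX1 i => ?_⟩
  set e : EuclideanSpace ℝ (Fin (n + 1)) := EuclideanSpace.single i 1 with he
  have he1 : ‖e‖ = 1 := by simp [he]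
  set B := Metric.ball a R with hB
  have hBm : MeasurableSet B := Metric.isOpen_ball.measurableSet
  have hBfin : volume B ≠ ∞ := measure_ball_lt_top.ne
  set f : EuclideanSpace ℝ (Fin (n + 1)) → ℝ := fun x => X x i with hf
  have hfc : Continuous f := (by fun_prop : Continuous fun y : EuclideanSpace ℝ (Fin (n + 1)) => y i).comp hX.continuous
  have hf1 : ∀ x, ‖f x‖ ≤ 1 := fun x => (PiLp.norm_apply_le (X x) i).trans (hX1 x)
  obtain ⟨K, hK⟩ := (hX.continuous_fderiv one_ne_zero).bounded_above_of_compact_support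
    (hXc.fderiv ℝ)
  have hder : ∀ x t, HasDerivAt (fun t : ℝ => f (x + t • e)) (fderiv ℝ X (x + t • e) e i) t := by
    intro x t
    have h1 : HasDerivAt (fun t : ℝ => x + t • e) e t := by
      simpa using ((hasDerivAt_id t).smul_const e).const_add x
    have h2 := ((hX.differentiable one_ne_zero) (x + t • e)).hasFDerivAt.comp_hasDerivAt t h1
    exact ((EuclideanSpace.proj i : EuclideanSpace ℝ (Fin (n + 1)) →L[ℝ] ℝ).hasFDerivAt).comp_hasDerivAt t h2
  have hbd : ∀ x t, ‖f (x + t • e) - f x‖ ≤ K * |t| := by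
    intro x t
    have h := Convex.norm_image_sub_le_of_norm_hasDerivWithin_le (s := univ) (C := K)
      (fun t _ => (hder x t).hasDerivWithinAt) (fun t _ => ?_) convex_univ (mem_univ 0) (mem_univ t)
    · simpa using h
    · refine (PiLp.norm_apply_le _ i).trans ((ContinuousLinearMap.le_opNorm _ _).trans ?_)
      rw [he1, mul_one]
      exact hK _
  have hmono : 𝓝[>] (0 : ℝ) ≤ 𝓝[≠] 0 := nhdsWithin_mono 0 fun h hh => ne_of_gt hh
  -- the difference quotients converge to the partial derivative
  have hlim : Tendsto (fun h : ℝ => ∫ x in B, h⁻¹ * (f (x + h • e) - f x)) (𝓝[>] 0)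
      (𝓝 (∫ x in B, fderiv ℝ X x e i)) := by
    refine tendsto_integral_filter_of_dominated_convergence (fun _ => K) ?_ ?_ ?_ ?_
    · refine Eventually.of_forall fun h => Continuous.aestronglyMeasurable ?_
      fun_prop
    · filter_upwards [self_mem_nhdsWithin] with h hh
      refine Eventually.of_forall fun x => ?_
      have hh0 : (0 : ℝ) < h := hh
      rw [norm_mul, norm_inv, Real.norm_of_nonneg hh0.le, inv_mul_le_iff₀ hh0, mul_comm]
      have := hbd x h
      rwa [abs_of_pos hh0] at this
    · exact integrable_const_iff.2 (Or.inr (by rw [isFiniteMeasure_restrict]; exact hBfin))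
    · refine Eventually.of_forall fun x => ?_
      have h1 := (hasDerivAt_iff_tendsto_slope_zero.1 (hder x 0)).mono_left
        hmono
      simpa using h1
  have hquot : Tendsto (fun h : ℝ => 2 * (h⁻¹ * (V h - V 0))) (𝓝[>] 0)
      (𝓝 (2 * ((n + 1) * R ^ n * ω))) := by
    have h1 := (hasDerivAt_iff_tendsto_slope_zero.1 hVd).mono_left
      hmono
    simpa using h1.const_mul 2
  refine le_of_tendsto_of_tendsto hlim hquot ?_
  filter_upwards [self_mem_nhdsWithin] with h hh
  have hh0 : (0 : ℝ) < h := hh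
  rw [integral_const_mul]
  have hint : ∀ s : Set (EuclideanSpace ℝ (Fin (n + 1))), volume s ≠ ∞ → IntegrableOn f s := by
    intro s hs
    refine Measure.integrableOn_of_bounded hs hfc.aestronglyMeasurable (Eventually.of_forall hf1)
  set B' := (fun x => x - h • e) ⁻¹' B with hB'
  have hmp := measurePreserving_sub_right (volume : Measure (EuclideanSpace ℝ (Fin (n + 1)))) (h • e)
  have hmp' := measurePreserving_add_right (volume : Measure (EuclideanSpace ℝ (Fin (n + 1)))) (h • e)
  have hB'm : MeasurableSet B' := hBm.preimage hmp.measurable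
  have hB'v : volume B' = volume B := hmp.measure_preimage hBm.nullMeasurableSet
  have hB'fin : volume B' ≠ ∞ := hB'v ▸ hBfin
  have hshift : ∫ x in B, f (x + h • e) = ∫ x in B', f x := by
    have := hmp'.setIntegral_preimage_emb (measurableEmbedding_addRight (h • e)) f B'
    rw [← this]
    congr 2
    ext x
    simp [hB']
  have hsubB' : B' ⊆ Metric.ball a (R + h) := by
    intro x hx
    have h1 : dist (x - h • e) a < R := hx
    rw [dist_eq_norm] at h1
    rw [Metric.mem_ball, dist_eq_norm]
    have h2 := norm_add_le (x - h • e - a) (h • e)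
    rw [norm_smul, he1, Real.norm_of_nonneg hh0.le, mul_one] at h2
    have h3 : x - h • e - a + h • e = x - a := by abel
    rw [h3] at h2
    linarith
  -- `B` and its translate differ by at most twice the volume of the shell between the radii `R`
  -- and `R + h`, which is of order `h`
  have hdiff1 : volume.real (B' \ B) ≤ V h - V 0 := by
    have h1 : B' \ B ⊆ Metric.ball a (R + h) \ B := sdiff_subset_sdiff_left hsubB'
    have h2 : volume.real (Metric.ball a (R + h) \ B) = V h - V 0 := by
      rw [measureReal_sdiff (show B ⊆ Metric.ball a (R + h) from
        Metric.ball_subset_ball (by linarith)) hBm measure_ball_lt_top.ne, hvol h hh0.le]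
      have := hvol 0 le_rfl
      rw [add_zero] at this
      rw [this]
    rw [← h2]
    exact measureReal_mono h1 (measure_ne_top_of_subset sdiff_subset measure_ball_lt_top.ne)
  have hdiff2 : volume.real (B \ B') = volume.real (B' \ B) := by
    have h1 := measureReal_sdiff_add_inter (μ := volume) (s := B) hB'm hBfin
    have h2 := measureReal_sdiff_add_inter (μ := volume) (s := B') hBm hB'fin
    rw [inter_comm] at h2
    have h3 : volume.real B' = volume.real B := by rw [Measure.real, hB'v, Measure.real]
    linarith
  have hbound : ∀ s : Set (EuclideanSpace ℝ (Fin (n + 1))), volume s ≠ ∞ →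
      ‖∫ x in s, f x‖ ≤ volume.real s := by
    intro s hs
    have := norm_setIntegral_le_of_norm_le_const (f := f) (C := 1) hs.lt_top fun x _ => hf1 x
    rwa [one_mul] at this
  have hX2 : ∫ x in B, (f (x + h • e) - f x) = (∫ x in B' \ B, f x) - ∫ x in B \ B', f x := by
    have hfs : IntegrableOn (fun x => f (x + h • e)) B :=
      Measure.integrableOn_of_bounded hBfin
        (Continuous.aestronglyMeasurable (by fun_prop)) (Eventually.of_forall fun x => hf1 _)
    rw [integral_sub hfs (hint B hBfin), hshift]
    have h1 := integral_inter_add_sdiff hB'm (hint B hBfin)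
    have h2 := integral_inter_add_sdiff hBm (hint B' hB'fin)
    rw [inter_comm] at h2
    linarith
  rw [hX2]
  have h1 := hbound _ (measure_ne_top_of_subset sdiff_subset hB'fin : volume (B' \ B) ≠ ∞)
  have h2 := hbound _ (measure_ne_top_of_subset sdiff_subset hBfin : volume (B \ B') ≠ ∞)
  rw [Real.norm_eq_abs] at h1 h2
  have h3 := le_abs_self (∫ x in B' \ B, f x)
  have h4 := neg_le_abs (∫ x in B \ B', f x)
  have h5 : (∫ x in B' \ B, f x) - ∫ x in B \ B', f x ≤ 2 * (V h - V 0) := by linarith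
  calc h⁻¹ * _ ≤ h⁻¹ * (2 * (V h - V 0)) := by gcongr
    _ = _ := by ring

lemma locallyFinitePerimeter_ball (a : EuclideanSpace ℝ (Fin (n + 1))) {R : ℝ} (hR : 0 < R) :
    LocallyFinitePerimeter (Metric.ball a R) := by
  intro K hK _
  obtain ⟨C, hC⟩ := abs_integral_ball_partial_le a hR
  refine ⟨∑ _i : Fin (n + 1), C, fun X hX hXK hX1 => ?_⟩
  have hXc : HasCompactSupport X := hK.of_isClosed_subset (isClosed_tsupport X) hXK
  simp only [divergence]
  rw [integral_finsetSum]
  · exact Finset.sum_le_sum fun i _ => hC X hX hXc hX1 i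
  · intro i _
    have hc : Continuous fun x => fderiv ℝ X x (EuclideanSpace.single i 1) i := by
      have h1 : Continuous fun x => fderiv ℝ X x (EuclideanSpace.single i 1) :=
        (hX.continuous_fderiv one_ne_zero).clm_apply continuous_const
      exact (by fun_prop : Continuous fun y : EuclideanSpace ℝ (Fin (n + 1)) => y i).comp h1
    exact (hc.locallyIntegrable.integrableOn_isCompact (isCompact_closedBall a R)).mono_set
      Metric.ball_subset_closedBall

end FinitePerimeter

/-! ### Small balls far away: nonexistence of minimizers -/

section Nonexistence

variable {n : ℕ}

open scoped Pointwise in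
/-- The unit sphere is covered by finitely many isometric copies of the open hemisphere, whose area
is computed by the area formula for radial graphs. -/
lemma euclideanHausdorff_sphere_ne_top :
    μHE[n] (Metric.sphere (0 : EuclideanSpace ℝ (Fin (n + 1))) 1) ≠ ∞ := by
  set S : Set (EuclideanSpace ℝ (Fin (n + 1))) := {x | x ∈ halfSpace n ∧ ‖x‖ = 1} with hS
  have hSfin : μHE[n] S ≠ ∞ := by
    have h := lintegral_radial_graph (n := n) 0 0 (W := fun _ => 0) (fun _ _ _ _ => rfl)
      (G := fun _ => 0) (fun x _ => by simpa using hasStrictFDerivAt_const (0 : ℝ) x)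
      measurable_const
    have := isFiniteMeasure_sphereMeasure (n := n) (α := 0) (by norm_num)
    simp only [weight, Real.rpow_zero, mul_one, ENNReal.ofReal_one, Real.exp_zero, mul_zero,
      norm_zero, ne_eq, OfNat.ofNat_ne_zero, not_false_eq_true, zero_pow, add_zero,
      Real.sqrt_one, lintegral_const, Measure.restrict_apply, MeasurableSet.univ, univ_inter,
      one_mul] at h
    rw [hS, h]
    exact measure_ne_top _ _
  let T : Fin (n + 1) → (EuclideanSpace ℝ (Fin (n + 1)) ≃ₗᵢ[ℝ] EuclideanSpace ℝ (Fin (n + 1))) :=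
    fun i => LinearIsometryEquiv.piLpCongrLeft 2 ℝ ℝ (Equiv.swap i (Fin.last n))
  have hT : ∀ i x, (T i x) (Fin.last n) = x i := by
    intro i x
    simp [T, LinearIsometryEquiv.piLpCongrLeft_apply, Equiv.piCongrLeft'_apply]
  have hcov : Metric.sphere (0 : EuclideanSpace ℝ (Fin (n + 1))) 1 ⊆
      ⋃ i, (T i ⁻¹' S ∪ (fun x => T i (-x)) ⁻¹' S) := by
    intro x hx
    have hx1 : ‖x‖ = 1 := by simpa using hx
    have hx0 : x ≠ 0 := by rintro rfl; simp at hx1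
    obtain ⟨i, hi⟩ : ∃ i, x i ≠ 0 := by
      by_contra! hcon
      exact hx0 (by ext i; simpa using hcon i)
    refine mem_iUnion.2 ⟨i, ?_⟩
    rcases lt_or_gt_of_ne hi with h | h
    · refine Or.inr ⟨?_, by simpa using hx1⟩
      change 0 < (T i (-x)) (Fin.last n)
      rw [hT]
      simpa using h
    · refine Or.inl ⟨?_, by simpa using hx1⟩
      change 0 < (T i x) (Fin.last n)
      rwa [hT]
  refine ne_top_of_le_ne_top ?_ (measure_mono hcov)
  refine ((measure_iUnion_le _).trans_lt ?_).ne
  rw [tsum_fintype]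
  refine ENNReal.sum_lt_top.2 fun i _ => (measure_union_le _ _).trans_lt ?_
  have h1 : μHE[n] (T i ⁻¹' S) ≠ ∞ := by
    rw [(T i).isometry.euclideanHausdorffMeasure_preimage]
    exact ne_top_of_le_ne_top hSfin (measure_mono inter_subset_left)
  have h2 : μHE[n] ((fun x => T i (-x)) ⁻¹' S) ≠ ∞ := by
    have hi : Isometry fun x => T i (-x) := (T i).isometry.comp (IsometryEquiv.neg _).isometry
    rw [hi.euclideanHausdorffMeasure_preimage]
    exact ne_top_of_le_ne_top hSfin (measure_mono inter_subset_left)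
  exact ENNReal.add_lt_top.2 ⟨h1.lt_top, h2.lt_top⟩

open scoped Pointwise in
lemma euclideanHausdorff_sphere (a : EuclideanSpace ℝ (Fin (n + 1))) {r : ℝ} (hr : 0 < r) :
    μHE[n] (Metric.sphere a r) =
      ENNReal.ofReal (r ^ n) * μHE[n] (Metric.sphere (0 : EuclideanSpace ℝ (Fin (n + 1))) 1) := by
  have h : Metric.sphere a r =
      a +ᵥ r • Metric.sphere (0 : EuclideanSpace ℝ (Fin (n + 1))) 1 := by
    rw [smul_sphere' hr.ne', Metric.vadd_sphere, smul_zero, vadd_eq_add, add_zero, mul_one,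
      Real.norm_of_nonneg hr.le]
  rw [h, ← image_vadd]
  rw [(isometry_vadd _ a).euclideanHausdorffMeasure_image,
    Measure.euclideanHausdorffMeasure_smul₀ n hr.ne', ENNReal.smul_def, smul_eq_mul]
  congr 1
  rw [ENNReal.ofReal_pow hr.le, ENNReal.coe_pow, ← Real.enorm_eq_ofReal hr.le]
  rfl

lemma weight_smul (s α : ℝ) {c : ℝ} (hc : 0 < c) {x : EuclideanSpace ℝ (Fin (n + 1))}
    (hx : x ∈ halfSpace n) :
    weight s α (c • x) = ENNReal.ofReal (c ^ (s + α)) * weight s α x := by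
  have hx' : 0 < x (Fin.last n) := hx
  rw [weight, weight, ← ENNReal.ofReal_mul (by positivity), norm_smul, Real.norm_of_nonneg hc.le,
    PiLp.smul_apply, smul_eq_mul, Real.mul_rpow hc.le (norm_nonneg _), Real.mul_rpow hc.le hx'.le,
    Real.rpow_add hc]
  congr 1
  ring

open scoped Pointwise in
lemma wMeasure_smul (l α : ℝ) {s : ℝ} (hs : 0 < s) {M : Set (EuclideanSpace ℝ (Fin (n + 1)))}
    (hM : MeasurableSet M) (hMU : M ⊆ halfSpace n) :
    wMeasure l α (s • M) = ENNReal.ofReal (s ^ (l + n + 1 + α)) * wMeasure l α M := by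
  have hsM : MeasurableSet (s • M) := hM.const_smul_of_ne_zero hs.ne'
  rw [wMeasure, wMeasure, ← lintegral_indicator hsM, ← lintegral_indicator hM,
    lintegral_comp_smul ((measurable_weight l α).indicator hsM) hs]
  have h : ∀ z, (s • M).indicator (weight l α) (s • z) =
      ENNReal.ofReal (s ^ (l + α)) * M.indicator (weight l α) z := by
    intro z
    by_cases hz : z ∈ M
    · rw [indicator_of_mem hz, indicator_of_mem (smul_mem_smul_set hz), weight_smul l α hs (hMU hz)]
    · rw [indicator_of_notMem hz, indicator_of_notMem, mul_zero]
      rwa [smul_mem_smul_set_iff₀ hs.ne']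
  simp_rw [h]
  rw [lintegral_const_mul _ ((measurable_weight l α).indicator hM), ← mul_assoc,
    ← ENNReal.ofReal_mul (by positivity)]
  congr 2
  rw [← Real.rpow_natCast, ← Real.rpow_add hs]
  push_cast
  ring_nf

lemma weight_pos (s α : ℝ) {x : EuclideanSpace ℝ (Fin (n + 1))} (hx : x ∈ halfSpace n) :
    0 < ‖x‖ ^ s * x (Fin.last n) ^ α := by
  have hx' : 0 < x (Fin.last n) := hx
  have h0 : 0 < ‖x‖ := norm_pos_iff.2 (by rintro rfl; simp at hx')
  positivity

lemma closedBall_eLast_subset : Metric.closedBall (eLast n) (1 / 2) ⊆ halfSpace n := by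
  intro x hx
  have h := (PiLp.norm_apply_le (x - eLast n) (Fin.last n)).trans (mem_closedBall_iff_norm.1 hx)
  rw [PiLp.sub_apply, eLast_last, Real.norm_eq_abs, abs_le] at h
  change 0 < x (Fin.last n)
  linarith [h.1]

lemma exists_weight_bounds (s α : ℝ) : ∃ c C : ℝ, 0 < c ∧
    ∀ x ∈ Metric.closedBall (eLast n) (1 / 2),
      ENNReal.ofReal c ≤ weight s α x ∧ weight s α x ≤ ENNReal.ofReal C := by
  have hK := isCompact_closedBall (eLast n) (1 / 2)
  have hpos : ∀ x ∈ Metric.closedBall (eLast n) (1 / 2), 0 < ‖x‖ ^ s * x (Fin.last n) ^ α :=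
    fun x hx => weight_pos s α (closedBall_eLast_subset hx)
  have hcont : ContinuousOn (fun x : EuclideanSpace ℝ (Fin (n + 1)) =>
      ‖x‖ ^ s * x (Fin.last n) ^ α) (Metric.closedBall (eLast n) (1 / 2)) := by
    refine ContinuousOn.mul ?_ ?_
    · refine continuous_norm.continuousOn.rpow_const fun x hx => Or.inl ?_
      have hx' : 0 < x (Fin.last n) := closedBall_eLast_subset hx
      exact norm_ne_zero_iff.2 (by rintro rfl; simp at hx')
    · refine ContinuousOn.rpow_const (Continuous.continuousOn (by fun_prop)) fun x hx => Or.inl ?_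
      exact (closedBall_eLast_subset hx : 0 < x (Fin.last n)).ne'
  have hne : (Metric.closedBall (eLast n) (1 / 2)).Nonempty := ⟨eLast n, by simp⟩
  obtain ⟨x0, hx0, hmin⟩ := hK.exists_isMinOn hne hcont
  obtain ⟨x1, hx1, hmax⟩ := hK.exists_isMaxOn hne hcont
  exact ⟨_, _, hpos x0 hx0, fun x hx =>
    ⟨ENNReal.ofReal_le_ofReal (hmin hx), ENNReal.ofReal_le_ofReal (hmax hx)⟩⟩

open scoped Pointwise in
/-- Balls of weighted measure `1` and arbitrarily small perimeter: the ball of radius `s ρ` about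
`s e_N`, with `s` chosen to normalize the measure, has perimeter of order
`ρ ^ (n - (n + 1) κ / λ)`, where `κ` and `λ` are the homogeneity degrees of perimeter and measure. -/
lemma exists_ball_small_perimeter {k l α : ℝ} (hl : 0 < l + n + 1 + α) (hk : 0 < k + n + α)
    (h2 : (n + 1) * (k + n + α) < (l + n + 1 + α) * n) {δ : ℝ≥0∞} (hδ : δ ≠ 0) :
    ∃ (a : EuclideanSpace ℝ (Fin (n + 1))) (r : ℝ), 0 < r ∧ Metric.ball a r ⊆ halfSpace n ∧
      wMeasure l α (Metric.ball a r) = 1 ∧ wPerimeter k α (Metric.ball a r) < δ := by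
  obtain ⟨c, C', hc, hcC⟩ := exists_weight_bounds (n := n) l α
  obtain ⟨c', C, hc', hcC'⟩ := exists_weight_bounds (n := n) k α
  set κ := k + n + α with hκ
  set lam := l + n + 1 + α with hlam
  set ω := (volume (Metric.ball (0 : EuclideanSpace ℝ (Fin (n + 1))) 1)).toReal with hω
  have hωpos : 0 < ω := ENNReal.toReal_pos (Metric.measure_ball_pos _ _ one_pos).ne'
    measure_ball_lt_top.ne
  set S := μHE[n] (Metric.sphere (0 : EuclideanSpace ℝ (Fin (n + 1))) 1) with hS
  have hSfin : S ≠ ∞ := euclideanHausdorff_sphere_ne_top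
  set σ := S.toReal with hσ
  -- the bound for the perimeter below is a constant times this positive power of `ρ`
  have hexp : 0 < n - (n + 1) * κ / lam := by
    rw [sub_pos, div_lt_iff₀ hl]
    linarith
  have hlim : Tendsto (fun ρ : ℝ => (c * ω) ^ (-κ / lam) * (|C| * σ) * ρ ^ (n - (n + 1) * κ / lam))
      (𝓝[>] 0) (𝓝 0) := by
    have h := (Real.continuousAt_rpow_const (0 : ℝ) _ (Or.inr hexp.le)).tendsto
    rw [Real.zero_rpow hexp.ne'] at h
    simpa using (h.mono_left nhdsWithin_le_nhds).const_mul ((c * ω) ^ (-κ / lam) * (|C| * σ))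
  have hlim' := (ENNReal.continuous_ofReal.tendsto _).comp hlim
  rw [ENNReal.ofReal_zero] at hlim'
  have hIoo : ∀ᶠ ρ in 𝓝[>] (0 : ℝ), ρ ∈ Ioo (0 : ℝ) (1 / 2) := Ioo_mem_nhdsGT (by norm_num)
  obtain ⟨ρ, hρδ, hρ0, hρ1⟩ :=
    ((hlim'.eventually (gt_mem_nhds (pos_iff_ne_zero.2 hδ))).and hIoo).exists
  set B := Metric.ball (eLast n) ρ with hB
  have hBsub : B ⊆ Metric.closedBall (eLast n) (1 / 2) :=
    Metric.ball_subset_closedBall.trans (Metric.closedBall_subset_closedBall hρ1.le)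
  have hBU : B ⊆ halfSpace n := hBsub.trans closedBall_eLast_subset
  have hBm : MeasurableSet B := Metric.isOpen_ball.measurableSet
  have hvolB : volume B = ENNReal.ofReal (ρ ^ (n + 1) * ω) := by
    rw [hB, Measure.addHaar_ball volume _ hρ0.le, finrank_euclideanSpace_fin,
      ENNReal.ofReal_mul (by positivity), hω, ENNReal.ofReal_toReal measure_ball_lt_top.ne]
  have hmlow : ENNReal.ofReal (c * ω * ρ ^ (n + 1)) ≤ wMeasure l α B := by
    calc ENNReal.ofReal (c * ω * ρ ^ (n + 1)) = ∫⁻ _ in B, ENNReal.ofReal c := by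
          rw [lintegral_const, Measure.restrict_apply_univ, hvolB, ← ENNReal.ofReal_mul hc.le]
          ring_nf
      _ ≤ _ := setLIntegral_mono (measurable_weight l α) fun x hx => (hcC x (hBsub hx)).1
  have hmtop : wMeasure l α B ≠ ∞ := by
    refine ne_top_of_le_ne_top ?_
      (setLIntegral_mono (μ := volume) measurable_const fun x hx => (hcC x (hBsub hx)).2)
    rw [lintegral_const, Measure.restrict_apply_univ, hvolB]
    exact ENNReal.mul_ne_top ENNReal.ofReal_ne_top ENNReal.ofReal_ne_top
  set m := (wMeasure l α B).toReal with hm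
  have hmlow' : c * ω * ρ ^ (n + 1) ≤ m := (ENNReal.ofReal_le_iff_le_toReal hmtop).1 hmlow
  have hmpos : 0 < m := lt_of_lt_of_le (by positivity) hmlow'
  set s := m ^ (-1 / lam) with hs
  have hspos : 0 < s := Real.rpow_pos_of_pos hmpos _
  have hball : s • B = Metric.ball (s • eLast n) (s * ρ) := by
    rw [hB, smul_ball hspos.ne', Real.norm_of_nonneg hspos.le]
  have hballU : Metric.ball (s • eLast n) (s * ρ) ⊆ halfSpace n := by
    rw [← hball]
    rintro _ ⟨x, hx, rfl⟩
    exact smul_mem_halfSpace (hBU hx) hspos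
  refine ⟨s • eLast n, s * ρ, by positivity, hballU, ?_, ?_⟩
  · rw [← hball, wMeasure_smul l α hspos hBm hBU, ← ENNReal.ofReal_toReal hmtop, ← hm,
      ← ENNReal.ofReal_mul (by positivity), hs, ← Real.rpow_mul hmpos.le]
    rw [div_mul_cancel₀ _ hl.ne', Real.rpow_neg_one, inv_mul_cancel₀ hmpos.ne', ENNReal.ofReal_one]
  · refine lt_of_le_of_lt ?_ hρδ
    rw [wPerimeter, essBoundary_ball _ (by positivity : 0 < s * ρ)]
    have hbd : ∀ x ∈ Metric.sphere (s • eLast n) (s * ρ),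
        weight k α x ≤ ENNReal.ofReal (s ^ (k + α) * |C|) := by
      intro x hx
      have hx' : s⁻¹ • x ∈ Metric.closedBall (eLast n) (1 / 2) := by
        have h : ‖x - s • eLast n‖ = s * ρ := mem_sphere_iff_norm.1 hx
        rw [mem_closedBall_iff_norm]
        have h3 : s⁻¹ • x - eLast n = s⁻¹ • (x - s • eLast n) := by
          rw [smul_sub, inv_smul_smul₀ hspos.ne']
        rw [h3, norm_smul, h, norm_inv, Real.norm_of_nonneg hspos.le, inv_mul_cancel_left₀ hspos.ne']
        exact hρ1.le
      have h4 := weight_smul k α hspos (closedBall_eLast_subset hx')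
      rw [smul_inv_smul₀ hspos.ne'] at h4
      rw [h4, ENNReal.ofReal_mul (by positivity)]
      gcongr
      exact (hcC' _ hx').2.trans (ENNReal.ofReal_le_ofReal (le_abs_self _))
    calc ∫⁻ x in Metric.sphere (s • eLast n) (s * ρ) ∩ halfSpace n, weight k α x ∂(μHE[n])
        ≤ ∫⁻ x in Metric.sphere (s • eLast n) (s * ρ), weight k α x ∂(μHE[n]) :=
          lintegral_mono_set inter_subset_left
      _ ≤ ∫⁻ _ in Metric.sphere (s • eLast n) (s * ρ),
            ENNReal.ofReal (s ^ (k + α) * |C|) ∂(μHE[n]) := setLIntegral_mono measurable_const hbd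
      _ = ENNReal.ofReal (s ^ κ * ρ ^ n * (|C| * σ)) := by
          rw [lintegral_const, Measure.restrict_apply_univ,
            euclideanHausdorff_sphere _ (by positivity : 0 < s * ρ), ← hS,
            ← ENNReal.ofReal_toReal hSfin, ← hσ, ← ENNReal.ofReal_mul (by positivity),
            ← ENNReal.ofReal_mul (by positivity)]
          congr 1
          have : s ^ κ = s ^ (k + α) * s ^ n := by
            rw [← Real.rpow_natCast, ← Real.rpow_add hspos, hκ]
            ring_nf
          rw [this]
          ring
      _ ≤ _ := by
          refine ENNReal.ofReal_le_ofReal ?_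
          -- the lower bound for the measure of the unscaled ball bounds `s` from above
          have hsκ : s ^ κ ≤ (c * ω * ρ ^ (n + 1)) ^ (-κ / lam) := by
            rw [hs, ← Real.rpow_mul hmpos.le]
            have h5 : -1 / lam * κ = -κ / lam := by ring
            rw [h5]
            refine Real.rpow_le_rpow_of_nonpos (by positivity) hmlow' ?_
            rw [neg_div]
            exact (neg_neg_of_pos (div_pos hk hl)).le
          have h6 : (c * ω * ρ ^ (n + 1)) ^ (-κ / lam) * ρ ^ n =
              (c * ω) ^ (-κ / lam) * ρ ^ (n - (n + 1) * κ / lam) := by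
            rw [Real.mul_rpow (by positivity) (by positivity), mul_assoc]
            congr 1
            rw [← Real.rpow_natCast, ← Real.rpow_natCast, ← Real.rpow_mul hρ0.le,
              ← Real.rpow_add hρ0]
            congr 1
            push_cast
            ring
          have hσ0 : 0 ≤ σ := ENNReal.toReal_nonneg
          calc s ^ κ * ρ ^ n * (|C| * σ)
              ≤ (c * ω * ρ ^ (n + 1)) ^ (-κ / lam) * ρ ^ n * (|C| * σ) := by gcongr
            _ = _ := by rw [h6]; ring

open scoped Pointwise in
/-- A minimizer would have perimeter zero, hence would be null or conull in the half-space; but the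
half-space has measure `0` or `∞` by homogeneity. -/
lemma not_exists_isMinimizer {k l α : ℝ} (hl : 0 < l + n + 1 + α) (hk : 0 < k + n + α)
    (h2 : (n + 1) * (k + n + α) < (l + n + 1 + α) * n)
    {A : Set (Set (EuclideanSpace ℝ (Fin (n + 1))))}
    (hA : ∀ M ∈ A, M ⊆ halfSpace n ∧ NullMeasurableSet M)
    (hball : ∀ (a : EuclideanSpace ℝ (Fin (n + 1))) (r : ℝ), 0 < r →
      Metric.ball a r ⊆ halfSpace n → Metric.ball a r ∈ A) :
    ¬ ∃ Ω, IsMinimizer k l α A Ω := by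
  rintro ⟨Ω, hΩA, hΩ1, hmin⟩
  obtain ⟨hΩU, hΩm⟩ := hA Ω hΩA
  have hP : wPerimeter k α Ω = 0 := by
    by_contra hne
    obtain ⟨a, r, hr, hU, h1, hlt⟩ := exists_ball_small_perimeter hl hk h2 hne
    exact absurd (hmin _ (hball a r hr hU) h1) (not_le.2 hlt)
  have hZ : μHE[n] (essBoundary Ω ∩ halfSpace n) = 0 := by
    rw [wPerimeter, lintegral_eq_zero_iff (measurable_weight k α)] at hP
    have hms : MeasurableSet {x : EuclideanSpace ℝ (Fin (n + 1)) | weight k α x = 0} :=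
      measurableSet_eq_fun (measurable_weight k α) measurable_const
    have h := (ae_restrict_iff hms).1 hP
    refine measure_mono_null (fun x hx => ?_) h
    intro hcon
    have h3 : weight k α x = 0 := hcon hx
    rw [weight, ENNReal.ofReal_eq_zero] at h3
    exact absurd (weight_pos k α hx.2) (not_lt.2 h3)
  rcases null_or_conull_of_essBoundary_null hΩm isOpen_halfSpace convex_halfSpace hZ with h | h
  · rw [inter_eq_right.2 hΩU] at h
    rw [wMeasure, setLIntegral_measure_zero _ _ h] at hΩ1
    exact zero_ne_one hΩ1
  · have hU : wMeasure l α (halfSpace n) = 1 := by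
      rw [← hΩ1, wMeasure, wMeasure]
      refine setLIntegral_congr ?_
      exact (ae_eq_set.2 ⟨h, by rw [sdiff_eq_empty.2 hΩU]; exact measure_empty⟩)
    -- dilation by `2` multiplies the measure of the half-space by `2 ^ λ > 1`, so it is not `1`
    have hs : (2 : ℝ) • halfSpace n = halfSpace n := by
      ext x
      rw [mem_smul_set_iff_inv_smul_mem₀ two_ne_zero]
      change 0 < (2 : ℝ)⁻¹ * x (Fin.last n) ↔ 0 < x (Fin.last n)
      simp
    have h3 := wMeasure_smul (n := n) l α two_pos measurableSet_halfSpace subset_rfl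
    rw [hs, hU, mul_one, eq_comm, ENNReal.ofReal_eq_one] at h3
    exact absurd h3 (Real.one_lt_rpow one_lt_two hl).ne'

end Nonexistence

/-! ### The two-point energy: tensorization and one-dimensional spectral gaps -/

section PairEnergy

/-- The energy `∬ (f x - f y)² dμ dμ`, which for finite `μ` is `2 μ(X)²` times the variance of `f`
under the normalized measure. It makes sense for any measurable `f`. -/
noncomputable def pairEnergy {X : Type*} [MeasurableSpace X] (μ : Measure X) (f : X → ℝ) : ℝ≥0∞ :=
  ∫⁻ p, ENNReal.ofReal ((f p.1 - f p.2) ^ 2) ∂(μ.prod μ)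

variable {X Y : Type*} [MeasurableSpace X] [MeasurableSpace Y]

lemma lintegral_prod_prod_comm {μ : Measure X} {ν : Measure Y} [SFinite μ] [SFinite ν]
    {h : (X × Y) × (X × Y) → ℝ≥0∞} (hh : Measurable h) :
    ∫⁻ p, h p ∂((μ.prod ν).prod (μ.prod ν)) =
      ∫⁻ q, h ((q.1.1, q.2.1), (q.1.2, q.2.2)) ∂((μ.prod μ).prod (ν.prod ν)) := by
  have hm : Measurable fun q : (X × X) × (Y × Y) => h ((q.1.1, q.2.1), (q.1.2, q.2.2)) :=
    hh.comp (by fun_prop)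
  rw [lintegral_prod _ hh.aemeasurable, lintegral_prod _ hm.aemeasurable,
    lintegral_prod _ (Measurable.lintegral_prod_right' hh).aemeasurable,
    lintegral_prod _ (Measurable.lintegral_prod_right' hm).aemeasurable]
  refine lintegral_congr fun x => ?_
  have h1 : ∀ y, ∫⁻ p, h ((x, y), p) ∂(μ.prod ν) = ∫⁻ x', ∫⁻ y', h ((x, y), (x', y')) ∂ν ∂μ :=
    fun y => lintegral_prod _ (hh.comp (by fun_prop)).aemeasurable
  have h2 : ∀ x', ∫⁻ p : Y × Y, h ((x, p.1), (x', p.2)) ∂(ν.prod ν) =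
      ∫⁻ y, ∫⁻ y', h ((x, y), (x', y')) ∂ν ∂ν :=
    fun x' => lintegral_prod _ (hh.comp (by fun_prop)).aemeasurable
  simp_rw [h1, h2]
  refine lintegral_lintegral_swap (Measurable.aemeasurable ?_)
  have h3 : Measurable fun r : (Y × X) × Y => h ((x, r.1.1), (r.1.2, r.2)) :=
    hh.comp (by fun_prop)
  exact Measurable.lintegral_prod_right' h3

/-- The Efron–Stein inequality for two factors. It is the integrated form of the quadrilateral
inequality `(a - d)² + (b - c)² ≤ (a - b)² + (c - d)² + (a - c)² + (b - d)²` for the four values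
at the vertices of a rectangle. -/
lemma pairEnergy_prod_le {μ : Measure X} {ν : Measure Y} [SFinite μ] [SFinite ν]
    {f : X × Y → ℝ} (hf : Measurable f) :
    pairEnergy (μ.prod ν) f ≤ ν univ * ∫⁻ y, pairEnergy μ (fun x => f (x, y)) ∂ν +
      μ univ * ∫⁻ x, pairEnergy ν (fun y => f (x, y)) ∂μ := by
  set Q := (μ.prod μ).prod (ν.prod ν) with hQ
  let A : (X × X) × (Y × Y) → ℝ := fun q => f (q.1.1, q.2.1)
  let B : (X × X) × (Y × Y) → ℝ := fun q => f (q.1.2, q.2.1)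
  let C : (X × X) × (Y × Y) → ℝ := fun q => f (q.1.1, q.2.2)
  let D : (X × X) × (Y × Y) → ℝ := fun q => f (q.1.2, q.2.2)
  have hA : Measurable A := hf.comp (by fun_prop)
  have hB : Measurable B := hf.comp (by fun_prop)
  have hC : Measurable C := hf.comp (by fun_prop)
  have hD : Measurable D := hf.comp (by fun_prop)
  let E : ((X × X) × (Y × Y) → ℝ) → ((X × X) × (Y × Y) → ℝ) → ℝ≥0∞ := fun u v =>
    ∫⁻ q, ENNReal.ofReal ((u q - v q) ^ 2) ∂Q
  have hmeas : ∀ {u v : (X × X) × (Y × Y) → ℝ}, Measurable u → Measurable v →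
      Measurable fun q => ENNReal.ofReal ((u q - v q) ^ 2) := by
    intro u v hu hv
    exact ((hu.sub hv).pow_const 2).ennreal_ofReal
  have hsw1 : MeasurePreserving (Prod.map (Prod.swap : X × X → X × X) (id : Y × Y → Y × Y)) Q Q :=
    Measure.measurePreserving_swap.prod (MeasurePreserving.id _)
  have hsw2 : MeasurePreserving (Prod.map (id : X × X → X × X) (Prod.swap : Y × Y → Y × Y)) Q Q :=
    (MeasurePreserving.id _).prod Measure.measurePreserving_swap
  have e1 : pairEnergy (μ.prod ν) f = E A D := by
    refine lintegral_prod_prod_comm (h := fun p => ENNReal.ofReal ((f p.1 - f p.2) ^ 2)) ?_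
    exact (((hf.comp measurable_fst).sub (hf.comp measurable_snd)).pow_const 2).ennreal_ofReal
  have e2 : E B C = E A D := by
    exact (hsw1.lintegral_comp (hmeas hB hC)).symm
  have e3 : E C D = E A B := by
    exact (hsw2.lintegral_comp (hmeas hC hD)).symm
  have e4 : E B D = E A C := by
    exact (hsw1.lintegral_comp (hmeas hB hD)).symm
  have e5 : E A B = ν univ * ∫⁻ y, pairEnergy μ (fun x => f (x, y)) ∂ν := by
    have h0 : E A B = ∫⁻ r : Y × Y, pairEnergy μ (fun x => f (x, r.1)) ∂(ν.prod ν) :=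
      lintegral_prod_symm _ (hmeas hA hB).aemeasurable
    have hm : Measurable fun r : Y × Y => pairEnergy μ (fun x => f (x, r.1)) :=
      Measurable.lintegral_prod_left' (hmeas hA hB)
    rw [h0, lintegral_prod _ hm.aemeasurable]
    simp only [lintegral_const]
    rw [lintegral_mul_const, mul_comm]
    exact hm.comp (measurable_id.prodMk measurable_id)
  have e6 : E A C = μ univ * ∫⁻ x, pairEnergy ν (fun y => f (x, y)) ∂μ := by
    have h0 : E A C = ∫⁻ r : X × X, pairEnergy ν (fun y => f (r.1, y)) ∂(μ.prod μ) :=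
      lintegral_prod _ (hmeas hA hC).aemeasurable
    have hm : Measurable fun r : X × X => pairEnergy ν (fun y => f (r.1, y)) :=
      Measurable.lintegral_prod_right' (hmeas hA hC)
    rw [h0, lintegral_prod _ hm.aemeasurable]
    simp only [lintegral_const]
    rw [lintegral_mul_const, mul_comm]
    exact hm.comp (measurable_id.prodMk measurable_id)
  have hsum : E A D + E B C ≤ (E A B + E C D) + (E A C + E B D) := by
    have hABCD : Measurable fun q =>
        ENNReal.ofReal ((A q - B q) ^ 2) + ENNReal.ofReal ((C q - D q) ^ 2) :=
      (hmeas hA hB).add (hmeas hC hD)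
    simp only [E]
    rw [← lintegral_add_left (hmeas hA hD), ← lintegral_add_left (hmeas hA hB),
      ← lintegral_add_left (hmeas hA hC),
      ← lintegral_add_left hABCD]
    refine lintegral_mono fun q => ?_
    rw [← ENNReal.ofReal_add (by positivity) (by positivity),
      ← ENNReal.ofReal_add (by positivity) (by positivity),
      ← ENNReal.ofReal_add (by positivity) (by positivity),
      ← ENNReal.ofReal_add (by positivity) (by positivity)]
    refine ENNReal.ofReal_le_ofReal ?_
    nlinarith [sq_nonneg (A q - B q - C q + D q)]
  rw [e1, ← e5, ← e6]
  rw [e2, e3, e4, ← two_mul, ← two_mul, ← two_mul, ← mul_add] at hsum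
  exact (ENNReal.mul_le_mul_iff_right two_ne_zero ENNReal.ofNat_ne_top).1 hsum

/-- Cauchy–Schwarz on an interval, in the form of Young's inequality with the optimal constant. -/
lemma ofReal_sq_sub_le {I : Set ℝ} (hI : IsOpen I) (hIc : I.OrdConnected) {g G : ℝ → ℝ}
    (hg : ContDiffOn ℝ 1 g I) (hG : ContDiffOn ℝ 1 G I) (hpos : ∀ t ∈ I, 0 < deriv G t)
    {x y : ℝ} (hx : x ∈ I) (hy : y ∈ I) (hxy : x < y) :
    G x < G y ∧ ENNReal.ofReal ((g x - g y) ^ 2) ≤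
      ∫⁻ t in Ioo x y, ENNReal.ofReal (deriv g t ^ 2 / deriv G t) * ENNReal.ofReal (G y - G x) := by
  have hsub : Icc x y ⊆ I := hIc.out hx hy
  have hder : ∀ {u : ℝ → ℝ}, ContDiffOn ℝ 1 u I → ∀ t ∈ I, HasDerivAt u (deriv u t) t :=
    fun hu t ht => ((hu.differentiableOn one_ne_zero).differentiableAt (hI.mem_nhds ht)).hasDerivAt
  have hcont : ∀ {u : ℝ → ℝ}, ContDiffOn ℝ 1 u I → ContinuousOn (deriv u) I :=
    fun hu => hu.continuousOn_deriv_of_isOpen hI le_rfl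
  have hint : ∀ {u : ℝ → ℝ}, ContDiffOn ℝ 1 u I → IntervalIntegrable (deriv u) volume x y :=
    fun hu => ((hcont hu).mono (by rwa [uIcc_of_le hxy.le])).intervalIntegrable
  have hftc : ∀ {u : ℝ → ℝ}, ContDiffOn ℝ 1 u I → ∫ t in x..y, deriv u t = u y - u x :=
    fun hu => intervalIntegral.integral_eq_sub_of_hasDerivAt
      (fun t ht => hder hu t (hsub (by rwa [uIcc_of_le hxy.le] at ht))) (hint hu)
  have hGlt : G x < G y := by
    refine strictMonoOn_of_deriv_pos (convex_Icc x y) (hG.continuousOn.mono hsub) ?_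
      (left_mem_Icc.2 hxy.le) (right_mem_Icc.2 hxy.le) hxy
    intro t ht
    exact hpos t (hsub (interior_subset ht))
  refine ⟨hGlt, ?_⟩
  set Δ := G y - G x with hΔ
  have hΔ0 : 0 < Δ := sub_pos.2 hGlt
  set c := (g y - g x) / Δ with hc
  have h1 : ∫ t in x..y, (2 * c * deriv g t - c ^ 2 * deriv G t) = (g y - g x) ^ 2 / Δ := by
    rw [intervalIntegral.integral_sub ((hint hg).const_mul _) ((hint hG).const_mul _),
      intervalIntegral.integral_const_mul, intervalIntegral.integral_const_mul, hftc hg, hftc hG,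
      ← hΔ, hc]
    field_simp
    ring
  have h2 : ENNReal.ofReal ((g y - g x) ^ 2 / Δ) ≤
      ∫⁻ t in Ioo x y, ENNReal.ofReal (deriv g t ^ 2 / deriv G t) := by
    have hi : IntegrableOn (fun t => 2 * c * deriv g t - c ^ 2 * deriv G t) (Ioo x y) :=
      ((intervalIntegrable_iff_integrableOn_Ioc_of_le hxy.le).1
        (((hint hg).const_mul (2 * c)).sub ((hint hG).const_mul (c ^ 2)))).mono_set Ioo_subset_Ioc_self
    rw [← h1, intervalIntegral.integral_of_le hxy.le, integral_Ioc_eq_integral_Ioo,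
      integral_eq_lintegral_pos_part_sub_lintegral_neg_part hi]
    refine (ENNReal.ofReal_le_of_le_toReal (sub_le_self _ ENNReal.toReal_nonneg)).trans ?_
    refine setLIntegral_mono' measurableSet_Ioo fun t ht => ENNReal.ofReal_le_ofReal ?_
    have hp := hpos t (hsub (Ioo_subset_Icc_self ht))
    rw [le_div_iff₀ hp]
    nlinarith [sq_nonneg (deriv g t - c * deriv G t)]
  calc ENNReal.ofReal ((g x - g y) ^ 2) = ENNReal.ofReal ((g y - g x) ^ 2 / Δ) * ENNReal.ofReal Δ := by
        rw [← ENNReal.ofReal_mul (by positivity)]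
        congr 1
        field_simp
        ring
    _ ≤ (∫⁻ t in Ioo x y, ENNReal.ofReal (deriv g t ^ 2 / deriv G t)) * ENNReal.ofReal Δ := by gcongr
    _ = _ := by
        rw [lintegral_mul_const]
        exact (((measurable_deriv g).pow_const 2).div (measurable_deriv G)).ennreal_ofReal

/-- A one-dimensional spectral gap. For `m = w dx` on an interval `I` and an increasing function `G`
of mean zero, the gap is at least `1` as soon as the tail integrals of `G` satisfy
`∫_t^∞ G dm ≤ G'(t) w(t)`. The energy is bounded with Cauchy–Schwarz in the form
`(g y - g x)² ≤ (G y - G x) ∫_x^y g'² / G'`, and the order of integration is exchanged. -/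
lemma pairEnergy_le_of_tail {I : Set ℝ} (hI : IsOpen I) (hIc : I.OrdConnected) {w G : ℝ → ℝ}
    (hw : Measurable w) (hG : ContDiffOn ℝ 1 G I) (hGm : Measurable G)
    (hpos : ∀ t ∈ I, 0 < deriv G t) {m : Measure ℝ} [IsFiniteMeasure m]
    (hm : m = (volume.restrict I).withDensity fun t => ENNReal.ofReal (w t))
    (hint : Integrable G m) (hzero : ∫ t, G t ∂m = 0)
    (htail : ∀ t ∈ I, ∫ y in Ioi t, G y ∂m ≤ deriv G t * w t)
    {g : ℝ → ℝ} (hg : ContDiffOn ℝ 1 g I) :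
    pairEnergy m g ≤ 2 * m univ * ∫⁻ t, ENNReal.ofReal (deriv g t ^ 2) ∂m := by
  have hmI : ∀ᵐ t ∂m, t ∈ I := by
    rw [hm]
    exact (withDensity_absolutelyContinuous _ _).ae_le (ae_restrict_mem hI.measurableSet)
  have hGmono : ∀ x ∈ I, ∀ y ∈ I, x ≤ y → G x ≤ G y := by
    intro x hx y hy hxy
    rcases hxy.eq_or_lt with rfl | hxy
    · exact le_rfl
    · exact (ofReal_sq_sub_le hI hIc hg hG hpos hx hy hxy).1.le
  set φ : ℝ → ℝ≥0∞ := fun t => ENNReal.ofReal (deriv g t ^ 2 / deriv G t) with hφ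
  have hφm : Measurable φ :=
    (((measurable_deriv g).pow_const 2).div (measurable_deriv G)).ennreal_ofReal
  set k : (ℝ × ℝ) × ℝ → ℝ≥0∞ := {r | r.1.1 ≤ r.2 ∧ r.2 < r.1.2}.indicator
    fun r => ENNReal.ofReal (G r.1.2 - G r.1.1) with hk
  have hkset : MeasurableSet {r : (ℝ × ℝ) × ℝ | r.1.1 ≤ r.2 ∧ r.2 < r.1.2} :=
    MeasurableSet.inter
      (measurableSet_le (measurable_fst.comp measurable_fst) measurable_snd)
      (measurableSet_lt measurable_snd (measurable_snd.comp measurable_fst))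
  have hkm : Measurable k := by
    refine Measurable.indicator ?_ hkset
    exact ((hGm.comp (by fun_prop)).sub (hGm.comp (by fun_prop))).ennreal_ofReal
  have hlt : ∀ x ∈ I, ∀ y ∈ I, x < y → ENNReal.ofReal ((g x - g y) ^ 2) ≤
      ∫⁻ t in I, φ t * k ((x, y), t) := by
    intro x hx y hy hxy
    refine (ofReal_sq_sub_le hI hIc hg hG hpos hx hy hxy).2.trans ?_
    have hsub : Ioo x y ⊆ I := Ioo_subset_Icc_self.trans (hIc.out hx hy)
    refine le_trans (le_of_eq ?_) (lintegral_mono_set hsub)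
    refine setLIntegral_congr_fun measurableSet_Ioo fun t ht => ?_
    have : ((x, y), t) ∈ {r : (ℝ × ℝ) × ℝ | r.1.1 ≤ r.2 ∧ r.2 < r.1.2} := ⟨ht.1.le, ht.2⟩
    simp only [hk, indicator_of_mem this, hφ]
  have hptw : ∀ x ∈ I, ∀ y ∈ I, ENNReal.ofReal ((g x - g y) ^ 2) ≤
      (∫⁻ t in I, φ t * k ((x, y), t)) + ∫⁻ t in I, φ t * k ((y, x), t) := by
    intro x hx y hy
    rcases lt_trichotomy x y with h | h | h
    · exact (hlt x hx y hy h).trans le_self_add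
    · simp [h]
    · rw [← neg_sub, neg_sq]
      exact (hlt y hy x hx h).trans le_add_self
  -- the kernel obtained by integrating out the two end points
  have hK : ∀ t ∈ I, ∫⁻ p, k (p, t) ∂(m.prod m) ≤
      m univ * ENNReal.ofReal (deriv G t * w t) := by
    intro t ht
    have hIic : ∀ᵐ x ∂m.restrict (Iic t), 0 ≤ G t - G x := by
      filter_upwards [ae_restrict_mem measurableSet_Iic, ae_restrict_of_ae hmI] with x hx hxI
      exact sub_nonneg.2 (hGmono x hxI t ht hx)
    have hIoi : ∀ᵐ y ∂m.restrict (Ioi t), 0 ≤ G y - G t := by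
      filter_upwards [ae_restrict_mem measurableSet_Ioi, ae_restrict_of_ae hmI] with y hy hyI
      exact sub_nonneg.2 (hGmono t ht y hyI (le_of_lt hy))
    have h1 : ∫⁻ x in Iic t, ENNReal.ofReal (G t - G x) ∂m =
        ENNReal.ofReal (∫ x in Iic t, (G t - G x) ∂m) :=
      (ofReal_integral_eq_lintegral_ofReal ((integrable_const _).sub hint.integrableOn) hIic).symm
    have h2 : ∫⁻ y in Ioi t, ENNReal.ofReal (G y - G t) ∂m =
        ENNReal.ofReal (∫ y in Ioi t, (G y - G t) ∂m) :=
      (ofReal_integral_eq_lintegral_ofReal (hint.integrableOn.sub (integrable_const _)) hIoi).symm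
    -- with `a`, `c` the masses on the two sides of `t` and `b` the tail of `G`, the kernel is
    -- `a (b - c G t) + c (a G t + b) = (a + c) b`, since `G` has mean zero
    set a := m.real (Iic t) with ha
    set c := m.real (Ioi t) with hc
    set b := ∫ y in Ioi t, G y ∂m with hb
    have hsplit : (∫ x in Iic t, G x ∂m) + b = 0 := by
      rw [← hzero, ← setIntegral_union (Iic_disjoint_Ioi le_rfl) measurableSet_Ioi
        hint.integrableOn hint.integrableOn, Iic_union_Ioi, setIntegral_univ]
    have h3 : ∫ x in Iic t, (G t - G x) ∂m = a * G t + b := by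
      rw [integral_sub (integrable_const _) hint.integrableOn, setIntegral_const, smul_eq_mul]
      linarith
    have h4 : ∫ y in Ioi t, (G y - G t) ∂m = b - c * G t := by
      rw [integral_sub hint.integrableOn (integrable_const _), setIntegral_const, smul_eq_mul]
    have h3' : 0 ≤ a * G t + b := h3 ▸ integral_nonneg_of_ae hIic
    have h4' : 0 ≤ b - c * G t := h4 ▸ integral_nonneg_of_ae hIoi
    have hma : m (Iic t) = ENNReal.ofReal a := (ofReal_measureReal (measure_ne_top _ _)).symm
    have hmc : m (Ioi t) = ENNReal.ofReal c := (ofReal_measureReal (measure_ne_top _ _)).symm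
    have hac : m univ = ENNReal.ofReal (a + c) := by
      rw [ENNReal.ofReal_add measureReal_nonneg measureReal_nonneg, ← hma, ← hmc,
        ← measure_union (Iic_disjoint_Ioi le_rfl) measurableSet_Ioi, Iic_union_Ioi]
    calc ∫⁻ p, k (p, t) ∂(m.prod m)
        ≤ ∫⁻ p in Iic t ×ˢ Ioi t,
            (ENNReal.ofReal (G p.2 - G t) + ENNReal.ofReal (G t - G p.1)) ∂(m.prod m) := by
          rw [← lintegral_indicator (measurableSet_Iic.prod measurableSet_Ioi)]
          refine lintegral_mono fun p => ?_
          by_cases hp : p ∈ Iic t ×ˢ Ioi t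
          · have : (p, t) ∈ {r : (ℝ × ℝ) × ℝ | r.1.1 ≤ r.2 ∧ r.2 < r.1.2} := ⟨hp.1, hp.2⟩
            rw [indicator_of_mem hp, hk, indicator_of_mem this]
            refine le_trans (le_of_eq ?_) ENNReal.ofReal_add_le
            congr 1
            ring
          · have : (p, t) ∉ {r : (ℝ × ℝ) × ℝ | r.1.1 ≤ r.2 ∧ r.2 < r.1.2} :=
              fun h => hp ⟨h.1, h.2⟩
            rw [hk, indicator_of_notMem this]
            exact zero_le
      _ = ENNReal.ofReal a * ENNReal.ofReal (b - c * G t) +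
            ENNReal.ofReal c * ENNReal.ofReal (a * G t + b) := by
          have hm1 : Measurable fun p : ℝ × ℝ => ENNReal.ofReal (G p.2 - G t) :=
            ((hGm.comp measurable_snd).sub_const _).ennreal_ofReal
          have hm2 : Measurable fun p : ℝ × ℝ => ENNReal.ofReal (G t - G p.1) :=
            ((hGm.comp measurable_fst).const_sub _).ennreal_ofReal
          rw [← Measure.prod_restrict, lintegral_add_left hm1,
            lintegral_prod _ hm1.aemeasurable, lintegral_prod _ hm2.aemeasurable]
          simp only [lintegral_const, Measure.restrict_apply_univ]
          rw [lintegral_mul_const _ (hGm.const_sub _).ennreal_ofReal, h1, h2, h3, h4, hma, hmc]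
          ring
      _ = m univ * ENNReal.ofReal b := by
          have ha0 : 0 ≤ a := measureReal_nonneg
          have hc0 : 0 ≤ c := measureReal_nonneg
          rw [hac, ← ENNReal.ofReal_mul ha0, ← ENNReal.ofReal_mul hc0,
            ← ENNReal.ofReal_add (by positivity) (by positivity), ← ENNReal.ofReal_mul (by positivity)]
          congr 1
          ring
      _ ≤ _ := by
          gcongr
          exact htail t ht
  have hmeas1 : Measurable fun r : (ℝ × ℝ) × ℝ => φ r.2 * k r := (hφm.comp measurable_snd).mul hkm
  have hsw : ∫⁻ p : ℝ × ℝ, (∫⁻ t in I, φ t * k ((p.2, p.1), t)) ∂(m.prod m) =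
      ∫⁻ p : ℝ × ℝ, (∫⁻ t in I, φ t * k (p, t)) ∂(m.prod m) :=
    Measure.measurePreserving_swap.lintegral_comp
      (f := fun p : ℝ × ℝ => ∫⁻ t in I, φ t * k (p, t)) (Measurable.lintegral_prod_right' hmeas1)
  have hae : ∀ᵐ p ∂(m.prod m), p.1 ∈ I ∧ p.2 ∈ I :=
    (Measure.quasiMeasurePreserving_fst.ae hmI).and (Measure.quasiMeasurePreserving_snd.ae hmI)
  calc pairEnergy m g
      ≤ ∫⁻ p : ℝ × ℝ, ((∫⁻ t in I, φ t * k (p, t)) + ∫⁻ t in I, φ t * k ((p.2, p.1), t))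
          ∂(m.prod m) := by
        refine lintegral_mono_ae ?_
        filter_upwards [hae] with p hp
        exact hptw _ hp.1 _ hp.2
    _ = 2 * ∫⁻ p : ℝ × ℝ, (∫⁻ t in I, φ t * k (p, t)) ∂(m.prod m) := by
        rw [lintegral_add_left (Measurable.lintegral_prod_right' hmeas1), hsw, two_mul]
    _ = 2 * ∫⁻ t in I, φ t * ∫⁻ p, k (p, t) ∂(m.prod m) := by
        rw [lintegral_lintegral_swap hmeas1.aemeasurable]
        congr 1
        refine lintegral_congr fun t => ?_
        rw [lintegral_const_mul]
        exact hkm.comp (by fun_prop)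
    _ ≤ 2 * ∫⁻ t in I, m univ * (ENNReal.ofReal (w t) * ENNReal.ofReal (deriv g t ^ 2)) := by
        gcongr 2 * ?_
        refine setLIntegral_mono' hI.measurableSet fun t ht => ?_
        calc φ t * ∫⁻ p, k (p, t) ∂(m.prod m)
            ≤ φ t * (m univ * ENNReal.ofReal (deriv G t * w t)) := by
              gcongr
              exact hK t ht
          _ = m univ * (φ t * (ENNReal.ofReal (deriv G t) * ENNReal.ofReal (w t))) := by
              rw [ENNReal.ofReal_mul (hpos t ht).le]
              ring
          _ = m univ * (ENNReal.ofReal (w t) * (φ t * ENNReal.ofReal (deriv G t))) := by ring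
          _ = _ := by
              rw [hφ, ← ENNReal.ofReal_mul (div_nonneg (sq_nonneg _) (hpos t ht).le),
                div_mul_cancel₀ _ (hpos t ht).ne']
    _ = _ := by
        have hm3 : Measurable fun t => ENNReal.ofReal (deriv g t ^ 2) :=
          ((measurable_deriv g).pow_const 2).ennreal_ofReal
        have h5 : ∫⁻ t, ENNReal.ofReal (deriv g t ^ 2) ∂m =
            ∫⁻ t in I, ENNReal.ofReal (w t) * ENNReal.ofReal (deriv g t ^ 2) := by
          rw [hm, lintegral_withDensity_eq_lintegral_mul _ hw.ennreal_ofReal hm3]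
          rfl
        have hm4 : Measurable fun t => ENNReal.ofReal (w t) * ENNReal.ofReal (deriv g t ^ 2) :=
          hw.ennreal_ofReal.mul hm3
        rw [lintegral_const_mul _ hm4, h5]
        ring

end PairEnergy

/-! ### Spectral gap of the weighted Gaussian measure on the half-space -/

section GaussianGap

lemma integrable_withDensity_restrict_iff {I s : Set ℝ} (hI : MeasurableSet I)
    (hs : MeasurableSet s) {w G : ℝ → ℝ} (hw : Measurable w) (hw0 : ∀ t ∈ I, 0 ≤ w t) :
    (IntegrableOn G s ((volume.restrict I).withDensity fun t => ENNReal.ofReal (w t)) ↔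
      IntegrableOn (fun t => w t * G t) (s ∩ I)) ∧
    ∫ t in s, G t ∂((volume.restrict I).withDensity fun t => ENNReal.ofReal (w t)) =
      ∫ t in s ∩ I, w t * G t := by
  have hae : ∀ᵐ t ∂(volume.restrict (s ∩ I)), ENNReal.ofReal (w t) < ∞ :=
    Eventually.of_forall fun _ => ENNReal.ofReal_lt_top
  have heq : (fun t => (ENNReal.ofReal (w t)).toReal • G t) =ᵐ[volume.restrict (s ∩ I)]
      fun t => w t * G t := by
    filter_upwards [ae_restrict_mem (hs.inter hI)] with t ht
    rw [ENNReal.toReal_ofReal (hw0 t ht.2), smul_eq_mul]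
  rw [IntegrableOn, restrict_withDensity hs, Measure.restrict_restrict hs]
  refine ⟨?_, ?_⟩
  · rw [integrable_withDensity_iff_integrable_smul' hw.ennreal_ofReal hae]
    exact integrable_congr heq
  · rw [integral_withDensity_eq_integral_toReal_smul hw.ennreal_ofReal hae]
    exact integral_congr_ae heq

/-- The weighted half-line measure `t^α e^{-t²/2} dt`. -/
noncomputable def halfLineGauss (α : ℝ) : Measure ℝ :=
  (volume.restrict (Ioi 0)).withDensity fun t => ENNReal.ofReal (t ^ α * Real.exp (-t ^ 2 / 2))

/-- The (unnormalized) Gaussian measure on the line. -/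
noncomputable def lineGauss : Measure ℝ :=
  (volume.restrict univ).withDensity fun t => ENNReal.ofReal (Real.exp (-t ^ 2 / 2))

lemma tendsto_exp_neg_sq_div_two_atTop : Tendsto (fun t : ℝ => Real.exp (-t ^ 2 / 2)) atTop (𝓝 0) := by
  refine Real.tendsto_exp_atBot.comp ?_
  have h : Tendsto (fun t : ℝ => t ^ 2 / 2) atTop atTop :=
    (tendsto_pow_atTop two_ne_zero).atTop_div_const two_pos
  refine (tendsto_neg_atTop_atBot.comp h).congr fun t => ?_
  simp only [Function.comp]
  ring

lemma integrable_rpow_mul_exp {s : ℝ} (hs : -1 < s) :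
    IntegrableOn (fun t : ℝ => t ^ s * Real.exp (-t ^ 2 / 2)) (Ioi 0) := by
  refine (integrableOn_rpow_mul_exp_neg_mul_sq (b := 1 / 2) (by norm_num) hs).congr_fun
    (fun t _ => ?_) measurableSet_Ioi
  ring_nf

lemma lineGauss_gap {g : ℝ → ℝ} (hg : ContDiff ℝ 1 g) :
    pairEnergy lineGauss g ≤
      2 * lineGauss univ * ∫⁻ t, ENNReal.ofReal (deriv g t ^ 2) ∂lineGauss := by
  have hw : Measurable fun t : ℝ => Real.exp (-t ^ 2 / 2) := by fun_prop
  have hexp : Integrable fun t : ℝ => Real.exp (-t ^ 2 / 2) := by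
    refine (integrable_exp_neg_mul_sq (b := 1 / 2) (by norm_num)).congr (Eventually.of_forall fun t => ?_)
    simp only
    ring_nf
  have hG : Integrable fun t : ℝ => Real.exp (-t ^ 2 / 2) * t := by
    refine (integrable_mul_exp_neg_mul_sq (b := 1 / 2) (by norm_num)).congr (Eventually.of_forall fun t => ?_)
    simp only
    ring_nf
  have hfin : IsFiniteMeasure lineGauss := by
    rw [lineGauss, Measure.restrict_univ]
    exact isFiniteMeasure_withDensity_ofReal hexp.2
  have hder : ∀ t : ℝ, HasDerivAt (fun t => -Real.exp (-t ^ 2 / 2)) (Real.exp (-t ^ 2 / 2) * t) t := by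
    intro t
    have h := ((((hasDerivAt_id t).pow 2).neg.div_const 2).exp).neg
    convert! h using 1
    simp
    ring
  have htop : Tendsto (fun t : ℝ => -Real.exp (-t ^ 2 / 2)) atTop (𝓝 0) := by
    simpa using tendsto_exp_neg_sq_div_two_atTop.neg
  have hbot : Tendsto (fun t : ℝ => -Real.exp (-t ^ 2 / 2)) atBot (𝓝 0) := by
    refine (htop.comp tendsto_neg_atBot_atTop).congr fun t => ?_
    simp
  have hI := fun (s : Set ℝ) (hs : MeasurableSet s) =>
    integrable_withDensity_restrict_iff (G := fun t => t) MeasurableSet.univ hs hw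
      (fun t _ => (Real.exp_pos _).le)
  refine pairEnergy_le_of_tail (m := lineGauss) (G := fun t => t) isOpen_univ ordConnected_univ hw
    contDiff_id.contDiffOn measurable_id ?_ rfl ?_ ?_ ?_ hg.contDiffOn
  · intro t _
    simp
  · rw [← integrableOn_univ]
    exact (hI univ MeasurableSet.univ).1.2 hG.integrableOn
  · rw [← setIntegral_univ]
    refine (hI univ MeasurableSet.univ).2.trans ?_
    rw [univ_inter, setIntegral_univ, integral_of_hasDerivAt_of_tendsto hder hG hbot htop, sub_zero]
  · intro t _
    refine le_of_eq ((hI (Ioi t) measurableSet_Ioi).2.trans ?_)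
    rw [inter_univ, integral_Ioi_of_hasDerivAt_of_tendsto' (fun x _ => hder x) hG.integrableOn htop]
    simp

lemma isFiniteMeasure_halfLineGauss {α : ℝ} (hα : -1 < α) : IsFiniteMeasure (halfLineGauss α) :=
  isFiniteMeasure_withDensity_ofReal (integrable_rpow_mul_exp hα).2

/-- For `t^α e^{-t²/2}` the function `G(t) = (t² - (α + 1)) / 2` has mean zero, and
`½ t^{α+1} e^{-t²/2}` as its tail integral. -/
lemma halfLineGauss_gap {α : ℝ} (hα : -1 < α) {g : ℝ → ℝ} (hg : ContDiffOn ℝ 1 g (Ioi 0)) :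
    pairEnergy (halfLineGauss α) g ≤ 2 * halfLineGauss α univ *
      ∫⁻ t, ENNReal.ofReal (deriv g t ^ 2) ∂(halfLineGauss α) := by
  have hfin := isFiniteMeasure_halfLineGauss hα
  have hw : Measurable fun t : ℝ => t ^ α * Real.exp (-t ^ 2 / 2) := by fun_prop
  have hw0 : ∀ t ∈ Ioi (0 : ℝ), 0 ≤ t ^ α * Real.exp (-t ^ 2 / 2) := by
    intro t ht
    have : (0 : ℝ) < t := ht
    positivity
  set G : ℝ → ℝ := fun t => (t ^ 2 - (α + 1)) / 2 with hGdef
  have hGd : ∀ t, HasDerivAt G t t := by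
    intro t
    have h := (((hasDerivAt_id t).pow 2).sub_const (α + 1)).div_const 2
    convert! h using 1
    simp
  have hint : IntegrableOn (fun t : ℝ => t ^ α * Real.exp (-t ^ 2 / 2) * G t) (Ioi 0) := by
    have h1 := (integrable_rpow_mul_exp (s := α + 2) (by linarith)).const_mul (1 / 2)
    have h2 := (integrable_rpow_mul_exp hα).const_mul ((α + 1) / 2)
    refine IntegrableOn.congr_fun (h1.sub h2) (fun t ht => ?_) measurableSet_Ioi
    have ht0 : (0 : ℝ) < t := ht
    simp only [Pi.sub_apply, hGdef]
    rw [Real.rpow_add ht0, Real.rpow_two]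
    ring
  have hder : ∀ t ∈ Ioi (0 : ℝ), HasDerivAt (fun t : ℝ => -(t ^ (α + 1) * Real.exp (-t ^ 2 / 2) / 2))
      (t ^ α * Real.exp (-t ^ 2 / 2) * G t) t := by
    intro t ht
    have ht0 : (0 : ℝ) < t := ht
    have h1 := ((hasDerivAt_id t).pow 2).neg.div_const 2 |>.exp
    have h2 := Real.hasDerivAt_rpow_const (x := t) (p := α + 1) (Or.inl ht0.ne')
    have h := ((h2.mul h1).div_const 2).neg
    convert! h using 1
    simp only [hGdef, id, Nat.cast_ofNat, add_sub_cancel_right, Pi.neg_apply, Pi.pow_apply]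
    rw [Real.rpow_add ht0, Real.rpow_one]
    ring
  have hcont : ContinuousAt (fun t : ℝ => -(t ^ (α + 1) * Real.exp (-t ^ 2 / 2) / 2)) 0 := by
    have h1 : ContinuousAt (fun t : ℝ => t ^ (α + 1)) 0 :=
      Real.continuousAt_rpow_const _ _ (Or.inr (by linarith))
    exact ((h1.mul (by fun_prop)).div_const 2).neg
  have htop : Tendsto (fun t : ℝ => -(t ^ (α + 1) * Real.exp (-t ^ 2 / 2) / 2)) atTop (𝓝 0) := by
    have h := (rpow_mul_exp_neg_mul_sq_isLittleO_exp_neg (b := 1 / 2) (by norm_num) (α + 1)).trans_tendsto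
      (Real.tendsto_exp_atBot.comp (tendsto_id.const_mul_atTop_of_neg (by norm_num : -(1 / 2 : ℝ) < 0)))
    refine ((h.div_const 2).neg.congr fun t => ?_).trans (by simp)
    ring_nf
  have hI := fun (s : Set ℝ) (hs : MeasurableSet s) =>
    integrable_withDensity_restrict_iff (G := G) measurableSet_Ioi hs hw hw0
  have hGs : ContDiff ℝ 1 G := by
    simp only [hGdef]
    fun_prop
  refine pairEnergy_le_of_tail (m := halfLineGauss α) (G := G) isOpen_Ioi ordConnected_Ioi hw
    hGs.contDiffOn hGs.continuous.measurable ?_ rfl ?_ ?_ ?_ hg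
  · intro t ht
    rw [(hGd t).deriv]
    exact ht
  · rw [← integrableOn_univ]
    refine (hI univ MeasurableSet.univ).1.2 ?_
    rwa [univ_inter]
  · rw [← setIntegral_univ]
    refine (hI univ MeasurableSet.univ).2.trans ?_
    rw [univ_inter, integral_Ioi_of_hasDerivAt_of_tendsto hcont.continuousWithinAt hder hint htop]
    simp [Real.zero_rpow (by linarith : α + 1 ≠ 0)]
  · intro t ht
    have ht0 : (0 : ℝ) < t := ht
    refine (hI (Ioi t) measurableSet_Ioi).2.le.trans ?_
    rw [inter_eq_left.2 (Ioi_subset_Ioi ht0.le),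
      integral_Ioi_of_hasDerivAt_of_tendsto' (fun x hx => hder x (lt_of_lt_of_le ht0 hx))
        (hint.mono_set (Ioi_subset_Ioi ht0.le)) htop, (hGd t).deriv, Real.rpow_add ht0, Real.rpow_one]
    have : 0 < t ^ α * t * Real.exp (-t ^ 2 / 2) := by positivity
    linarith

variable {n : ℕ}

/-- The (unnormalized) standard Gaussian measure on `ℝ^n`. -/
noncomputable def spaceGauss (n : ℕ) : Measure (EuclideanSpace ℝ (Fin n)) :=
  volume.withDensity fun z => ENNReal.ofReal (Real.exp (-‖z‖ ^ 2 / 2))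

/-- The measure `x_N^α e^{-|x|²/2} dx` on the half-space. -/
noncomputable def halfGauss (n : ℕ) (α : ℝ) : Measure (EuclideanSpace ℝ (Fin (n + 1))) :=
  (volume.restrict (halfSpace n)).withDensity
    fun x => ENNReal.ofReal (x (Fin.last n) ^ α * Real.exp (-‖x‖ ^ 2 / 2))

lemma map_heightEquiv_prod {J : Set ℝ} (hJ : MeasurableSet J) {w : ℝ → ℝ} (hw : Measurable w)
    (hw0 : ∀ t, 0 ≤ w t)
    {u : EuclideanSpace ℝ (Fin (n + 1)) → ℝ} (hu : Measurable u)
    (huw : ∀ s z, u (emb n z + s • eLast n) = w s * Real.exp (-‖z‖ ^ 2 / 2)) :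
    (((volume.restrict J).withDensity fun t => ENNReal.ofReal (w t)).prod (spaceGauss n)).map
      (heightEquiv n) =
    (volume.restrict {x : EuclideanSpace ℝ (Fin (n + 1)) | x (Fin.last n) ∈ J}).withDensity
      fun x => ENNReal.ofReal (u x) := by
  have hJ' : MeasurableSet {x : EuclideanSpace ℝ (Fin (n + 1)) | x (Fin.last n) ∈ J} :=
    (by fun_prop : Measurable fun x : EuclideanSpace ℝ (Fin (n + 1)) => x (Fin.last n)) hJ
  have he : Measurable fun z : EuclideanSpace ℝ (Fin n) =>
      ENNReal.ofReal (Real.exp (-‖z‖ ^ 2 / 2)) := by fun_prop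
  have hpre : heightEquiv n ⁻¹' {x : EuclideanSpace ℝ (Fin (n + 1)) | x (Fin.last n) ∈ J} =
      J ×ˢ univ := by
    ext p
    simp [heightEquiv_apply]
  ext A hA
  have hAm : Measurable (A.indicator fun _ => (1 : ℝ≥0∞)) := measurable_const.indicator hA
  rw [Measure.map_apply (heightEquiv n).measurable hA, withDensity_apply _ hA,
    spaceGauss, prod_withDensity hw.ennreal_ofReal he,
    withDensity_apply _ ((heightEquiv n).measurable hA)]
  have h1 : (volume.restrict J).prod (volume : Measure (EuclideanSpace ℝ (Fin n))) =
      (volume : Measure (ℝ × EuclideanSpace ℝ (Fin n))).restrict (J ×ˢ univ) := by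
    rw [Measure.volume_eq_prod, ← Measure.prod_restrict, Measure.restrict_univ]
  rw [h1, ← hpre]
  have h2 := ((measurePreserving_heightEquiv n).restrict_preimage hJ').setLIntegral_comp_preimage hA
    hu.ennreal_ofReal
  rw [← h2]
  refine lintegral_congr fun p => ?_
  rw [heightEquiv_apply, huw, ENNReal.ofReal_mul (hw0 _)]

lemma pairEnergy_map_heightEquiv {μ : Measure (ℝ × EuclideanSpace ℝ (Fin n))} [SFinite μ]
    {f : EuclideanSpace ℝ (Fin (n + 1)) → ℝ} (hf : Measurable f) :
    pairEnergy (μ.map (heightEquiv n)) f = pairEnergy μ fun p => f (heightEquiv n p) := by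
  have he := (heightEquiv n).measurable
  rw [pairEnergy, Measure.map_prod_map μ μ he he, lintegral_map _ (he.prodMap he)]
  · rfl
  · exact (((hf.comp measurable_fst).sub (hf.comp measurable_snd)).pow_const 2).ennreal_ofReal

lemma sq_apply_add_norm_comp_emb_sq_le (L : EuclideanSpace ℝ (Fin (n + 1)) →L[ℝ] ℝ) :
    L (eLast n) ^ 2 + ‖L.comp (emb n)‖ ^ 2 ≤ ‖L‖ ^ 2 := by
  obtain ⟨g, rfl⟩ := (InnerProductSpace.toDual ℝ _).surjective L
  set z : EuclideanSpace ℝ (Fin n) := hor g with hz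
  have hg : g = emb n z + g (Fin.last n) • eLast n := by
    ext i
    refine Fin.lastCases ?_ (fun j => ?_) i <;> simp [hz, hor]
  have h1 : InnerProductSpace.toDual ℝ _ g (eLast n) = g (Fin.last n) := by
    rw [InnerProductSpace.toDual_apply_apply]
    simp [PiLp.inner_apply, Fin.sum_univ_castSucc]
  have h2 : ‖(InnerProductSpace.toDual ℝ _ g).comp (emb n)‖ ≤ ‖z‖ := by
    refine ContinuousLinearMap.opNorm_le_bound _ (norm_nonneg _) fun v => ?_
    have : ((InnerProductSpace.toDual ℝ _ g).comp (emb n)) v = inner ℝ z v := by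
      rw [ContinuousLinearMap.comp_apply, InnerProductSpace.toDual_apply_apply]
      simp [PiLp.inner_apply, Fin.sum_univ_castSucc, hz, hor]
    rw [this]
    exact norm_inner_le_norm z v
  have h3 : ‖InnerProductSpace.toDual ℝ _ g‖ ^ 2 = ‖z‖ ^ 2 + g (Fin.last n) ^ 2 := by
    rw [LinearIsometryEquiv.norm_map, ← norm_emb_add_smul_sq, ← hg]
  rw [h1, h3]
  have := pow_le_pow_left₀ (norm_nonneg _) h2 2
  linarith

/-- Spectral gaps tensorize. -/
lemma pairEnergy_height_le {J : Set ℝ} (hJ : IsOpen J) {m : Measure ℝ} [SFinite m]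
    (hmJ : ∀ᵐ t ∂m, t ∈ J) {η : Measure (EuclideanSpace ℝ (Fin n))} [SFinite η]
    (hm : ∀ g : ℝ → ℝ, ContDiffOn ℝ 1 g J →
      pairEnergy m g ≤ 2 * m univ * ∫⁻ t, ENNReal.ofReal (deriv g t ^ 2) ∂m)
    (hη : ∀ f : EuclideanSpace ℝ (Fin n) → ℝ, ContDiff ℝ 1 f →
      pairEnergy η f ≤ 2 * η univ * ∫⁻ z, ENNReal.ofReal (‖fderiv ℝ f z‖ ^ 2) ∂η)
    {f : EuclideanSpace ℝ (Fin (n + 1)) → ℝ} (hf : Measurable f)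
    (hfd : ContDiffOn ℝ 1 f {x | x (Fin.last n) ∈ J}) :
    pairEnergy ((m.prod η).map (heightEquiv n)) f ≤ 2 * ((m.prod η).map (heightEquiv n)) univ *
      ∫⁻ x, ENNReal.ofReal (‖fderiv ℝ f x‖ ^ 2) ∂((m.prod η).map (heightEquiv n)) := by
  have hO : IsOpen {x : EuclideanSpace ℝ (Fin (n + 1)) | x (Fin.last n) ∈ J} :=
    hJ.preimage (by fun_prop)
  have he := (heightEquiv n).measurable
  set A : ℝ × EuclideanSpace ℝ (Fin n) → ℝ≥0∞ := fun p =>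
    ENNReal.ofReal ((fderiv ℝ f (heightEquiv n p) (eLast n)) ^ 2) with hA
  set B : ℝ × EuclideanSpace ℝ (Fin n) → ℝ≥0∞ := fun p =>
    ENNReal.ofReal (‖(fderiv ℝ f (heightEquiv n p)).comp (emb n)‖ ^ 2) with hB
  have hAm : Measurable A :=
    (((measurable_fderiv_apply_const ℝ f (eLast n)).comp he).pow_const 2).ennreal_ofReal
  have hBm : Measurable B := by
    have h1 : Continuous fun L : EuclideanSpace ℝ (Fin (n + 1)) →L[ℝ] ℝ => ‖L.comp (emb n)‖ :=
      (continuous_id.clm_comp continuous_const).norm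
    exact ((h1.measurable.comp ((measurable_fderiv ℝ f).comp he)).pow_const 2).ennreal_ofReal
  have hmem : ∀ s ∈ J, ∀ z, emb n z + s • eLast n ∈
      {x : EuclideanSpace ℝ (Fin (n + 1)) | x (Fin.last n) ∈ J} := by
    intro s hs z
    simpa using hs
  have hd : ∀ s ∈ J, ∀ z, HasFDerivAt f (fderiv ℝ f (emb n z + s • eLast n))
      (emb n z + s • eLast n) := fun s hs z =>
    ((hfd.differentiableOn one_ne_zero).differentiableAt (hO.mem_nhds (hmem s hs z))).hasFDerivAt
  have h1 : ∀ z, pairEnergy m (fun s => f (heightEquiv n (s, z))) ≤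
      2 * m univ * ∫⁻ s, A (s, z) ∂m := by
    intro z
    simp only [heightEquiv_apply]
    refine (hm _ ?_).trans ?_
    · refine hfd.comp (ContDiff.contDiffOn (by fun_prop)) ?_
      exact fun s hs => hmem s hs z
    · gcongr 2 * m univ * ?_
      refine lintegral_mono_ae ?_
      filter_upwards [hmJ] with s hs
      have h := (hd s hs z).comp_hasDerivAt s
        (((hasDerivAt_id s).smul_const (eLast n)).const_add (emb n z))
      rw [one_smul] at h
      simp only [hA, heightEquiv_apply]
      exact le_of_eq (by rw [← h.deriv]; rfl)
  have h2 : ∀ s ∈ J, pairEnergy η (fun z => f (heightEquiv n (s, z))) ≤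
      2 * η univ * ∫⁻ z, B (s, z) ∂η := by
    intro s hs
    simp only [heightEquiv_apply]
    refine (hη _ ?_).trans (le_of_eq ?_)
    · rw [← contDiffOn_univ]
      refine hfd.comp (ContDiff.contDiffOn (by fun_prop)) ?_
      exact fun z _ => hmem s hs z
    · congr 1
      refine lintegral_congr fun z => ?_
      have h := (hd s hs z).comp z (((emb n).hasFDerivAt (x := z)).add_const (s • eLast n))
      simp only [hB, heightEquiv_apply]
      rw [← h.fderiv]
      rfl
  rw [pairEnergy_map_heightEquiv hf, lintegral_map (by
    exact (((measurable_fderiv ℝ f).norm).pow_const 2).ennreal_ofReal) he,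
    Measure.map_apply he MeasurableSet.univ, preimage_univ, ← univ_prod_univ, Measure.prod_prod]
  calc pairEnergy (m.prod η) (fun p => f (heightEquiv n p))
      ≤ η univ * ∫⁻ z, pairEnergy m (fun s => f (heightEquiv n (s, z))) ∂η +
        m univ * ∫⁻ s, pairEnergy η (fun z => f (heightEquiv n (s, z))) ∂m :=
        pairEnergy_prod_le (hf.comp he)
    _ ≤ η univ * ∫⁻ z, 2 * m univ * ∫⁻ s, A (s, z) ∂m ∂η +
        m univ * ∫⁻ s, 2 * η univ * ∫⁻ z, B (s, z) ∂η ∂m := by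
        refine add_le_add (mul_le_mul' le_rfl (lintegral_mono h1))
          (mul_le_mul' le_rfl (lintegral_mono_ae ?_))
        filter_upwards [hmJ] with s hs using h2 s hs
    _ = 2 * (m univ * η univ) * ∫⁻ p, (A p + B p) ∂(m.prod η) := by
        rw [lintegral_const_mul _ (Measurable.lintegral_prod_left' hAm),
          lintegral_const_mul _ (Measurable.lintegral_prod_right' hBm),
          lintegral_add_left hAm, lintegral_prod_symm _ hAm.aemeasurable,
          lintegral_prod _ hBm.aemeasurable]
        ring
    _ ≤ _ := by
        gcongr with p
        rw [hA, hB, ← ENNReal.ofReal_add (by positivity) (by positivity)]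
        exact ENNReal.ofReal_le_ofReal (sq_apply_add_norm_comp_emb_sq_le _)

lemma spaceGauss_gap (n : ℕ) : ∀ f : EuclideanSpace ℝ (Fin n) → ℝ, ContDiff ℝ 1 f →
    pairEnergy (spaceGauss n) f ≤ 2 * spaceGauss n univ *
      ∫⁻ z, ENNReal.ofReal (‖fderiv ℝ f z‖ ^ 2) ∂(spaceGauss n) := by
  induction n with
  | zero =>
    intro f _
    have h : ∀ p : EuclideanSpace ℝ (Fin 0) × EuclideanSpace ℝ (Fin 0), f p.1 - f p.2 = 0 :=
      fun p => by rw [Subsingleton.elim p.1 p.2, sub_self]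
    simp [pairEnergy, h]
  | succ n ih =>
    intro f hf
    have hw : Measurable fun t : ℝ => Real.exp (-t ^ 2 / 2) := by fun_prop
    have hmap : (lineGauss.prod (spaceGauss n)).map (heightEquiv n) = spaceGauss (n + 1) := by
      rw [lineGauss, map_heightEquiv_prod MeasurableSet.univ hw (fun t => (Real.exp_pos _).le)
        (u := fun x => Real.exp (-‖x‖ ^ 2 / 2)) (by fun_prop)]
      · simp [spaceGauss]
      · intro s z
        rw [norm_emb_add_smul_sq, ← Real.exp_add]
        ring_nf
    have hs1 : SFinite lineGauss := by unfold lineGauss; infer_instance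
    have hs2 : SFinite (spaceGauss n) := by unfold spaceGauss; infer_instance
    rw [← hmap]
    exact pairEnergy_height_le isOpen_univ (Eventually.of_forall fun _ => mem_univ _)
      (fun g hg => lineGauss_gap (contDiffOn_univ.1 hg)) ih hf.continuous.measurable hf.contDiffOn

/-- The Poincaré inequality, with constant one, for the weighted Gaussian measure on the
half-space. -/
lemma halfGauss_gap {α : ℝ} (hα : -1 < α) {f : EuclideanSpace ℝ (Fin (n + 1)) → ℝ}
    (hf : Measurable f) (hfd : ContDiffOn ℝ 1 f (halfSpace n)) :
    pairEnergy (halfGauss n α) f ≤ 2 * halfGauss n α univ *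
      ∫⁻ x, ENNReal.ofReal (‖fderiv ℝ f x‖ ^ 2) ∂(halfGauss n α) := by
  -- the factor `|t|` makes the density nonnegative on the whole line
  have hw : Measurable fun t : ℝ => |t| ^ α * Real.exp (-t ^ 2 / 2) := by fun_prop
  have hmap : ((halfLineGauss α).prod (spaceGauss n)).map (heightEquiv n) = halfGauss n α := by
    have h1 : halfLineGauss α = (volume.restrict (Ioi 0)).withDensity
        fun t => ENNReal.ofReal (|t| ^ α * Real.exp (-t ^ 2 / 2)) := by
      refine withDensity_congr_ae ?_
      filter_upwards [ae_restrict_mem measurableSet_Ioi] with t ht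
      rw [abs_of_pos ht]
    rw [h1, map_heightEquiv_prod measurableSet_Ioi hw (fun t => by positivity)
      (u := fun x => |x (Fin.last n)| ^ α * Real.exp (-‖x‖ ^ 2 / 2)) (by fun_prop)]
    · refine withDensity_congr_ae ?_
      filter_upwards [ae_restrict_mem measurableSet_halfSpace] with x hx
      rw [abs_of_pos hx]
    · intro s z
      rw [norm_emb_add_smul_sq, mul_assoc, ← Real.exp_add]
      simp
      ring_nf
      simp
  have hs1 : SFinite (halfLineGauss α) := by unfold halfLineGauss; infer_instance
  have hs2 : SFinite (spaceGauss n) := by unfold spaceGauss; infer_instance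
  rw [← hmap]
  refine pairEnergy_height_le isOpen_Ioi ?_ (fun g hg => halfLineGauss_gap hα hg)
    (spaceGauss_gap n) hf hfd
  exact (withDensity_absolutelyContinuous _ _).ae_le (ae_restrict_mem measurableSet_Ioi)

end GaussianGap

/-! ### The weighted Poincaré inequality on the hemisphere -/

section Poincare

variable {n : ℕ}

/-- The radial moments `∫_0^∞ r^b e^{-r²/2} dr`. -/
noncomputable def radialMoment (b : ℝ) : ℝ :=
  ∫ r in Ioi (0 : ℝ), r ^ b * Real.exp (-r ^ 2 / 2)

lemma radialMoment_eq {b : ℝ} (hb : -1 < b) :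
    radialMoment b = (1 / 2) ^ (-(b + 1) / 2) * (1 / 2) * Real.Gamma ((b + 1) / 2) := by
  rw [← integral_rpow_mul_exp_neg_mul_rpow (p := 2) (q := b) (b := 1 / 2) two_pos hb (by norm_num)]
  refine setIntegral_congr_fun measurableSet_Ioi fun r _ => ?_
  simp only [Real.rpow_two]
  ring_nf

lemma radialMoment_pos {b : ℝ} (hb : -1 < b) : 0 < radialMoment b := by
  rw [radialMoment_eq hb]
  have : 0 < Real.Gamma ((b + 1) / 2) := Real.Gamma_pos_of_pos (by linarith)
  positivity

lemma radialMoment_add_two {b : ℝ} (hb : -1 < b) :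
    radialMoment (b + 2) = (b + 1) * radialMoment b := by
  rw [radialMoment_eq (by linarith), radialMoment_eq hb]
  have h1 : (b + 2 + 1) / 2 = (b + 1) / 2 + 1 := by ring
  have h2 : -(b + 2 + 1) / 2 = -(b + 1) / 2 + (-1) := by ring
  rw [h1, h2, Real.Gamma_add_one (by linarith), Real.rpow_add (by norm_num), Real.rpow_neg_one]
  ring

/-- Integration of functions homogeneous of degree `a` against the Gaussian measure on the
half-space. -/
lemma lintegral_halfGauss {α a : ℝ} (ha : -1 < n + α + a)
    {H : EuclideanSpace ℝ (Fin (n + 1)) → ℝ≥0∞} (hH : Measurable H)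
    {h : EuclideanSpace ℝ (Fin n) → ℝ≥0∞} (hh : Measurable h)
    (hHh : ∀ z, ∀ r, 0 < r → H (r • dir z) = ENNReal.ofReal (r ^ a) * h z) :
    ∫⁻ x, H x ∂(halfGauss n α) =
      ENNReal.ofReal (radialMoment (n + α + a)) * ∫⁻ z, h z ∂(sphereMeasure n α) := by
  have hw : Measurable fun x : EuclideanSpace ℝ (Fin (n + 1)) =>
      ENNReal.ofReal (x (Fin.last n) ^ α * Real.exp (-‖x‖ ^ 2 / 2)) := by fun_prop
  have hwH : Measurable fun x : EuclideanSpace ℝ (Fin (n + 1)) =>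
      ENNReal.ofReal (x (Fin.last n) ^ α * Real.exp (-‖x‖ ^ 2 / 2)) * H x := hw.mul hH
  have h1 : ∫⁻ x, H x ∂(halfGauss n α) = ∫⁻ x in halfSpace n,
      ENNReal.ofReal (x (Fin.last n) ^ α * Real.exp (-‖x‖ ^ 2 / 2)) * H x := by
    rw [halfGauss, lintegral_withDensity_eq_lintegral_mul _ hw hH]
    rfl
  have hhm : Measurable fun z => ENNReal.ofReal (‖vec z‖ ^ (-(n + 1 + α))) * h z :=
    (measurable_norm_vec_rpow _).ennreal_ofReal.mul hh
  rw [h1, lintegral_halfSpace_cone hwH, lintegral_sphereMeasure α hh, ← lintegral_const_mul _ hhm]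
  refine lintegral_congr fun z => ?_
  set q := ‖vec z‖ with hq
  have hq0 : 0 < q := norm_vec_pos z
  have hint : IntegrableOn (fun r : ℝ => r ^ (n + α + a) * Real.exp (-r ^ 2 / 2)) (Ioi 0) :=
    integrable_rpow_mul_exp ha
  have hint' : IntegrableOn (fun s : ℝ => q ^ (-(n + α)) *
      ((q * s) ^ (n + α + a) * Real.exp (-(q * s) ^ 2 / 2))) (Ioi 0) := by
    refine Integrable.const_mul ?_ _
    have := (integrableOn_Ioi_comp_mul_left_iff
      (fun r : ℝ => r ^ (n + α + a) * Real.exp (-r ^ 2 / 2)) 0 hq0).2 (by simpa using hint)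
    exact this
  have h2 : ∀ s ∈ Ioi (0 : ℝ), ENNReal.ofReal (s ^ n) *
      (ENNReal.ofReal ((s • vec z) (Fin.last n) ^ α * Real.exp (-‖s • vec z‖ ^ 2 / 2)) *
        H (s • vec z)) =
      ENNReal.ofReal (q ^ (-(n + α)) * ((q * s) ^ (n + α + a) * Real.exp (-(q * s) ^ 2 / 2))) *
        h z := by
    intro s hs
    have hs0 : 0 < s := hs
    have hv : s • vec z = (q * s) • dir z := by
      rw [dir, smul_smul, mul_comm q s, mul_assoc, mul_inv_cancel₀ hq0.ne', mul_one]
    have h3 : H (s • vec z) = ENNReal.ofReal ((q * s) ^ a) * h z := by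
      rw [hv, hHh z _ (by positivity)]
    rw [h3, norm_smul, Real.norm_of_nonneg hs0.le, PiLp.smul_apply, vec_last, smul_eq_mul, mul_one,
      ← mul_assoc, ← mul_assoc, ← ENNReal.ofReal_mul (by positivity),
      ← ENNReal.ofReal_mul (by positivity)]
    congr 2
    rw [← hq, mul_comm s q, Real.rpow_add (by positivity), Real.rpow_neg hq0.le,
      Real.mul_rpow hq0.le hs0.le (z := n + α), Real.rpow_add hs0, Real.rpow_natCast]
    have : 0 < q ^ ((n : ℝ) + α) := by positivity
    field_simp
  rw [setLIntegral_congr_fun measurableSet_Ioi h2, lintegral_mul_const _ (by fun_prop),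
    ← mul_assoc, ← ENNReal.ofReal_mul (radialMoment_pos ha).le]
  congr 1
  rw [← ofReal_integral_eq_lintegral_ofReal hint']
  · congr 1
    rw [integral_const_mul]
    have h4 := integral_comp_mul_left_Ioi
      (fun r : ℝ => r ^ (n + α + a) * Real.exp (-r ^ 2 / 2)) 0 hq0
    rw [h4, mul_zero, smul_eq_mul, ← radialMoment]
    have h5 : (-((n : ℝ) + 1 + α)) = -(n + α) + (-1) := by ring
    rw [h5, Real.rpow_add hq0, Real.rpow_neg_one]
    ring
  · filter_upwards [ae_restrict_mem measurableSet_Ioi] with s hs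
    have hs0 : (0 : ℝ) < s := hs
    positivity

lemma pairEnergy_eq_of_integral_eq_zero {X : Type*} [MeasurableSpace X] {μ : Measure X}
    [IsFiniteMeasure μ] {f : X → ℝ} (hf : Integrable f μ) (hf2 : Integrable (fun x => f x ^ 2) μ)
    (h0 : ∫ x, f x ∂μ = 0) :
    pairEnergy μ f = 2 * μ univ * ∫⁻ x, ENNReal.ofReal (f x ^ 2) ∂μ := by
  have h1 : Integrable (fun p : X × X => f p.1 ^ 2) (μ.prod μ) := hf2.comp_fst μ
  have h2 : Integrable (fun p : X × X => f p.2 ^ 2) (μ.prod μ) := hf2.comp_snd μ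
  have h3 : Integrable (fun p : X × X => f p.1 * f p.2) (μ.prod μ) := hf.mul_prod hf
  have heq : ∀ p : X × X, (f p.1 - f p.2) ^ 2 = f p.1 ^ 2 + f p.2 ^ 2 - 2 * (f p.1 * f p.2) :=
    fun p => by ring
  have h4 : Integrable (fun p : X × X => (f p.1 - f p.2) ^ 2) (μ.prod μ) := by
    simp_rw [heq]
    exact (h1.add h2).sub (h3.const_mul 2)
  rw [pairEnergy, ← ofReal_integral_eq_lintegral_ofReal h4 (Eventually.of_forall fun p => sq_nonneg _),
    ← ofReal_integral_eq_lintegral_ofReal hf2 (Eventually.of_forall fun p => sq_nonneg _),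
    ← ofReal_measureReal (measure_ne_top _ _), ← ENNReal.ofReal_ofNat 2,
    ← ENNReal.ofReal_mul (by norm_num), ← ENNReal.ofReal_mul (by positivity)]
  congr 1
  have h5 : Integrable (fun p : X × X => f p.1 ^ 2 + f p.2 ^ 2) (μ.prod μ) := h1.add h2
  simp_rw [heq]
  rw [integral_sub h5 (h3.const_mul 2), integral_add h1 h2, integral_const_mul,
    integral_prod_mul f f, h0, integral_fun_fst (fun x => f x ^ 2),
    integral_fun_snd (fun x => f x ^ 2)]
  simp only [smul_eq_mul, OfNat.ofNat]
  ring

/-- The gradient of `|x| V(x)` for `V` homogeneous of degree `0`. -/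
lemma norm_fderiv_norm_mul_sq {V : EuclideanSpace ℝ (Fin (n + 1)) → ℝ} (hV : IsHomog V)
    {x G : EuclideanSpace ℝ (Fin (n + 1))} (hx : x ∈ halfSpace n)
    (hG : HasFDerivAt V (innerSL ℝ G) x) :
    ‖fderiv ℝ (fun y => ‖y‖ * V y) x‖ ^ 2 = ‖x‖ ^ 2 * ‖G‖ ^ 2 + V x ^ 2 := by
  have hx' : 0 < x (Fin.last n) := hx
  have hx0 : x ≠ 0 := by rintro rfl; simp at hx'
  have hn : ‖x‖ ≠ 0 := norm_ne_zero_iff.2 hx0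
  have h1 : HasFDerivAt (fun y : EuclideanSpace ℝ (Fin (n + 1)) => ‖y‖)
      (innerSL ℝ (‖x‖⁻¹ • x)) x := by
    have h2 := ((hasStrictFDerivAt_norm_sq x).hasFDerivAt).sqrt (by positivity)
    have h3 : (fun y : EuclideanSpace ℝ (Fin (n + 1)) => √(‖y‖ ^ 2)) = fun y => ‖y‖ := by
      funext y
      exact Real.sqrt_sq (norm_nonneg y)
    rw [h3] at h2
    convert! h2 using 1
    ext v
    simp only [map_smul, _root_.smul_apply, innerSL_apply_apply, smul_eq_mul,
      Real.sqrt_sq (norm_nonneg x), nsmul_eq_mul, Nat.cast_ofNat]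
    field_simp
  have h2 : HasFDerivAt (fun y => ‖y‖ * V y) _ x := h1.mul hG
  have h3 : ‖x‖ • innerSL ℝ G + V x • innerSL ℝ (‖x‖⁻¹ • x) =
      innerSL ℝ (‖x‖ • G + (V x * ‖x‖⁻¹) • x) := by
    ext v
    simp
    ring
  rw [h3] at h2
  rw [h2.fderiv, innerSL_apply_norm, @norm_add_sq_real, real_inner_smul_left, real_inner_smul_right,
    hV.inner_gradient_eq_zero hx hG, norm_smul, norm_smul, norm_mul, norm_inv, norm_norm, mul_pow,
    mul_pow, mul_pow, Real.norm_eq_abs, sq_abs]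
  field_simp
  ring

/-- The weighted Poincaré inequality on the hemisphere. For mean-zero `V`, homogeneous of degree
`0`, it is the Gaussian Poincaré inequality for `f(x) = |x| V(x)`: here `|∇f|² = |∇V|² + V²` on
the unit sphere, and the ratio of the radial moments of `f²` and `|∇f|²` is `n + 1 + α`. -/
theorem poincare_hemisphere {α : ℝ} (hα : -1 < α) (hn : 0 ≤ n + α)
    {V : EuclideanSpace ℝ (Fin (n + 1)) → ℝ} (hV : IsHomog V)
    {G : EuclideanSpace ℝ (Fin (n + 1)) → EuclideanSpace ℝ (Fin (n + 1))}
    (hG : ∀ x ∈ halfSpace n, HasFDerivAt V (innerSL ℝ (G x)) x)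
    (hVd : ContDiffOn ℝ 1 V (halfSpace n)) (hGm : Measurable fun z : EuclideanSpace ℝ (Fin n) => G (dir z))
    {C : ℝ} (hC : ∀ z : EuclideanSpace ℝ (Fin n), |V (dir z)| ≤ C)
    (h0 : ∫ z, V (dir z) ∂(sphereMeasure n α) = 0) :
    ENNReal.ofReal (n + α) * ∫⁻ z, ENNReal.ofReal (V (dir z) ^ 2) ∂(sphereMeasure n α) ≤
      ∫⁻ z, ENNReal.ofReal (‖G (dir z)‖ ^ 2) ∂(sphereMeasure n α) := by
  have hfin := isFiniteMeasure_sphereMeasure (n := n) hα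
  have hb : -1 < (n : ℝ) + α := by linarith
  set f : EuclideanSpace ℝ (Fin (n + 1)) → ℝ := (halfSpace n).indicator fun x => ‖x‖ * V x with hf
  have hcn : ContDiffOn ℝ 1 (fun x : EuclideanSpace ℝ (Fin (n + 1)) => ‖x‖) (halfSpace n) := by
    intro x hx
    have hx' : 0 < x (Fin.last n) := hx
    exact (contDiffAt_norm ℝ (by rintro rfl; simp at hx')).contDiffWithinAt
  have hfd : ContDiffOn ℝ 1 f (halfSpace n) :=
    (hcn.mul hVd).congr fun x hx => indicator_of_mem hx _
  have hfm : Measurable f := by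
    have h := (hcn.mul hVd).continuousOn
    rw [hf]
    classical
    rw [← piecewise_eq_indicator]
    exact h.measurable_piecewise continuousOn_const measurableSet_halfSpace
  have hVm : Measurable fun z : EuclideanSpace ℝ (Fin n) => V (dir z) :=
    (hVd.continuousOn.comp_continuous continuous_dir fun z => dir_mem_halfSpace z).measurable
  have hfr : ∀ z, ∀ r, 0 < r → f (r • dir z) = r * V (dir z) := by
    intro z r hr
    rw [hf, indicator_of_mem (smul_mem_halfSpace (dir_mem_halfSpace z) hr), norm_smul, norm_dir,
      mul_one, Real.norm_of_nonneg hr.le, hV _ (dir_mem_halfSpace z) r hr]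
  have hfder : ∀ z, ∀ r : ℝ, 0 < r →
      ‖fderiv ℝ f (r • dir z)‖ ^ 2 = V (dir z) ^ 2 + ‖G (dir z)‖ ^ 2 := by
    intro z r hr
    have hm := smul_mem_halfSpace (dir_mem_halfSpace z) hr
    have heq : f =ᶠ[𝓝 (r • dir z)] fun y => ‖y‖ * V y := by
      filter_upwards [isOpen_halfSpace.mem_nhds hm] with y hy using indicator_of_mem hy _
    rw [heq.fderiv_eq, norm_fderiv_norm_mul_sq hV hm (hG _ hm), hV _ (dir_mem_halfSpace z) r hr,
      ← hV.gradient_smul (dir_mem_halfSpace z) hr (hG _ (dir_mem_halfSpace z)) (hG _ hm),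
      norm_smul, norm_smul, norm_dir, Real.norm_of_nonneg hr.le]
    ring
  -- the second moments
  have hsq : ∫⁻ x, ENNReal.ofReal (f x ^ 2) ∂(halfGauss n α) =
      ENNReal.ofReal ((n + α + 1) * radialMoment (n + α)) *
        ∫⁻ z, ENNReal.ofReal (V (dir z) ^ 2) ∂(sphereMeasure n α) := by
    rw [← radialMoment_add_two hb]
    refine lintegral_halfGauss (by linarith) ((hfm.pow_const 2).ennreal_ofReal)
      ((hVm.pow_const 2).ennreal_ofReal) fun z r hr => ?_
    rw [hfr z r hr, ← ENNReal.ofReal_mul (by positivity), Real.rpow_two]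
    ring_nf
  have hgr : ∫⁻ x, ENNReal.ofReal (‖fderiv ℝ f x‖ ^ 2) ∂(halfGauss n α) =
      ENNReal.ofReal (radialMoment (n + α)) *
        ∫⁻ z, (ENNReal.ofReal (V (dir z) ^ 2) + ENNReal.ofReal (‖G (dir z)‖ ^ 2))
          ∂(sphereMeasure n α) := by
    have h := lintegral_halfGauss (n := n) (α := α) (a := 0) (by linarith)
      (((measurable_fderiv ℝ f).norm.pow_const 2).ennreal_ofReal)
      (h := fun z => ENNReal.ofReal (V (dir z) ^ 2) + ENNReal.ofReal (‖G (dir z)‖ ^ 2))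
      ((hVm.pow_const 2).ennreal_ofReal.add (hGm.norm.pow_const 2).ennreal_ofReal) fun z r hr => by
        rw [hfder z r hr, Real.rpow_zero, ENNReal.ofReal_one, one_mul,
          ENNReal.ofReal_add (by positivity) (by positivity)]
    rwa [add_zero] at h
  have hmass : halfGauss n α univ ≠ ∞ := by
    have h := lintegral_halfGauss (n := n) (α := α) (a := 0) (by linarith) (H := fun _ => 1)
      measurable_const (h := fun _ => 1) measurable_const fun z r hr => by simp
    rw [lintegral_const, one_mul, lintegral_const, one_mul] at h
    rw [h]
    exact ENNReal.mul_ne_top ENNReal.ofReal_ne_top (measure_ne_top _ _)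
  have hfinG : IsFiniteMeasure (halfGauss n α) := ⟨hmass.lt_top⟩
  have hV2fin : ∫⁻ z, ENNReal.ofReal (V (dir z) ^ 2) ∂(sphereMeasure n α) ≠ ∞ := by
    refine ne_top_of_le_ne_top ?_ (lintegral_mono (g := fun _ => ENNReal.ofReal (C ^ 2)) fun z => ?_)
    · rw [lintegral_const]
      exact ENNReal.mul_ne_top ENNReal.ofReal_ne_top (measure_ne_top _ _)
    · refine ENNReal.ofReal_le_ofReal ?_
      rw [← sq_abs]
      exact pow_le_pow_left₀ (abs_nonneg _) (hC z) 2
  have hL2 : Integrable (fun x => f x ^ 2) (halfGauss n α) := by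
    refine ⟨(hfm.pow_const 2).aestronglyMeasurable, ?_⟩
    rw [hasFiniteIntegral_iff_ofReal (Eventually.of_forall fun x => sq_nonneg _), hsq]
    exact ENNReal.mul_lt_top ENNReal.ofReal_lt_top hV2fin.lt_top
  have hL1 : Integrable f (halfGauss n α) :=
    ((memLp_two_iff_integrable_sq hfm.aestronglyMeasurable).2 hL2).integrable one_le_two
  have hmean : ∫ x, f x ∂(halfGauss n α) = 0 := by
    have hb1 : -1 < (n : ℝ) + α + 1 := by linarith
    have hp := lintegral_halfGauss (n := n) (α := α) (a := 1) hb1 hfm.ennreal_ofReal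
      hVm.ennreal_ofReal fun z r hr => by
        rw [hfr z r hr, ENNReal.ofReal_mul hr.le, Real.rpow_one]
    have hm := lintegral_halfGauss (n := n) (α := α) (a := 1) hb1 hfm.neg.ennreal_ofReal
      hVm.neg.ennreal_ofReal fun z r hr => by
        rw [Pi.neg_apply, hfr z r hr, ← mul_neg, ENNReal.ofReal_mul hr.le, Real.rpow_one]
        rfl
    have hVint : Integrable (fun z => V (dir z)) (sphereMeasure n α) :=
      Integrable.of_bound hVm.aestronglyMeasurable C (Eventually.of_forall hC)
    rw [integral_eq_lintegral_pos_part_sub_lintegral_neg_part hVint] at h0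
    rw [integral_eq_lintegral_pos_part_sub_lintegral_neg_part hL1]
    simp only [Pi.neg_apply] at hm
    rw [hp, hm, ENNReal.toReal_mul, ENNReal.toReal_mul, ← mul_sub, h0, mul_zero]
  -- By separation of variables the gap inequality reads `(n + α + 1) ∫ V ^ 2 ≤ ∫ (V ^ 2 + ‖G‖ ^ 2)`
  -- up to the factor `radialMoment (n + α)`; one `∫ V ^ 2` cancels.
  have hgap := halfGauss_gap hα hfm hfd
  rw [pairEnergy_eq_of_integral_eq_zero hL1 hL2 hmean, hsq, hgr,
    lintegral_add_left (hVm.pow_const 2).ennreal_ofReal] at hgap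
  set X := ∫⁻ z, ENNReal.ofReal (V (dir z) ^ 2) ∂(sphereMeasure n α) with hX
  set Y := ∫⁻ z, ENNReal.ofReal (‖G (dir z)‖ ^ 2) ∂(sphereMeasure n α) with hY
  -- the total mass has to be divided out
  have hmass0 : halfGauss n α univ ≠ 0 ∨ sphereMeasure n α univ = 0 := by
    by_cases hs : sphereMeasure n α univ = 0
    · exact Or.inr hs
    · refine Or.inl ?_
      have h := lintegral_halfGauss (n := n) (α := α) (a := 0) (by linarith) (H := fun _ => 1)
        measurable_const (h := fun _ => 1) measurable_const fun z r hr => by simp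
      rw [lintegral_const, one_mul, lintegral_const, one_mul] at h
      rw [h]
      refine mul_ne_zero ?_ hs
      rw [add_zero]
      exact (ENNReal.ofReal_pos.2 (radialMoment_pos hb)).ne'
  rcases hmass0 with hmass0 | hs
  · have h3 : ENNReal.ofReal ((n + α + 1) * radialMoment (n + α)) * X ≤
        ENNReal.ofReal (radialMoment (n + α)) * (X + Y) :=
      (ENNReal.mul_le_mul_iff_right (mul_ne_zero two_ne_zero hmass0)
        (ENNReal.mul_ne_top ENNReal.ofNat_ne_top hmass)).1 hgap
    rw [mul_comm ((n : ℝ) + α + 1), ENNReal.ofReal_mul (radialMoment_pos hb).le, mul_assoc] at h3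
    have h4 := (ENNReal.mul_le_mul_iff_right (ENNReal.ofReal_pos.2 (radialMoment_pos hb)).ne'
      ENNReal.ofReal_ne_top).1 h3
    rw [ENNReal.ofReal_add hn zero_le_one, add_mul, ENNReal.ofReal_one, one_mul, add_comm] at h4
    exact (ENNReal.add_le_add_iff_left hV2fin).1 h4
  · rw [hX, Measure.measure_univ_eq_zero.1 hs]
    simp

end Poincare

/-! ### Lipschitz perturbations of the identity on the closed half-space -/

section Perturbation

variable {n : ℕ}

lemma isClosed_closedHalfSpace : IsClosed (closedHalfSpace n) :=
  isClosed_le continuous_const (by fun_prop)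

lemma convex_closedHalfSpace : Convex ℝ (closedHalfSpace n) := by
  intro x hx y hy a b ha hb _
  simp only [closedHalfSpace, mem_ofPred_eq, PiLp.add_apply, PiLp.smul_apply, smul_eq_mul] at *
  positivity

lemma halfSpace_subset_closedHalfSpace : halfSpace n ⊆ closedHalfSpace n :=
  fun x hx => show 0 ≤ x (Fin.last n) from le_of_lt (show 0 < x (Fin.last n) from hx)

lemma smul_mem_closedHalfSpace {x : EuclideanSpace ℝ (Fin (n + 1))} (hx : x ∈ closedHalfSpace n)
    {c : ℝ} (hc : 0 ≤ c) : c • x ∈ closedHalfSpace n := by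
  have hx' : 0 ≤ x (Fin.last n) := hx
  change 0 ≤ c * x (Fin.last n)
  positivity

/-- A map that is Lipschitz on each of two closed sets covering a convex set is Lipschitz, with the
same constant, on the convex set: a segment from one set to the other meets their intersection. -/
lemma norm_sub_le_of_closed_cover {V : Type*} [NormedAddCommGroup V] [NormedSpace ℝ V]
    {W : Type*} [NormedAddCommGroup W] {A B K : Set V} (hA : IsClosed A)
    (hB : IsClosed B) (hAB : A ∪ B = univ) (hK : Convex ℝ K) {f : V → W} {c : ℝ}
    (hfA : ∀ x ∈ K ∩ A, ∀ y ∈ K ∩ A, ‖f x - f y‖ ≤ c * ‖x - y‖)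
    (hfB : ∀ x ∈ K ∩ B, ∀ y ∈ K ∩ B, ‖f x - f y‖ ≤ c * ‖x - y‖) {x y : V} (hx : x ∈ K) (hy : y ∈ K) :
    ‖f x - f y‖ ≤ c * ‖x - y‖ := by
  have key : ∀ x ∈ K ∩ A, ∀ y ∈ K ∩ B, ‖f x - f y‖ ≤ c * ‖x - y‖ := by
    intro x hx y hy
    have hseg : IsPreconnected (segment ℝ x y) := (convex_segment x y).isPreconnected
    obtain ⟨p, hp, hpA, hpB⟩ := isPreconnected_closed_iff.1 hseg A B hA hB
      (by rw [hAB]; exact subset_univ _) ⟨x, left_mem_segment ℝ x y, hx.2⟩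
      ⟨y, right_mem_segment ℝ x y, hy.2⟩
    have hpK : p ∈ K := hK.segment_subset hx.1 hy.1 hp
    have h1 := hfA x hx p ⟨hpK, hpA⟩
    have h2 := hfB p ⟨hpK, hpB⟩ y hy
    have h3 : ‖x - p‖ + ‖p - y‖ = ‖x - y‖ := by
      have := mem_segment_iff_wbtw.1 hp
      simpa only [dist_eq_norm] using this.dist_add_dist
    calc ‖f x - f y‖ ≤ ‖f x - f p‖ + ‖f p - f y‖ := norm_sub_le_norm_sub_add_norm_sub _ _ _
      _ ≤ c * (‖x - p‖ + ‖p - y‖) := by rw [mul_add]; exact add_le_add h1 h2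
      _ = _ := by rw [h3]
  have hxAB : x ∈ A ∪ B := hAB ▸ mem_univ x
  have hyAB : y ∈ A ∪ B := hAB ▸ mem_univ y
  rcases hxAB with hxA | hxB <;> rcases hyAB with hyA | hyB
  · exact hfA x ⟨hx, hxA⟩ y ⟨hy, hyA⟩
  · exact key x ⟨hx, hxA⟩ y ⟨hy, hyB⟩
  · rw [norm_sub_rev, norm_sub_rev x]
    exact key y ⟨hy, hyA⟩ x ⟨hx, hxB⟩
  · exact hfB x ⟨hx, hxB⟩ y ⟨hy, hyB⟩

/-- Small perturbations of zero on the closed half-space: `E` is `c`-Lipschitz there and its last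
component vanishes on the hyperplane. -/
structure IsSmall (n : ℕ) (c : ℝ)
    (E : EuclideanSpace ℝ (Fin (n + 1)) → EuclideanSpace ℝ (Fin (n + 1))) : Prop where
  lip : ∀ x ∈ closedHalfSpace n, ∀ y ∈ closedHalfSpace n, ‖E x - E y‖ ≤ c * ‖x - y‖
  last : ∀ x ∈ hyperplane n, E x (Fin.last n) = 0

variable {c : ℝ} {E : EuclideanSpace ℝ (Fin (n + 1)) → EuclideanSpace ℝ (Fin (n + 1))}

lemma IsSmall.abs_last_le (hE : IsSmall n c E) {x : EuclideanSpace ℝ (Fin (n + 1))}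
    (hx : x ∈ closedHalfSpace n) : |E x (Fin.last n)| ≤ c * x (Fin.last n) := by
  have hx' : 0 ≤ x (Fin.last n) := hx
  set y := x - x (Fin.last n) • eLast n with hy
  -- `y` is the projection of `x` to the hyperplane, where the last component of `E` vanishes
  have hyH : y ∈ hyperplane n := by
    change y (Fin.last n) = 0
    simp [hy]
  have h1 := hE.lip x hx y (show 0 ≤ y (Fin.last n) from (show y (Fin.last n) = 0 from hyH).ge)
  have h2 := PiLp.norm_apply_le (E x - E y) (Fin.last n)
  rw [PiLp.sub_apply, hE.last y hyH, sub_zero, Real.norm_eq_abs] at h2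
  refine h2.trans (h1.trans (le_of_eq ?_))
  rw [hy, sub_sub_cancel, norm_smul, norm_eLast, mul_one, Real.norm_of_nonneg hx']

lemma IsSmall.antilipschitz (hE : IsSmall n c E) {x y : EuclideanSpace ℝ (Fin (n + 1))}
    (hx : x ∈ closedHalfSpace n) (hy : y ∈ closedHalfSpace n) :
    (1 - c) * ‖x - y‖ ≤ ‖(x + E x) - (y + E y)‖ := by
  have h1 := hE.lip x hx y hy
  have h2 : x - y = (x + E x) - (y + E y) - (E x - E y) := by abel
  have h3 := norm_sub_le ((x + E x) - (y + E y)) (E x - E y)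
  rw [← h2] at h3
  linarith

lemma IsSmall.injOn (hE : IsSmall n c E) (hc : c < 1) :
    InjOn (fun x => x + E x) (closedHalfSpace n) := by
  intro x hx y hy hxy
  have h := hE.antilipschitz hx hy
  simp only at hxy
  rw [hxy, sub_self, norm_zero] at h
  have h1 : ‖x - y‖ ≤ 0 := by
    by_contra! hcon
    have : 0 < (1 - c) * ‖x - y‖ := mul_pos (by linarith) hcon
    linarith
  exact sub_eq_zero.1 (norm_le_zero_iff.1 h1)

lemma IsSmall.mapsTo_halfSpace (hE : IsSmall n c E) (hc : c < 1) :
    MapsTo (fun x => x + E x) (halfSpace n) (halfSpace n) := by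
  intro x hx
  have hx' : 0 < x (Fin.last n) := hx
  have h := (abs_le.1 (hE.abs_last_le (halfSpace_subset_closedHalfSpace hx))).1
  change 0 < x (Fin.last n) + E x (Fin.last n)
  nlinarith

lemma IsSmall.mapsTo_closedHalfSpace (hE : IsSmall n c E) (hc : c < 1) :
    MapsTo (fun x => x + E x) (closedHalfSpace n) (closedHalfSpace n) := by
  intro x hx
  have hx' : 0 ≤ x (Fin.last n) := hx
  have h := (abs_le.1 (hE.abs_last_le hx)).1
  change 0 ≤ x (Fin.last n) + E x (Fin.last n)
  nlinarith

/-- The equation `y + E y = x` is solved by the contraction principle, on the strip of points whose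
height is at most twice that of `x`. -/
lemma IsSmall.surjOn (hE : IsSmall n c E) (hc0 : 0 ≤ c) (hc : c ≤ 1 / 2) :
    SurjOn (fun x => x + E x) (closedHalfSpace n) (closedHalfSpace n) := by
  intro x hx
  have hx' : 0 ≤ x (Fin.last n) := hx
  set s : Set (EuclideanSpace ℝ (Fin (n + 1))) :=
    closedHalfSpace n ∩ {y | y (Fin.last n) ≤ 2 * x (Fin.last n)} with hs
  have hsc : IsComplete s :=
    (isClosed_closedHalfSpace.inter (isClosed_le (by fun_prop) continuous_const)).isComplete
  have hmaps : MapsTo (fun y => x - E y) s s := by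
    intro y hy
    have hy2 : y (Fin.last n) ≤ 2 * x (Fin.last n) := hy.2
    have hy1 : 0 ≤ y (Fin.last n) := hy.1
    have h := abs_le.1 (hE.abs_last_le hy.1)
    have h3 : c * y (Fin.last n) ≤ x (Fin.last n) := by nlinarith
    constructor
    · change 0 ≤ x (Fin.last n) - E y (Fin.last n)
      linarith [h.2]
    · change x (Fin.last n) - E y (Fin.last n) ≤ 2 * x (Fin.last n)
      linarith [h.1]
  have hcon : ContractingWith (NNReal.mk c hc0) (hmaps.restrict _ s s) := by
    refine ⟨?_, LipschitzWith.of_dist_le_mul fun y z => ?_⟩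
    · have h1 : c < 1 := by linarith
      exact_mod_cast h1
    · have h := hE.lip y y.2.1 z z.2.1
      change dist (x - E y) (x - E z) ≤ c * dist (y : EuclideanSpace ℝ (Fin (n + 1))) z
      rw [dist_eq_norm, dist_eq_norm, sub_sub_sub_cancel_left, norm_sub_rev]
      exact h
  have hxs : x ∈ s := ⟨hx, by change x (Fin.last n) ≤ 2 * x (Fin.last n); linarith⟩
  obtain ⟨y, hy, hfix, -⟩ := hcon.exists_fixedPoint' hsc hmaps hxs (edist_ne_top _ _)
  refine ⟨y, hy.1, ?_⟩
  have : x - E y = y := hfix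
  exact (sub_eq_iff_eq_add.1 this).symm

lemma IsSmall.surjOn_halfSpace (hE : IsSmall n c E) (hc0 : 0 ≤ c) (hc : c ≤ 1 / 2) :
    SurjOn (fun x => x + E x) (halfSpace n) (halfSpace n) := by
  intro x hx
  obtain ⟨y, hy, hyx⟩ := hE.surjOn hc0 hc (halfSpace_subset_closedHalfSpace hx)
  refine ⟨y, ?_, hyx⟩
  rcases (show 0 ≤ y (Fin.last n) from hy).eq_or_lt with h | h
  · exfalso
    have h1 : (y + E y) (Fin.last n) = 0 := by
      rw [PiLp.add_apply, hE.last y h.symm, ← h, add_zero]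
    simp only at hyx
    rw [hyx] at h1
    exact (show 0 < x (Fin.last n) from hx).ne' h1
  · exact h

/-- The extension, homogeneous of degree one, of the restriction of `E` to the sphere of radius
`R`. -/
noncomputable def homogExt (R : ℝ)
    (E : EuclideanSpace ℝ (Fin (n + 1)) → EuclideanSpace ℝ (Fin (n + 1)))
    (y : EuclideanSpace ℝ (Fin (n + 1))) : EuclideanSpace ℝ (Fin (n + 1)) :=
  (‖y‖ / R) • E ((R / ‖y‖) • y)

lemma homogExt_smul (R : ℝ) {s : ℝ} (hs : 0 < s) (y : EuclideanSpace ℝ (Fin (n + 1))) :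
    homogExt R E (s • y) = s • homogExt R E y := by
  rw [homogExt, homogExt, norm_smul, Real.norm_of_nonneg hs.le, smul_smul, smul_smul]
  congr 1
  · ring
  · congr 2
    by_cases hy : ‖y‖ = 0
    · simp [hy]
    · field_simp

lemma homogExt_of_norm_eq {R : ℝ} (hR : 0 < R) {y : EuclideanSpace ℝ (Fin (n + 1))} (hy : ‖y‖ = R) :
    homogExt R E y = E y := by
  rw [homogExt, hy, div_self hR.ne', one_smul, one_smul]

lemma radial_mem {R : ℝ} (hR : 0 < R) {y : EuclideanSpace ℝ (Fin (n + 1))}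
    (hy : y ∈ closedHalfSpace n) :
    (R / ‖y‖) • y ∈ closedHalfSpace n ∩ Metric.closedBall 0 R := by
  refine ⟨smul_mem_closedHalfSpace hy (by positivity), ?_⟩
  rw [mem_closedBall_zero_iff, norm_smul, Real.norm_of_nonneg (by positivity)]
  by_cases h : ‖y‖ = 0
  · simp [h, hR.le]
  · rw [div_mul_cancel₀ _ h]

lemma norm_mul_norm_unit_sub_le (x y : EuclideanSpace ℝ (Fin (n + 1))) (hy : y ≠ 0) (hx : x ≠ 0) :
    ‖x‖ * ‖‖x‖⁻¹ • x - ‖y‖⁻¹ • y‖ ≤ 2 * ‖x - y‖ := by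
  have hxn : ‖x‖ ≠ 0 := norm_ne_zero_iff.2 hx
  have hyn : ‖y‖ ≠ 0 := norm_ne_zero_iff.2 hy
  have h1 : ‖x‖ • (‖x‖⁻¹ • x - ‖y‖⁻¹ • y) = (x - y) + ((‖y‖ - ‖x‖) * ‖y‖⁻¹) • y := by
    rw [smul_sub, smul_inv_smul₀ hxn, smul_smul, sub_mul, mul_inv_cancel₀ hyn, sub_smul, one_smul]
    abel
  have h2 : ‖x‖ * ‖‖x‖⁻¹ • x - ‖y‖⁻¹ • y‖ = ‖(x - y) + ((‖y‖ - ‖x‖) * ‖y‖⁻¹) • y‖ := by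
    rw [← h1, norm_smul, norm_norm]
  rw [h2]
  refine (norm_add_le _ _).trans ?_
  rw [norm_smul, norm_mul, norm_inv, norm_norm, mul_assoc, inv_mul_cancel₀ hyn, mul_one,
    Real.norm_eq_abs]
  have := abs_norm_sub_norm_le y x
  rw [norm_sub_rev] at this
  linarith

lemma isSmall_homogExt {R : ℝ} (hR : 0 < R) (hc0 : 0 ≤ c)
    (hlip : ∀ x ∈ closedHalfSpace n ∩ Metric.closedBall 0 R,
      ∀ y ∈ closedHalfSpace n ∩ Metric.closedBall 0 R, ‖E x - E y‖ ≤ c * ‖x - y‖)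
    (hbd : ∀ x ∈ closedHalfSpace n ∩ Metric.closedBall 0 R, ‖E x‖ ≤ c * R)
    (hlast : ∀ x ∈ hyperplane n, E x (Fin.last n) = 0) : IsSmall n (3 * c) (homogExt R E) where
  last x hx := by
    rw [homogExt, PiLp.smul_apply, hlast, smul_zero]
    change (R / ‖x‖) * x (Fin.last n) = 0
    rw [show x (Fin.last n) = 0 from hx, mul_zero]
  lip x hx y hy := by
    -- the division by `‖y‖` in `homogExt` needs the origin to be treated separately
    have hz : ∀ y ∈ closedHalfSpace n, ‖homogExt R E y‖ ≤ c * ‖y‖ := by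
      intro y hy
      rw [homogExt, norm_smul, Real.norm_of_nonneg (by positivity)]
      calc ‖y‖ / R * ‖E ((R / ‖y‖) • y)‖ ≤ ‖y‖ / R * (c * R) := by
            gcongr
            exact hbd _ (radial_mem hR hy)
        _ = c * ‖y‖ := by field_simp
    have hE0 : homogExt R E 0 = 0 := by simp [homogExt]
    by_cases hx0 : x = 0
    · rw [hx0, hE0, zero_sub, norm_neg, zero_sub, norm_neg]
      have := mul_nonneg hc0 (norm_nonneg y)
      linarith [hz y hy]
    by_cases hy0 : y = 0
    · rw [hy0, hE0, sub_zero, sub_zero]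
      have := mul_nonneg hc0 (norm_nonneg x)
      linarith [hz x hx]
    set u := (R / ‖x‖) • x with hu
    set v := (R / ‖y‖) • y with hv
    have h1 : homogExt R E x - homogExt R E y =
        (‖x‖ / R) • (E u - E v) + ((‖x‖ - ‖y‖) / R) • E v := by
      rw [homogExt, homogExt, ← hu, ← hv, sub_div, sub_smul, smul_sub]
      abel
    have h2 : ‖u - v‖ = R * ‖‖x‖⁻¹ • x - ‖y‖⁻¹ • y‖ := by
      rw [hu, hv, div_eq_mul_inv, div_eq_mul_inv, mul_smul, mul_smul, ← smul_sub, norm_smul,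
        Real.norm_of_nonneg hR.le]
    have h3 := norm_mul_norm_unit_sub_le x y hy0 hx0
    have h4 : ‖(‖x‖ / R) • (E u - E v)‖ ≤ 2 * c * ‖x - y‖ := by
      rw [norm_smul, Real.norm_of_nonneg (by positivity)]
      calc ‖x‖ / R * ‖E u - E v‖ ≤ ‖x‖ / R * (c * ‖u - v‖) := by
            gcongr
            exact hlip _ (radial_mem hR hx) _ (radial_mem hR hy)
        _ = c * (‖x‖ * ‖‖x‖⁻¹ • x - ‖y‖⁻¹ • y‖) := by
            rw [h2]
            field_simp
        _ ≤ c * (2 * ‖x - y‖) := by gcongr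
        _ = _ := by ring
    have h5 : ‖((‖x‖ - ‖y‖) / R) • E v‖ ≤ c * ‖x - y‖ := by
      rw [norm_smul, norm_div, Real.norm_of_nonneg hR.le, Real.norm_eq_abs]
      calc |‖x‖ - ‖y‖| / R * ‖E v‖ ≤ ‖x - y‖ / R * (c * R) := by
            gcongr
            · exact abs_norm_sub_norm_le x y
            · exact hbd _ (radial_mem hR hy)
        _ = _ := by field_simp
    rw [h1]
    refine (norm_add_le _ _).trans ?_
    linarith

/-- A small perturbation of the identity and its homogeneous extension from the sphere have the
same image of the half-ball: both complements are the image of the outside of the ball under the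
homogeneous extension, since the map obtained by gluing along the sphere is bijective. -/
lemma image_halfBall_homogExt {R : ℝ} (hR : 0 < R) (hc0 : 0 ≤ c) (hc : 3 * c ≤ 1 / 2)
    (hlip : ∀ x ∈ closedHalfSpace n ∩ Metric.closedBall 0 R,
      ∀ y ∈ closedHalfSpace n ∩ Metric.closedBall 0 R, ‖E x - E y‖ ≤ c * ‖x - y‖)
    (hbd : ∀ x ∈ closedHalfSpace n ∩ Metric.closedBall 0 R, ‖E x‖ ≤ c * R)
    (hlast : ∀ x ∈ hyperplane n, E x (Fin.last n) = 0) :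
    (fun x => x + E x) '' halfBall n R = (fun x => x + homogExt R E x) '' halfBall n R := by
  classical
  have hH := isSmall_homogExt hR hc0 hlip hbd hlast
  set g : EuclideanSpace ℝ (Fin (n + 1)) → EuclideanSpace ℝ (Fin (n + 1)) := fun x =>
    if ‖x‖ ≤ R then E x else homogExt R E x with hg
  have hgin : ∀ x, ‖x‖ ≤ R → g x = E x := fun x hx => if_pos hx
  have hgout : ∀ x, R ≤ ‖x‖ → g x = homogExt R E x := by
    intro x hx
    rcases hx.eq_or_lt with h | h
    · rw [hgin x h.ge, homogExt_of_norm_eq hR h.symm]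
    · exact if_neg (not_le.2 h)
  have hgs : IsSmall n (3 * c) g := by
    refine ⟨fun x hx y hy => ?_, fun x hx => ?_⟩
    · refine norm_sub_le_of_closed_cover (A := {x | ‖x‖ ≤ R}) (B := {x | R ≤ ‖x‖})
        (isClosed_le continuous_norm continuous_const) (isClosed_le continuous_const continuous_norm)
        ?_ convex_closedHalfSpace ?_ ?_ hx hy
      · ext x
        simp [le_total]
      · intro x hx y hy
        rw [hgin x hx.2, hgin y hy.2]
        refine (hlip x ⟨hx.1, mem_closedBall_zero_iff.2 hx.2⟩ y
          ⟨hy.1, mem_closedBall_zero_iff.2 hy.2⟩).trans ?_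
        have := mul_nonneg hc0 (norm_nonneg (x - y))
        linarith
      · intro x hx y hy
        rw [hgout x hx.2, hgout y hy.2]
        exact hH.lip x hx.1 y hy.1
    · by_cases h : ‖x‖ ≤ R
      · rw [hgin x h]
        exact hlast x hx
      · rw [hgout x (not_le.1 h).le]
        exact hH.last x hx
  have hc3 : 0 ≤ 3 * c := by positivity
  have hc1 : 3 * c < 1 := by linarith
  have hcompl : ∀ {F : EuclideanSpace ℝ (Fin (n + 1)) → EuclideanSpace ℝ (Fin (n + 1))},
      IsSmall n (3 * c) F → (fun x => x + F x) '' halfBall n R =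
        halfSpace n \ ((fun x => x + F x) '' (halfSpace n ∩ {x | R ≤ ‖x‖})) := by
    intro F hF
    have h1 : halfBall n R = halfSpace n \ (halfSpace n ∩ {x | R ≤ ‖x‖}) := by
      ext x
      simp only [halfBall, mem_inter_iff, mem_ball_zero_iff, Set.mem_sdiff, mem_ofPred_eq, not_and,
        not_le]
      tauto
    rw [h1, ((hF.injOn hc1).mono halfSpace_subset_closedHalfSpace).image_sdiff_subset
      inter_subset_left, ((hF.surjOn_halfSpace hc3 hc).image_eq_of_mapsTo (hF.mapsTo_halfSpace hc1))]
  have h1 : (fun x => x + E x) '' halfBall n R = (fun x => x + g x) '' halfBall n R := by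
    refine image_congr fun x hx => ?_
    rw [hgin x (mem_ball_zero_iff.1 hx.1).le]
  have h2 : (fun x => x + g x) '' (halfSpace n ∩ {x | R ≤ ‖x‖}) =
      (fun x => x + homogExt R E x) '' (halfSpace n ∩ {x | R ≤ ‖x‖}) := by
    refine image_congr fun x hx => ?_
    rw [hgout x hx.2]
  rw [h1, hcompl hgs, hcompl hH, h2]

end Perturbation

/-! ### Images of half-balls under variations are regions below radial graphs -/

section Variation

variable {n : ℕ}

/-- A continuous inverse of a `C^m` map with invertible derivatives is `C^m`, for maps of a set with
unique differentials, which need not be open. -/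
lemma contDiffOn_of_rightInverse {X : Type*} [NormedAddCommGroup X] [NormedSpace ℝ X]
    [CompleteSpace X] {D : Set X} (hD : UniqueDiffOn ℝ D) {Ψ Z : X → X} (hZc : ContinuousOn Z D)
    (hZD : MapsTo Z D D) (hZ : ∀ x ∈ D, Ψ (Z x) = x)
    (hinv : ∀ p ∈ D, ∃ e : X ≃L[ℝ] X, (e : X →L[ℝ] X) = fderivWithin ℝ Ψ D p) (m : ℕ)
    (hΨ : ContDiffOn ℝ m Ψ D) : ContDiffOn ℝ m Z D := by
  induction m with
  | zero =>
    rw [Nat.cast_zero, contDiffOn_zero]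
    exact hZc
  | succ m ih =>
    have hm : ((m + 1 : ℕ) : WithTop ℕ∞) = (m : WithTop ℕ∞) + 1 := by push_cast; rfl
    have hZm : ContDiffOn ℝ m Z D := ih (hΨ.of_le (by exact_mod_cast Nat.le_succ m))
    rw [hm] at hΨ ⊢
    have hΨ' := (contDiffOn_succ_iff_fderivWithin hD).1 hΨ
    rw [contDiffOn_succ_iff_hasFDerivWithinAt_of_uniqueDiffOn hD]
    refine ⟨fun h => absurd h (by simp),
      fun x => ContinuousLinearMap.inverse (fderivWithin ℝ Ψ D (Z x)), ?_, ?_⟩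
    · intro x hx
      obtain ⟨e, he⟩ := hinv (Z x) (hZD hx)
      have h1 := (hΨ'.2.2.comp hZm hZD) x hx
      have h2 : ContDiffAt ℝ m ContinuousLinearMap.inverse ((fderivWithin ℝ Ψ D ∘ Z) x) := by
        simp only [Function.comp]
        rw [← he]
        exact contDiffAt_map_inverse e
      exact h2.comp_contDiffWithinAt x h1
    · intro x hx
      obtain ⟨e, he⟩ := hinv (Z x) (hZD hx)
      have h1 : HasFDerivWithinAt Ψ (e : X →L[ℝ] X) D (Z x) := by
        rw [he]
        exact (hΨ'.1 _ (hZD hx)).hasFDerivWithinAt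
      simp only
      rw [← he, ContinuousLinearMap.inverse_equiv]
      refine HasFDerivWithinAt.of_local_left_inverse ?_ h1 hx ?_
      · exact tendsto_nhdsWithin_iff.2
          ⟨hZc x hx, eventually_nhdsWithin_of_forall fun y hy => hZD hy⟩
      · exact eventually_nhdsWithin_of_forall fun y hy => hZ y hy

lemma closedHalfSpace_subset_closure : closedHalfSpace n ⊆ closure (halfSpace n) := by
  intro x hx
  have hlim : Tendsto (fun s : ℝ => x + s • eLast n) (𝓝[>] 0) (𝓝 x) := by
    have h : Continuous fun s : ℝ => x + s • eLast n := by fun_prop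
    have h0 := (h.tendsto 0).mono_left (nhdsWithin_le_nhds (s := Ioi 0))
    simpa using h0
  refine mem_closure_of_tendsto hlim ?_
  filter_upwards [self_mem_nhdsWithin] with s hs
  have hs0 : (0 : ℝ) < s := hs
  have hx0 : 0 ≤ x (Fin.last n) := hx
  change 0 < (x + s • eLast n) (Fin.last n)
  simp
  linarith

lemma uniqueDiffOn_closedHalfSpace : UniqueDiffOn ℝ (closedHalfSpace n) := by
  refine uniqueDiffOn_convex convex_closedHalfSpace ⟨eLast n, ?_⟩
  refine interior_mono halfSpace_subset_closedHalfSpace ?_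
  rw [isOpen_halfSpace.interior_eq]
  simp [halfSpace]

lemma hasFDerivWithinAt_slice {X : Type*} [NormedAddCommGroup X] [NormedSpace ℝ X]
    {F : ℝ × EuclideanSpace ℝ (Fin (n + 1)) → X} {L : ℝ × EuclideanSpace ℝ (Fin (n + 1)) →L[ℝ] X}
    {I : Set ℝ} {K : Set (EuclideanSpace ℝ (Fin (n + 1)))} {t : ℝ} {x : EuclideanSpace ℝ (Fin (n + 1))}
    (hF : HasFDerivWithinAt F L (I ×ˢ K) (t, x)) (ht : t ∈ I) :
    HasFDerivWithinAt (fun y => F (t, y))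
      (L.comp (ContinuousLinearMap.inr ℝ ℝ (EuclideanSpace ℝ (Fin (n + 1))))) K x :=
  hF.comp x (hasFDerivAt_prodMk_right t x).hasFDerivWithinAt fun _ hy => ⟨ht, hy⟩

/-- For small `t`, the difference of `φ_t` and the identity is small with its first derivatives. -/
lemma IsVariation.exists_small {m : ℕ∞} (hm : 1 ≤ m) {ε : ℝ}
    {φ : ℝ → EuclideanSpace ℝ (Fin (n + 1)) → EuclideanSpace ℝ (Fin (n + 1))}
    (hφ : IsVariation m ε φ) {R : ℝ} (hR : 0 < R) {c : ℝ} (hc : 0 < c) :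
    ∃ δ, 0 < δ ∧ δ ≤ ε ∧ ∀ t ∈ Ioo (-δ) δ,
      (∀ x ∈ closedHalfSpace n ∩ Metric.closedBall 0 R,
        ∀ y ∈ closedHalfSpace n ∩ Metric.closedBall 0 R,
          ‖(φ t x - x) - (φ t y - y)‖ ≤ c * ‖x - y‖) ∧
      ∀ x ∈ closedHalfSpace n ∩ Metric.closedBall 0 R, ‖φ t x - x‖ ≤ c * R := by
  set S := Ioo (-ε) ε ×ˢ closedHalfSpace n with hS
  set F : ℝ × EuclideanSpace ℝ (Fin (n + 1)) → EuclideanSpace ℝ (Fin (n + 1)) :=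
    fun q => φ q.1 q.2 - q.2 with hF
  have h0 : (0 : ℝ) ∈ Ioo (-ε) ε := ⟨neg_lt_zero.2 hφ.pos, hφ.pos⟩
  have hm1 : (1 : WithTop ℕ∞) ≤ (m : WithTop ℕ∞) := by exact_mod_cast hm
  have hm0 : (m : WithTop ℕ∞) ≠ 0 := fun h => by rw [h] at hm1; exact absurd hm1 (by simp)
  have hSu : UniqueDiffOn ℝ S := isOpen_Ioo.uniqueDiffOn.prod uniqueDiffOn_closedHalfSpace
  have hFc : ContDiffOn ℝ m F S := hφ.contDiffOn.sub contDiff_snd.contDiffOn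
  have hzero : ∀ x ∈ closedHalfSpace n, F (0, x) = 0 := by
    have hcont : ContinuousOn (fun x => F (0, x)) (closedHalfSpace n) :=
      hFc.continuousOn.comp (by fun_prop) fun x hx => ⟨h0, hx⟩
    refine EqOn.of_subset_closure (s := halfSpace n) (g := fun _ => 0) ?_ hcont continuousOn_const
      halfSpace_subset_closedHalfSpace closedHalfSpace_subset_closure
    intro x hx
    simp [hF, hφ.zero x hx]
  have hder : ∀ t ∈ Ioo (-ε) ε, ∀ x ∈ closedHalfSpace n, HasFDerivWithinAt (fun y => F (t, y))
      ((fderivWithin ℝ F S (t, x)).comp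
        (ContinuousLinearMap.inr ℝ ℝ (EuclideanSpace ℝ (Fin (n + 1))))) (closedHalfSpace n) x :=
    fun t ht x hx => hasFDerivWithinAt_slice
      ((hFc.differentiableOn hm0) (t, x) ⟨ht, hx⟩).hasFDerivWithinAt ht
  -- at time `0` the difference vanishes identically, hence so does its spatial derivative, and by
  -- compactness both stay small for small times
  have hder0 : ∀ x ∈ closedHalfSpace n, (fderivWithin ℝ F S (0, x)).comp
      (ContinuousLinearMap.inr ℝ ℝ (EuclideanSpace ℝ (Fin (n + 1)))) = 0 := by
    intro x hx
    refine (uniqueDiffOn_closedHalfSpace x hx).eq (hder 0 h0 x hx) ?_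
    exact (hasFDerivWithinAt_const 0 x _).congr (fun y hy => hzero y hy) (hzero x hx)
  have hNc : ContinuousOn (fun q => ‖(fderivWithin ℝ F S q).comp
      (ContinuousLinearMap.inr ℝ ℝ (EuclideanSpace ℝ (Fin (n + 1))))‖) S :=
    ((hFc.continuousOn_fderivWithin hSu hm1).clm_comp continuousOn_const).norm
  have hK : IsCompact (closedHalfSpace n ∩ Metric.closedBall 0 R) :=
    (isCompact_closedBall 0 R).inter_left isClosed_closedHalfSpace
  have hev : ∀ᶠ t in 𝓝 (0 : ℝ), ∀ x ∈ closedHalfSpace n ∩ Metric.closedBall 0 R,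
      (t, x) ∈ S → ‖(fderivWithin ℝ F S (t, x)).comp
        (ContinuousLinearMap.inr ℝ ℝ (EuclideanSpace ℝ (Fin (n + 1))))‖ < c ∧ ‖F (t, x)‖ < c * R := by
    refine hK.eventually_forall_of_forall_eventually fun x hx => ?_
    have hxS : ((0 : ℝ), x) ∈ S := ⟨h0, hx.1⟩
    suffices hev : ∀ᶠ q in 𝓝[S] ((0 : ℝ), x), ‖(fderivWithin ℝ F S q).comp
        (ContinuousLinearMap.inr ℝ ℝ (EuclideanSpace ℝ (Fin (n + 1))))‖ < c ∧ ‖F q‖ < c * R from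
      eventually_nhdsWithin_iff.1 hev
    refine Filter.Eventually.and ?_ ?_
    · refine (hNc _ hxS).eventually_lt continuousWithinAt_const ?_
      simp only
      rw [hder0 x hx.1, norm_zero]
      exact hc
    · refine (hFc.continuousOn.norm _ hxS).eventually_lt continuousWithinAt_const ?_
      simp only
      rw [hzero x hx.1, norm_zero]
      positivity
  obtain ⟨δ₀, hδ₀, hball⟩ := Metric.eventually_nhds_iff.1 hev
  refine ⟨min δ₀ ε, lt_min hδ₀ hφ.pos, min_le_right _ _, fun t ht => ?_⟩
  have htε : t ∈ Ioo (-ε) ε :=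
    ⟨lt_of_le_of_lt (neg_le_neg (min_le_right _ _)) ht.1, ht.2.trans_le (min_le_right _ _)⟩
  have htδ : dist t 0 < δ₀ := by
    rw [Real.dist_eq, sub_zero, abs_lt]
    exact ⟨lt_of_le_of_lt (neg_le_neg (min_le_left _ _)) ht.1, ht.2.trans_le (min_le_left _ _)⟩
  have hb := hball htδ
  refine ⟨fun x hx y hy => ?_, fun x hx => (hb x hx ⟨htε, hx.1⟩).2.le⟩
  refine (convex_closedHalfSpace.inter (convex_closedBall 0 R)).norm_image_sub_le_of_norm_hasFDerivWithin_le
    (f := fun y => F (t, y)) (fun z hz => (hder t htε z hz.1).mono inter_subset_left)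
    (fun z hz => (hb z hz ⟨htε, hz.1⟩).1.le) hy hx

/-- A map of products over the identity of the parameter has invertible derivative if its slices
are uniformly antilipschitz. At boundary points half of the directions are available, which
suffices. -/
lemma exists_equiv_fderivWithin {δ c : ℝ} (hc : 0 < c)
    {Φ : ℝ → EuclideanSpace ℝ (Fin (n + 1)) → EuclideanSpace ℝ (Fin (n + 1))}
    {D : Set (ℝ × EuclideanSpace ℝ (Fin (n + 1)))} (hD : D = Ioo (-δ) δ ×ˢ (closedHalfSpace n \ {0}))
    (hDu : UniqueDiffOn ℝ D)
    (hΦ : DifferentiableOn ℝ (fun q : ℝ × EuclideanSpace ℝ (Fin (n + 1)) => (q.1, Φ q.1 q.2)) D)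
    (hanti : ∀ t ∈ Ioo (-δ) δ, ∀ x ∈ closedHalfSpace n, ∀ y ∈ closedHalfSpace n,
      c * ‖x - y‖ ≤ ‖Φ t x - Φ t y‖) {p : ℝ × EuclideanSpace ℝ (Fin (n + 1))} (hp : p ∈ D) :
    ∃ e : (ℝ × EuclideanSpace ℝ (Fin (n + 1))) ≃L[ℝ] (ℝ × EuclideanSpace ℝ (Fin (n + 1))),
      (e : (ℝ × EuclideanSpace ℝ (Fin (n + 1))) →L[ℝ] (ℝ × EuclideanSpace ℝ (Fin (n + 1)))) =
        fderivWithin ℝ (fun q : ℝ × EuclideanSpace ℝ (Fin (n + 1)) => (q.1, Φ q.1 q.2)) D p := by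
  set Ψ : ℝ × EuclideanSpace ℝ (Fin (n + 1)) → ℝ × EuclideanSpace ℝ (Fin (n + 1)) :=
    fun q => (q.1, Φ q.1 q.2) with hΨ
  set L := fderivWithin ℝ Ψ D p with hL
  have hLd : HasFDerivWithinAt Ψ L D p := (hΦ p hp).hasFDerivWithinAt
  have hfst : (ContinuousLinearMap.fst ℝ ℝ (EuclideanSpace ℝ (Fin (n + 1)))).comp L =
      ContinuousLinearMap.fst ℝ ℝ (EuclideanSpace ℝ (Fin (n + 1))) :=
    (hDu p hp).eq (hLd.fst) (hasFDerivWithinAt_fst)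
  obtain ⟨t, x⟩ := p
  have hp' : t ∈ Ioo (-δ) δ ∧ x ∈ closedHalfSpace n ∧ x ≠ 0 := by
    rw [hD] at hp
    exact ⟨hp.1, hp.2.1, hp.2.2⟩
  obtain ⟨ht, hx, hx0⟩ := hp'
  -- a direction `v` pointing into the half-space is tangent to an admissible curve, along which the
  -- antilipschitz bound passes to the derivative
  have hpos : ∀ v : EuclideanSpace ℝ (Fin (n + 1)), v ∈ closedHalfSpace n → L (0, v) = 0 → v = 0 := by
    intro v hv hLv
    set A : Set ℝ := {s | 0 ≤ s ∧ x + s • v ≠ 0} with hA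
    have hcurve : HasDerivWithinAt (fun s : ℝ => ((t, x + s • v) : ℝ × EuclideanSpace ℝ (Fin (n + 1))))
        (0, v) A 0 := by
      have h1 : HasDerivAt (fun s : ℝ => x + s • v) v 0 := by
        simpa using ((hasDerivAt_id (0 : ℝ)).smul_const v).const_add x
      exact ((hasDerivAt_const (0 : ℝ) t).prodMk h1).hasDerivWithinAt
    have hcone : ∀ s : ℝ, 0 ≤ s → x + s • v ∈ closedHalfSpace n := by
      intro s hs
      have hv' : 0 ≤ v (Fin.last n) := hv
      have hx' : 0 ≤ x (Fin.last n) := hx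
      change 0 ≤ x (Fin.last n) + s * v (Fin.last n)
      positivity
    have hmaps : MapsTo (fun s : ℝ => ((t, x + s • v) : ℝ × EuclideanSpace ℝ (Fin (n + 1)))) A D := by
      intro s hs
      rw [hD]
      exact ⟨ht, hcone s hs.1, hs.2⟩
    have hA' : 𝓝[>] (0 : ℝ) ≤ 𝓝[A \ {0}] 0 := by
      refine nhdsWithin_le_iff.2 ?_
      have h1 : ContinuousAt (fun s : ℝ => x + s • v) 0 := by fun_prop
      have h2 : ∀ᶠ s in 𝓝 (0 : ℝ), x + s • v ≠ 0 := h1.eventually_ne (by simpa using hx0)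
      filter_upwards [nhdsWithin_le_nhds h2, self_mem_nhdsWithin] with s hs hs0
      exact ⟨⟨le_of_lt hs0, hs⟩, ne_of_gt hs0⟩
    have hLd' : HasFDerivWithinAt Ψ L D (t, x + (0 : ℝ) • v) := by simpa using hLd
    have hslope := (hasDerivWithinAt_iff_tendsto_slope.1
      (hLd'.comp_hasDerivWithinAt (0 : ℝ) hcurve hmaps)).mono_left hA'
    rw [hLv] at hslope
    have hle : c * ‖v‖ ≤ 0 := by
      have hn := hslope.norm
      rw [norm_zero] at hn
      refine ge_of_tendsto hn ?_
      filter_upwards [self_mem_nhdsWithin] with s hs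
      have hs0 : (0 : ℝ) < s := hs
      rw [slope_def_module, sub_zero, norm_smul, norm_inv, Real.norm_of_nonneg hs0.le,
        le_inv_mul_iff₀ hs0]
      have h3 := hanti t ht _ (hcone s hs0.le) x hx
      rw [add_sub_cancel_left, norm_smul, Real.norm_of_nonneg hs0.le] at h3
      have h4 := norm_snd_le (Ψ (t, x + s • v) - Ψ (t, x))
      simp only [Function.comp, zero_smul, add_zero]
      refine le_trans (le_of_eq (by ring)) (h3.trans h4)
    have hv0 : ‖v‖ ≤ 0 := by
      by_contra! hcon
      exact absurd hle (not_le.2 (mul_pos hc hcon))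
    exact norm_le_zero_iff.1 hv0
  have hinj : Function.Injective L := by
    refine (injective_iff_map_eq_zero L).2 fun w hw => ?_
    obtain ⟨τ, v⟩ := w
    have hτ : τ = 0 := by
      have := congrArg (fun l => l (τ, v)) hfst
      simp only [ContinuousLinearMap.comp_apply, hw] at this
      simpa using this.symm
    subst hτ
    have hv : v = 0 := by
      rcases le_total 0 (v (Fin.last n)) with h | h
      · exact hpos v h hw
      · have h1 : L (0, -v) = 0 := by
          have : ((0 : ℝ), -v) = -((0 : ℝ), v) := by simp
          rw [this, map_neg, hw, neg_zero]
        have h2 : -v ∈ closedHalfSpace n := by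
          change 0 ≤ -(v (Fin.last n))
          linarith
        exact neg_eq_zero.1 (hpos (-v) h2 h1)
    rw [hv]
    rfl
  refine ⟨(LinearEquiv.ofInjectiveEndo (L : _ →ₗ[ℝ] _) hinj).toContinuousLinearEquiv, ?_⟩
  ext w <;> rfl

end Variation

section VariationGraph

variable {n : ℕ}

/-- For small `t`, a variation maps the half-ball onto the region below the graph
`‖x‖ = exp (W t x)` of a function homogeneous of degree `0` which is jointly `C^m` up to the
hyperplane. The variation is replaced by its homogeneous extension `Φ_t` from the sphere, and
`W t x = log R + log ‖x‖ - log ‖Φ_t⁻¹ x‖`. -/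
theorem IsVariation.exists_radial_param {m : ℕ} (hm : 1 ≤ m) {ε : ℝ}
    {φ : ℝ → EuclideanSpace ℝ (Fin (n + 1)) → EuclideanSpace ℝ (Fin (n + 1))}
    (hφ : IsVariation (m : ℕ∞) ε φ) {R : ℝ} (hR : 0 < R) :
    ∃ δ, 0 < δ ∧ ∃ W : ℝ → EuclideanSpace ℝ (Fin (n + 1)) → ℝ,
      ContDiffOn ℝ m (fun q : ℝ × EuclideanSpace ℝ (Fin (n + 1)) => W q.1 q.2)
        (Ioo (-δ) δ ×ˢ (closedHalfSpace n \ {0})) ∧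
      (∀ t ∈ Ioo (-δ) δ, IsHomog (W t)) ∧
      (∀ t ∈ Ioo (-δ) δ, φ t '' halfBall n R = {x | x ∈ halfSpace n ∧ ‖x‖ < Real.exp (W t x)}) ∧
      ∀ x ∈ halfSpace n, W 0 x = Real.log R := by
  obtain ⟨δ, hδ, hδε, hsmall⟩ := hφ.exists_small (by exact_mod_cast hm) hR
    (c := 1 / 8) (by norm_num)
  set H : ℝ → EuclideanSpace ℝ (Fin (n + 1)) → EuclideanSpace ℝ (Fin (n + 1)) := fun t =>
    homogExt R fun x => φ t x - x with hH
  set Φ : ℝ → EuclideanSpace ℝ (Fin (n + 1)) → EuclideanSpace ℝ (Fin (n + 1)) := fun t y =>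
    y + H t y with hΦ
  have hIoo : ∀ t ∈ Ioo (-δ) δ, t ∈ Ioo (-ε) ε := fun t ht =>
    ⟨lt_of_le_of_lt (neg_le_neg hδε) ht.1, ht.2.trans_le hδε⟩
  have hlast : ∀ t ∈ Ioo (-δ) δ, ∀ x ∈ hyperplane n, (φ t x - x) (Fin.last n) = 0 := by
    intro t ht x hx
    have h1 : φ t x (Fin.last n) = 0 := hφ.mapsTo_hyperplane t (hIoo t ht) hx
    rw [PiLp.sub_apply, h1, show x (Fin.last n) = 0 from hx, sub_zero]
  have hS : ∀ t ∈ Ioo (-δ) δ, IsSmall n (3 * (1 / 8)) (H t) := fun t ht =>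
    isSmall_homogExt hR (by norm_num) (hsmall t ht).1 (hsmall t ht).2 (hlast t ht)
  have hΦ0 : ∀ t, Φ t 0 = 0 := by
    intro t
    simp [hΦ, hH, homogExt]
  have hinj : ∀ t ∈ Ioo (-δ) δ, InjOn (Φ t) (closedHalfSpace n) := fun t ht =>
    (hS t ht).injOn (by norm_num)
  have hsurj : ∀ t ∈ Ioo (-δ) δ, SurjOn (Φ t) (closedHalfSpace n) (closedHalfSpace n) := fun t ht =>
    (hS t ht).surjOn (by norm_num) (by norm_num)
  have hΦmaps : ∀ t ∈ Ioo (-δ) δ, MapsTo (Φ t) (closedHalfSpace n) (closedHalfSpace n) :=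
    fun t ht => (hS t ht).mapsTo_closedHalfSpace (by norm_num)
  have hΦsmul : ∀ t, ∀ s : ℝ, 0 < s → ∀ y, Φ t (s • y) = s • Φ t y := by
    intro t s hs y
    simp only [hΦ, hH]
    rw [homogExt_smul R hs, smul_add]
  have h0mem : (0 : EuclideanSpace ℝ (Fin (n + 1))) ∈ closedHalfSpace n :=
    show (0 : ℝ) ≤ (0 : EuclideanSpace ℝ (Fin (n + 1))) (Fin.last n) from le_rfl
  set Y : ℝ → EuclideanSpace ℝ (Fin (n + 1)) → EuclideanSpace ℝ (Fin (n + 1)) := fun t =>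
    Function.invFunOn (Φ t) (closedHalfSpace n) with hY
  have hYmem : ∀ t ∈ Ioo (-δ) δ, ∀ x ∈ closedHalfSpace n, Y t x ∈ closedHalfSpace n :=
    fun t ht x hx => Function.invFunOn_mem (hsurj t ht hx)
  have hΦY : ∀ t ∈ Ioo (-δ) δ, ∀ x ∈ closedHalfSpace n, Φ t (Y t x) = x :=
    fun t ht x hx => Function.invFunOn_eq (hsurj t ht hx)
  have hYΦ : ∀ t ∈ Ioo (-δ) δ, ∀ y ∈ closedHalfSpace n, Y t (Φ t y) = y := fun t ht y hy =>
    hinj t ht (hYmem t ht _ (hΦmaps t ht hy)) hy (hΦY t ht _ (hΦmaps t ht hy))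
  have hY0 : ∀ t ∈ Ioo (-δ) δ, ∀ x ∈ closedHalfSpace n, x ≠ 0 → Y t x ≠ 0 := by
    intro t ht x hx hx0 hcon
    have := hΦY t ht x hx
    rw [hcon, hΦ0] at this
    exact hx0 this.symm
  have hYsmul : ∀ t ∈ Ioo (-δ) δ, ∀ x ∈ closedHalfSpace n, ∀ s : ℝ, 0 < s →
      Y t (s • x) = s • Y t x := by
    intro t ht x hx s hs
    have h1 : s • x = Φ t (s • Y t x) := by rw [hΦsmul t s hs, hΦY t ht x hx]
    rw [h1, hYΦ t ht _ (smul_mem_closedHalfSpace (hYmem t ht x hx) hs.le)]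
  -- regularity of the inverse
  set D : Set (ℝ × EuclideanSpace ℝ (Fin (n + 1))) := Ioo (-δ) δ ×ˢ (closedHalfSpace n \ {0}) with hD
  have hDu : UniqueDiffOn ℝ D :=
    isOpen_Ioo.uniqueDiffOn.prod (uniqueDiffOn_closedHalfSpace.inter isOpen_compl_singleton)
  have hne : ∀ q ∈ D, q.2 ≠ 0 := fun q hq => hq.2.2
  have hnorm : ContDiffOn ℝ m (fun q : ℝ × EuclideanSpace ℝ (Fin (n + 1)) => ‖q.2‖) D :=
    contDiff_snd.contDiffOn.norm ℝ hne
  have hradial : ContDiffOn ℝ m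
      (fun q : ℝ × EuclideanSpace ℝ (Fin (n + 1)) => (R / ‖q.2‖) • q.2) D :=
    (contDiffOn_const.div hnorm fun q hq => norm_ne_zero_iff.2 (hne q hq)).smul
      contDiff_snd.contDiffOn
  have hΦd : ContDiffOn ℝ m (fun q : ℝ × EuclideanSpace ℝ (Fin (n + 1)) => Φ q.1 q.2) D := by
    have h1 : ContDiffOn ℝ m (fun q : ℝ × EuclideanSpace ℝ (Fin (n + 1)) =>
        φ q.1 ((R / ‖q.2‖) • q.2)) D := by
      refine ContDiffOn.comp (t := Ioo (-ε) ε ×ˢ closedHalfSpace n) (by exact_mod_cast hφ.contDiffOn)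
        (contDiff_fst.contDiffOn.prodMk hradial) ?_
      intro q hq
      exact ⟨hIoo _ hq.1, smul_mem_closedHalfSpace hq.2.1 (by positivity)⟩
    simp only [hΦ, hH, homogExt]
    exact contDiff_snd.contDiffOn.add ((hnorm.div_const R).smul (h1.sub hradial))
  -- adjoining the time parameter gives a map of `D` to itself with inverse `Z` below
  set Ψ : ℝ × EuclideanSpace ℝ (Fin (n + 1)) → ℝ × EuclideanSpace ℝ (Fin (n + 1)) :=
    fun q => (q.1, Φ q.1 q.2) with hΨ
  have hΨd : ContDiffOn ℝ m Ψ D := contDiff_fst.contDiffOn.prodMk hΦd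
  have hanti : ∀ t ∈ Ioo (-δ) δ, ∀ x ∈ closedHalfSpace n, ∀ y ∈ closedHalfSpace n,
      (1 - 3 * (1 / 8)) * ‖x - y‖ ≤ ‖Φ t x - Φ t y‖ := fun t ht x hx y hy =>
    (hS t ht).antilipschitz hx hy
  -- `‖Y t x - Y t₀ x₀‖` is controlled by `‖x - Φ t (Y t₀ x₀)‖` through the antilipschitz bound
  have hYc : ContinuousOn (fun q : ℝ × EuclideanSpace ℝ (Fin (n + 1)) => Y q.1 q.2) D := by
    rintro ⟨t₀, x₀⟩ hq₀
    have hy₀ := hYmem t₀ hq₀.1 x₀ hq₀.2.1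
    have hy₀0 := hY0 t₀ hq₀.1 x₀ hq₀.2.1 hq₀.2.2
    have hlim : Tendsto (fun q : ℝ × EuclideanSpace ℝ (Fin (n + 1)) =>
        (1 - 3 * (1 / 8) : ℝ)⁻¹ * ‖q.2 - Φ q.1 (Y t₀ x₀)‖) (𝓝[D] (t₀, x₀)) (𝓝 0) := by
      have h1 : Tendsto (fun q : ℝ × EuclideanSpace ℝ (Fin (n + 1)) => (q.1, Y t₀ x₀))
          (𝓝[D] (t₀, x₀)) (𝓝[D] (t₀, Y t₀ x₀)) := by
        refine tendsto_nhdsWithin_iff.2 ⟨?_, eventually_nhdsWithin_of_forall fun q hq =>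
          ⟨hq.1, hy₀, hy₀0⟩⟩
        exact ((continuous_fst.prodMk continuous_const).tendsto' _ _ rfl).mono_left
          nhdsWithin_le_nhds
      have h2 := (hΦd.continuousOn (t₀, Y t₀ x₀) ⟨hq₀.1, hy₀, hy₀0⟩).tendsto.comp h1
      have h3 := (((continuous_snd.tendsto (t₀, x₀)).mono_left
        (nhdsWithin_le_nhds (s := D))).sub h2).norm.const_mul (1 - 3 * (1 / 8) : ℝ)⁻¹
      have h4 : (1 - 3 * (1 / 8) : ℝ)⁻¹ * ‖x₀ - Φ t₀ (Y t₀ x₀)‖ = 0 := by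
        rw [hΦY t₀ hq₀.1 x₀ hq₀.2.1, sub_self, norm_zero, mul_zero]
      simp only at h3
      rwa [h4] at h3
    refine tendsto_iff_norm_sub_tendsto_zero.2 (squeeze_zero' (Eventually.of_forall fun _ =>
      norm_nonneg _) ?_ hlim)
    filter_upwards [self_mem_nhdsWithin] with q hq
    have h6 := hanti q.1 hq.1 _ (hYmem q.1 hq.1 q.2 hq.2.1) _ hy₀
    rw [hΦY q.1 hq.1 q.2 hq.2.1] at h6
    rwa [le_inv_mul_iff₀ (by norm_num)]
  set Z : ℝ × EuclideanSpace ℝ (Fin (n + 1)) → ℝ × EuclideanSpace ℝ (Fin (n + 1)) :=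
    fun q => (q.1, Y q.1 q.2) with hZ
  have hZd : ContDiffOn ℝ m Z D := by
    refine contDiffOn_of_rightInverse hDu (Ψ := Ψ) (continuousOn_fst.prodMk hYc) ?_ ?_ ?_ m hΨd
    · intro q hq
      exact ⟨hq.1, hYmem _ hq.1 _ hq.2.1, hY0 _ hq.1 _ hq.2.1 hq.2.2⟩
    · intro q hq
      simp only [hΨ, hΦY _ hq.1 _ hq.2.1]
    · intro p hp
      exact exists_equiv_fderivWithin (by norm_num) hD hDu
        (hΨd.differentiableOn (by exact_mod_cast (by omega : m ≠ 0))) hanti hp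
  have hYd : ContDiffOn ℝ m (fun q : ℝ × EuclideanSpace ℝ (Fin (n + 1)) => Y q.1 q.2) D :=
    contDiff_snd.comp_contDiffOn hZd
  have hYne : ∀ q ∈ D, Y q.1 q.2 ≠ 0 := fun q hq => hY0 _ hq.1 _ hq.2.1 hq.2.2
  have hUne : ∀ x ∈ halfSpace n, x ≠ 0 := by
    rintro x hx rfl
    exact lt_irrefl _ (show (0 : ℝ) < (0 : EuclideanSpace ℝ (Fin (n + 1))) (Fin.last n) from hx)
  refine ⟨δ, hδ, fun t x => Real.log R + Real.log ‖x‖ - Real.log ‖Y t x‖, ?_, ?_, ?_, ?_⟩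
  · exact (contDiffOn_const.add (hnorm.log fun q hq => norm_ne_zero_iff.2 (hne q hq))).sub
      ((hYd.norm ℝ hYne).log fun q hq => norm_ne_zero_iff.2 (hYne q hq))
  · intro t ht x hx s hs
    have hx' := halfSpace_subset_closedHalfSpace hx
    have h1 : ‖x‖ ≠ 0 := norm_ne_zero_iff.2 (hUne x hx)
    have h2 : ‖Y t x‖ ≠ 0 := norm_ne_zero_iff.2 (hY0 t ht x hx' (hUne x hx))
    simp only
    rw [hYsmul t ht x hx' s hs, norm_smul, norm_smul, Real.norm_of_nonneg hs.le,
      Real.log_mul hs.ne' h1, Real.log_mul hs.ne' h2]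
    ring
  · intro t ht
    have h1 : φ t '' halfBall n R = (fun x => x + (φ t x - x)) '' halfBall n R := by
      simp
    rw [h1, image_halfBall_homogExt (c := 1 / 8) hR (by norm_num) (by norm_num) (hsmall t ht).1
      (hsmall t ht).2 (hlast t ht)]
    have hiff : ∀ x ∈ halfSpace n,
        (‖x‖ < Real.exp (Real.log R + Real.log ‖x‖ - Real.log ‖Y t x‖) ↔ ‖Y t x‖ < R) := by
      intro x hx
      have hx0 : 0 < ‖x‖ := norm_pos_iff.2 (hUne x hx)
      have hy0 : 0 < ‖Y t x‖ :=
        norm_pos_iff.2 (hY0 t ht x (halfSpace_subset_closedHalfSpace hx) (hUne x hx))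
      rw [Real.exp_sub, Real.exp_add, Real.exp_log hR, Real.exp_log hx0, Real.exp_log hy0,
        lt_div_iff₀ hy0, mul_comm, mul_lt_mul_iff_of_pos_right hx0]
    ext x
    constructor
    · rintro ⟨y, hy, rfl⟩
      have hyU : y ∈ halfSpace n := hy.2
      have hxU : Φ t y ∈ halfSpace n := (hS t ht).mapsTo_halfSpace (by norm_num) hyU
      refine ⟨hxU, (hiff _ hxU).2 ?_⟩
      have h2 := hYΦ t ht y (halfSpace_subset_closedHalfSpace hyU)
      change ‖Y t (Φ t y)‖ < R
      rw [h2]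
      exact mem_ball_zero_iff.1 hy.1
    · rintro ⟨hxU, hx⟩
      have h2 := (hiff x hxU).1 hx
      obtain ⟨y, hyU, hyx⟩ := (hS t ht).surjOn_halfSpace (by norm_num) (by norm_num) hxU
      have hyx' : Φ t y = x := hyx
      refine ⟨y, ⟨mem_ball_zero_iff.2 ?_, hyU⟩, hyx⟩
      rwa [← hyx', hYΦ t ht y (halfSpace_subset_closedHalfSpace hyU)] at h2
  · intro x hx
    have ht : (0 : ℝ) ∈ Ioo (-δ) δ := ⟨neg_lt_zero.2 hδ, hδ⟩
    have hx' := halfSpace_subset_closedHalfSpace hx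
    have h1 : Φ 0 x = x := by
      have hU : (R / ‖x‖) • x ∈ halfSpace n :=
        smul_mem_halfSpace hx (div_pos hR (norm_pos_iff.2 (hUne x hx)))
      simp only [hΦ, hH, homogExt]
      rw [hφ.zero _ hU, sub_self, smul_zero, add_zero]
    have h2 : Y 0 x = x := by
      have := hYΦ 0 ht x hx'
      rwa [h1] at this
    simp only
    rw [h2]
    ring

end VariationGraph

/-! ### Perimeter and measure of the region below a radial graph -/

section RadialRegion

variable {n : ℕ}

lemma ne_zero_of_mem_halfSpace {x : EuclideanSpace ℝ (Fin (n + 1))} (hx : x ∈ halfSpace n) :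
    x ≠ 0 := by
  rintro rfl
  exact lt_irrefl _ (show (0 : ℝ) < (0 : EuclideanSpace ℝ (Fin (n + 1))) (Fin.last n) from hx)

variable {W : EuclideanSpace ℝ (Fin (n + 1)) → ℝ}
  {G : EuclideanSpace ℝ (Fin (n + 1)) → EuclideanSpace ℝ (Fin (n + 1))}

lemma isOpen_radialRegion (hW : ContinuousOn W (halfSpace n)) :
    IsOpen {x | x ∈ halfSpace n ∧ ‖x‖ < Real.exp (W x)} := by
  have h : ContinuousOn (fun x => Real.exp (W x) - ‖x‖) (halfSpace n) :=
    hW.rexp.sub continuous_norm.continuousOn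
  have h2 := h.isOpen_inter_preimage isOpen_halfSpace (isOpen_Ioi (a := (0 : ℝ)))
  convert! h2 using 1
  ext x
  simp [sub_pos]

lemma essBoundary_radialRegion (hW : IsHomog W)
    (hG : ∀ x ∈ halfSpace n, HasStrictFDerivAt W (innerSL ℝ (G x)) x) :
    essBoundary {x | x ∈ halfSpace n ∧ ‖x‖ < Real.exp (W x)} ∩ halfSpace n =
      {x | x ∈ halfSpace n ∧ ‖x‖ = Real.exp (W x)} := by
  set S := {x | x ∈ halfSpace n ∧ ‖x‖ < Real.exp (W x)} with hS
  have hWc : ∀ x ∈ halfSpace n, ContinuousAt W x := fun x hx => (hG x hx).continuousAt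
  have hSo : IsOpen S := isOpen_radialRegion fun x hx => (hWc x hx).continuousWithinAt
  ext x
  constructor
  · rintro ⟨hxb, hxU⟩
    refine ⟨hxU, ?_⟩
    have hf := essBoundary_subset_frontier hxb
    rw [hSo.frontier_eq] at hf
    refine le_antisymm ?_ (not_lt.1 fun h => hf.2 ⟨hxU, h⟩)
    by_contra! hlt
    have hev : ∀ᶠ y in 𝓝 x, Real.exp (W y) < ‖y‖ :=
      ((hWc x hxU).rexp).eventually_lt continuous_norm.continuousAt hlt
    obtain ⟨y, hy, hyS⟩ := mem_closure_iff_nhds.1 hf.1 _ hev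
    exact absurd hyS.2 (not_lt.2 (le_of_lt hy))
  · rintro ⟨hxU, hx⟩
    refine ⟨?_, hxU⟩
    have hx0 := ne_zero_of_mem_halfSpace hxU
    have hFd : DifferentiableAt ℝ (fun y => ‖y‖ - Real.exp (W y)) x :=
      ((contDiffAt_norm (n := 1) ℝ hx0).differentiableAt one_ne_zero).sub
        (hG x hxU).differentiableAt.exp
    refine mem_essBoundary_of_hasFDerivAt hFd.hasFDerivAt ?_ (by simp [hx]) ?_
    · -- along rays `W` is constant, so the radial derivative is `‖x‖`
      intro hL
      have h1 : HasDerivAt (fun s : ℝ => s • x) x 1 := by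
        simpa using (hasDerivAt_id (1 : ℝ)).smul_const x
      have hFd' : HasFDerivAt (fun y => ‖y‖ - Real.exp (W y)) (0 : _ →L[ℝ] ℝ) ((1 : ℝ) • x) := by
        rw [one_smul, ← hL]
        exact hFd.hasFDerivAt
      have h2 := hFd'.comp_hasDerivAt (1 : ℝ) h1
      have h3 : HasDerivAt (fun s : ℝ => s * ‖x‖ - Real.exp (W x)) ‖x‖ 1 := by
        simpa using ((hasDerivAt_id (1 : ℝ)).mul_const ‖x‖).sub_const (Real.exp (W x))
      have h4 : (fun s : ℝ => s * ‖x‖ - Real.exp (W x)) =ᶠ[𝓝 1]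
          (fun y => ‖y‖ - Real.exp (W y)) ∘ fun s : ℝ => s • x := by
        filter_upwards [lt_mem_nhds one_pos] with s hs
        simp only [Function.comp]
        rw [hW x hxU s hs, norm_smul, Real.norm_of_nonneg (le_of_lt hs)]
      have h5 := (h2.congr_of_eventuallyEq h4).unique h3
      exact norm_ne_zero_iff.2 hx0 (by simpa using h5.symm)
    · filter_upwards [isOpen_halfSpace.mem_nhds hxU] with y hy
      exact ⟨fun h => ⟨hy, by linarith⟩, fun h h' => by linarith [h'.2]⟩

lemma wPerimeter_radialRegion (k α : ℝ) (hW : IsHomog W)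
    (hG : ∀ x ∈ halfSpace n, HasStrictFDerivAt W (innerSL ℝ (G x)) x)
    (hGm : Measurable fun z : EuclideanSpace ℝ (Fin n) => G (dir z)) :
    wPerimeter k α {x | x ∈ halfSpace n ∧ ‖x‖ < Real.exp (W x)} =
      ∫⁻ z, ENNReal.ofReal (Real.exp ((k + n + α) * W (dir z)) * √(1 + ‖G (dir z)‖ ^ 2))
        ∂(sphereMeasure n α) := by
  rw [wPerimeter, essBoundary_radialRegion hW hG, lintegral_radial_graph k α hW hG hGm]

end RadialRegion

/-! ### Regularity of a family of radial graphs up to the hyperplane -/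

section Family

variable {n : ℕ}

/-- The domain of the parametrizations of the radial graphs: small times and the closed half-space
without the origin. -/
def paramDomain (n : ℕ) (δ : ℝ) : Set (ℝ × EuclideanSpace ℝ (Fin (n + 1))) :=
  Ioo (-δ) δ ×ˢ (closedHalfSpace n \ {0})

variable {δ : ℝ}

lemma uniqueDiffOn_paramDomain : UniqueDiffOn ℝ (paramDomain n δ) :=
  isOpen_Ioo.uniqueDiffOn.prod (uniqueDiffOn_closedHalfSpace.inter isOpen_compl_singleton)

lemma mem_paramDomain {t : ℝ} (ht : t ∈ Ioo (-δ) δ) {x : EuclideanSpace ℝ (Fin (n + 1))}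
    (hx : x ∈ halfSpace n) : (t, x) ∈ paramDomain n δ :=
  ⟨ht, halfSpace_subset_closedHalfSpace hx, ne_zero_of_mem_halfSpace hx⟩

lemma paramDomain_mem_nhds {t : ℝ} (ht : t ∈ Ioo (-δ) δ) {x : EuclideanSpace ℝ (Fin (n + 1))}
    (hx : x ∈ halfSpace n) : paramDomain n δ ∈ 𝓝 (t, x) := by
  refine Filter.mem_of_superset ((isOpen_Ioo.prod isOpen_halfSpace).mem_nhds ⟨ht, hx⟩) ?_
  rintro ⟨s, y⟩ ⟨hs, hy⟩
  exact mem_paramDomain hs hy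

variable {X : Type*} [NormedAddCommGroup X]

lemma continuous_comp_dir {f : ℝ × EuclideanSpace ℝ (Fin (n + 1)) → X}
    (hf : ContinuousOn f (paramDomain n δ)) {t : ℝ} (ht : t ∈ Ioo (-δ) δ) :
    Continuous fun z : EuclideanSpace ℝ (Fin n) => f (t, dir z) :=
  hf.comp_continuous (continuous_const.prodMk continuous_dir)
    fun z => mem_paramDomain ht (dir_mem_halfSpace z)

/-- Functions that are continuous up to the hyperplane are bounded on the hemisphere. -/
lemma exists_bound_comp_dir (hδ : 0 < δ) {f : ℝ × EuclideanSpace ℝ (Fin (n + 1)) → X}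
    (hf : ContinuousOn f (paramDomain n δ)) :
    ∃ C, 0 ≤ C ∧ ∀ t ∈ Ioo (-(δ / 2)) (δ / 2), ∀ z : EuclideanSpace ℝ (Fin n),
      ‖f (t, dir z)‖ ≤ C := by
  have hK : IsCompact (Icc (-(δ / 2)) (δ / 2) ×ˢ
      (closedHalfSpace n ∩ Metric.sphere (0 : EuclideanSpace ℝ (Fin (n + 1))) 1)) :=
    isCompact_Icc.prod ((isCompact_sphere 0 1).inter_left isClosed_closedHalfSpace)
  have hsub : Icc (-(δ / 2)) (δ / 2) ×ˢ
      (closedHalfSpace n ∩ Metric.sphere (0 : EuclideanSpace ℝ (Fin (n + 1))) 1) ⊆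
        paramDomain n δ := by
    rintro ⟨t, x⟩ ⟨ht, hx, hx1⟩
    refine ⟨⟨by linarith [ht.1], by linarith [ht.2]⟩, hx, ?_⟩
    rintro rfl
    simp at hx1
  obtain ⟨C, hC⟩ := hK.exists_bound_of_continuousOn (hf.mono hsub)
  refine ⟨max C 0, le_max_right _ _, fun t ht z => (hC (t, dir z) ⟨Ioo_subset_Icc_self ht,
    halfSpace_subset_closedHalfSpace (dir_mem_halfSpace z), ?_⟩).trans (le_max_left _ _)⟩
  rw [mem_sphere_zero_iff_norm, norm_dir]

lemma half_mem_Ioo {t : ℝ} (ht : t ∈ Ioo (-(δ / 2)) (δ / 2)) : t ∈ Ioo (-δ) δ := by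
  have h1 := ht.1
  have h2 := ht.2
  constructor <;> linarith

lemma integrable_comp_dir {α : ℝ} (hα : -1 < α) (hδ : 0 < δ)
    {f : ℝ × EuclideanSpace ℝ (Fin (n + 1)) → ℝ} (hf : ContinuousOn f (paramDomain n δ)) {t : ℝ}
    (ht : t ∈ Ioo (-(δ / 2)) (δ / 2)) :
    Integrable (fun z : EuclideanSpace ℝ (Fin n) => f (t, dir z)) (sphereMeasure n α) := by
  have := isFiniteMeasure_sphereMeasure (n := n) hα
  obtain ⟨C, -, hC⟩ := exists_bound_comp_dir hδ hf
  exact Integrable.of_bound (continuous_comp_dir hf (half_mem_Ioo ht)).aestronglyMeasurable C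
    (Eventually.of_forall (hC t ht))

/-- Differentiation under the integral over the hemisphere. -/
lemma hasDerivAt_integral_comp_dir {α : ℝ} (hα : -1 < α) (hδ : 0 < δ)
    {f f' : ℝ × EuclideanSpace ℝ (Fin (n + 1)) → ℝ} (hf : ContinuousOn f (paramDomain n δ))
    (hf' : ContinuousOn f' (paramDomain n δ))
    (hd : ∀ t ∈ Ioo (-δ) δ, ∀ x ∈ halfSpace n, HasDerivAt (fun s => f (s, x)) (f' (t, x)) t)
    {t : ℝ} (ht : t ∈ Ioo (-(δ / 2)) (δ / 2)) :
    HasDerivAt (fun s => ∫ z, f (s, dir z) ∂(sphereMeasure n α))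
      (∫ z, f' (t, dir z) ∂(sphereMeasure n α)) t := by
  have := isFiniteMeasure_sphereMeasure (n := n) hα
  obtain ⟨C, -, hC⟩ := exists_bound_comp_dir hδ hf'
  refine (hasDerivAt_integral_of_dominated_loc_of_deriv_le (isOpen_Ioo.mem_nhds ht)
    (F := fun s z => f (s, dir z)) (F' := fun s z => f' (s, dir z)) (bound := fun _ => C) ?_ ?_ ?_ ?_
    (integrable_const C) ?_).2
  · filter_upwards [isOpen_Ioo.mem_nhds ht] with s hs
    exact (continuous_comp_dir hf (half_mem_Ioo hs)).aestronglyMeasurable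
  · exact integrable_comp_dir hα hδ hf ht
  · exact (continuous_comp_dir hf' (half_mem_Ioo ht)).aestronglyMeasurable
  · exact Eventually.of_forall fun z s hs => hC s hs z
  · exact Eventually.of_forall fun z s hs => hd s (half_mem_Ioo hs) _ (dir_mem_halfSpace z)

/-- Differentiation under the integral at time `0` for a product `⟨u, v⟩ h` whose factor `u`
vanishes at time `0`: here `v` and `h` need only be continuous. -/
lemma hasDerivAt_integral_inner_comp_dir {α : ℝ} (hα : -1 < α) (hδ : 0 < δ)
    {u u' v : ℝ × EuclideanSpace ℝ (Fin (n + 1)) → EuclideanSpace ℝ (Fin (n + 1))}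
    {h : ℝ × EuclideanSpace ℝ (Fin (n + 1)) → ℝ}
    (hu : ContinuousOn u (paramDomain n δ)) (hu' : ContinuousOn u' (paramDomain n δ))
    (hv : ContinuousOn v (paramDomain n δ)) (hh : ContinuousOn h (paramDomain n δ))
    (hd : ∀ t ∈ Ioo (-δ) δ, ∀ x ∈ halfSpace n, HasDerivAt (fun s => u (s, x)) (u' (t, x)) t)
    (hu0 : ∀ x ∈ halfSpace n, u (0, x) = 0) :
    HasDerivAt (fun s => ∫ z, inner ℝ (u (s, dir z)) (v (s, dir z)) * h (s, dir z)
        ∂(sphereMeasure n α))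
      (∫ z, inner ℝ (u' (0, dir z)) (v (0, dir z)) * h (0, dir z) ∂(sphereMeasure n α)) 0 := by
  have := isFiniteMeasure_sphereMeasure (n := n) hα
  have h0' : (0 : ℝ) ∈ Ioo (-(δ / 2)) (δ / 2) := ⟨by linarith, by linarith⟩
  have h0 := half_mem_Ioo h0'
  have hprod : ContinuousOn (fun q => inner ℝ (u q) (v q) * h q) (paramDomain n δ) :=
    (hu.inner hv).mul hh
  obtain ⟨C₁, hC₁0, hC₁⟩ := exists_bound_comp_dir hδ hu'
  obtain ⟨C₂, hC₂0, hC₂⟩ := exists_bound_comp_dir hδ hv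
  obtain ⟨C₃, hC₃0, hC₃⟩ := exists_bound_comp_dir hδ hh
  have hulip : ∀ t ∈ Ioo (-(δ / 2)) (δ / 2), ∀ z : EuclideanSpace ℝ (Fin n),
      ‖u (t, dir z)‖ ≤ C₁ * |t| := by
    intro t ht z
    have h1 := (convex_Ioo (-(δ / 2)) (δ / 2)).norm_image_sub_le_of_norm_hasDerivWithin_le
      (f := fun s => u (s, dir z)) (f' := fun s => u' (s, dir z)) (C := C₁)
      (fun s hs => (hd s (half_mem_Ioo hs) _ (dir_mem_halfSpace z)).hasDerivWithinAt)
      (fun s hs => hC₁ s hs z) h0' ht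
    simpa [hu0 _ (dir_mem_halfSpace z)] using h1
  set L : ℝ →L[ℝ] ℝ →L[ℝ] ℝ := ContinuousLinearMap.smulRightL ℝ ℝ ℝ 1 with hL
  have key := hasFDerivAt_integral_of_dominated_loc_of_lip' (𝕜 := ℝ) (μ := sphereMeasure n α)
    (x₀ := (0 : ℝ)) (isOpen_Ioo.mem_nhds h0')
    (F := fun s z => inner ℝ (u (s, dir z)) (v (s, dir z)) * h (s, dir z))
    (F' := fun z => L (inner ℝ (u' (0, dir z)) (v (0, dir z)) * h (0, dir z)))
    (bound := fun _ => C₁ * C₂ * C₃) ?_ ?_ ?_ ?_ (integrable_const _) ?_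
  · have h3 := key.2.hasDerivAt
    convert! h3 using 1
    have hint : Integrable (fun z => inner ℝ (u' (0, dir z)) (v (0, dir z)) * h (0, dir z))
        (sphereMeasure n α) :=
      integrable_comp_dir hα hδ (f := fun q => inner ℝ (u' q) (v q) * h q)
        ((hu'.inner hv).mul hh) h0'
    rw [L.integral_comp_comm hint]
    simp [hL]
  · intro s hs
    exact (continuous_comp_dir hprod (half_mem_Ioo hs)).aestronglyMeasurable
  · exact integrable_comp_dir hα hδ hprod h0'
  · refine Continuous.aestronglyMeasurable (L.continuous.comp ?_)
    exact continuous_comp_dir (f := fun q => inner ℝ (u' q) (v q) * h q)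
      ((hu'.inner hv).mul hh) h0
  · refine Eventually.of_forall fun z s hs => ?_
    rw [hu0 _ (dir_mem_halfSpace z), inner_zero_left, zero_mul, sub_zero, sub_zero, norm_mul,
      Real.norm_eq_abs s]
    calc ‖inner ℝ (u (s, dir z)) (v (s, dir z))‖ * ‖h (s, dir z)‖
        ≤ (‖u (s, dir z)‖ * ‖v (s, dir z)‖) * ‖h (s, dir z)‖ := by
          gcongr
          exact norm_inner_le_norm _ _
      _ ≤ ((C₁ * |s|) * C₂) * C₃ := by
          gcongr
          · exact hulip s hs z
          · exact hC₂ s hs z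
          · exact hC₃ s hs z
      _ = _ := by ring
  · refine Eventually.of_forall fun z => ?_
    have hz := dir_mem_halfSpace z
    have hcont : ∀ {X : Type} [NormedAddCommGroup X] {f : ℝ × EuclideanSpace ℝ (Fin (n + 1)) → X},
        ContinuousOn f (paramDomain n δ) → ContinuousAt (fun s : ℝ => f (s, dir z)) 0 := by
      intro X _ f hf
      exact ContinuousAt.comp (f := fun s : ℝ => (s, dir z)) (g := f)
        (hf.continuousAt (paramDomain_mem_nhds h0 hz)) (by fun_prop)
    have hd0 := hd 0 h0 _ hz
    have h4 : HasDerivAt (fun s => inner ℝ (u (s, dir z)) (v (s, dir z)) * h (s, dir z))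
        (inner ℝ (u' (0, dir z)) (v (0, dir z)) * h (0, dir z)) 0 := by
      rw [hasDerivAt_iff_tendsto_slope_zero] at hd0 ⊢
      have h5 := (hd0.inner ((hcont hv).tendsto.mono_left (nhdsWithin_le_nhds (s := {0}ᶜ)))).mul
        ((hcont hh).tendsto.mono_left (nhdsWithin_le_nhds (s := {0}ᶜ)))
      refine h5.congr fun s => ?_
      rw [zero_add, hu0 _ hz, inner_zero_left, zero_mul, sub_zero, sub_zero, real_inner_smul_left,
        smul_eq_mul, mul_assoc]
    have h6 := h4.hasFDerivAt
    convert! h6 using 1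

end Family

/-! ### Time derivatives and spatial gradients up to the hyperplane -/

section Derivatives

variable {n : ℕ} {δ : ℝ} {X : Type*} [NormedAddCommGroup X] [NormedSpace ℝ X]

/-- The time derivative of a function on `paramDomain n δ`, one-sided at the hyperplane in the
sense of `fderivWithin`. -/
noncomputable def timeDeriv (δ : ℝ) (f : ℝ × EuclideanSpace ℝ (Fin (n + 1)) → X)
    (q : ℝ × EuclideanSpace ℝ (Fin (n + 1))) : X :=
  fderivWithin ℝ f (paramDomain n δ) q (1, 0)

/-- The gradient in the space variable of a function on `paramDomain n δ`. -/
noncomputable def spaceGrad (δ : ℝ) (f : ℝ × EuclideanSpace ℝ (Fin (n + 1)) → ℝ)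
    (q : ℝ × EuclideanSpace ℝ (Fin (n + 1))) : EuclideanSpace ℝ (Fin (n + 1)) :=
  (InnerProductSpace.toDual ℝ _).symm
    ((fderivWithin ℝ f (paramDomain n δ) q).comp (ContinuousLinearMap.inr ℝ ℝ _))

lemma innerSL_spaceGrad (f : ℝ × EuclideanSpace ℝ (Fin (n + 1)) → ℝ)
    (q : ℝ × EuclideanSpace ℝ (Fin (n + 1))) :
    innerSL ℝ (spaceGrad δ f q) =
      (fderivWithin ℝ f (paramDomain n δ) q).comp (ContinuousLinearMap.inr ℝ ℝ _) := by
  ext y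
  simp [spaceGrad, InnerProductSpace.toDual_symm_apply]

lemma contDiffOn_timeDeriv {f : ℝ × EuclideanSpace ℝ (Fin (n + 1)) → X} {a b : WithTop ℕ∞}
    (hf : ContDiffOn ℝ a f (paramDomain n δ)) (hab : b + 1 ≤ a) :
    ContDiffOn ℝ b (timeDeriv δ f) (paramDomain n δ) :=
  (hf.fderivWithin uniqueDiffOn_paramDomain hab).clm_apply contDiffOn_const

lemma contDiffOn_spaceGrad {f : ℝ × EuclideanSpace ℝ (Fin (n + 1)) → ℝ} {a b : WithTop ℕ∞}
    (hf : ContDiffOn ℝ a f (paramDomain n δ)) (hab : b + 1 ≤ a) :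
    ContDiffOn ℝ b (spaceGrad δ f) (paramDomain n δ) :=
  (InnerProductSpace.toDual ℝ (EuclideanSpace ℝ (Fin (n + 1)))).symm.toContinuousLinearEquiv.contDiff.comp_contDiffOn
    ((hf.fderivWithin uniqueDiffOn_paramDomain hab).clm_comp contDiffOn_const)

lemma fderivWithin_paramDomain {f : ℝ × EuclideanSpace ℝ (Fin (n + 1)) → X} {t : ℝ}
    (ht : t ∈ Ioo (-δ) δ) {x : EuclideanSpace ℝ (Fin (n + 1))} (hx : x ∈ halfSpace n) :
    fderivWithin ℝ f (paramDomain n δ) (t, x) = fderiv ℝ f (t, x) :=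
  fderivWithin_of_mem_nhds (paramDomain_mem_nhds ht hx)

lemma hasDerivAt_timeDeriv {f : ℝ × EuclideanSpace ℝ (Fin (n + 1)) → X}
    (hf : ContDiffOn ℝ 1 f (paramDomain n δ)) {t : ℝ} (ht : t ∈ Ioo (-δ) δ)
    {x : EuclideanSpace ℝ (Fin (n + 1))} (hx : x ∈ halfSpace n) :
    HasDerivAt (fun s => f (s, x)) (timeDeriv δ f (t, x)) t := by
  have h1 := ((hf.contDiffAt (paramDomain_mem_nhds ht hx)).differentiableAt one_ne_zero).hasFDerivAt
  rw [timeDeriv, fderivWithin_paramDomain ht hx]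
  exact h1.comp_hasDerivAt t ((hasDerivAt_id t).prodMk (hasDerivAt_const t x))

lemma hasStrictFDerivAt_spaceGrad {f : ℝ × EuclideanSpace ℝ (Fin (n + 1)) → ℝ}
    (hf : ContDiffOn ℝ 1 f (paramDomain n δ)) {t : ℝ} (ht : t ∈ Ioo (-δ) δ)
    {x : EuclideanSpace ℝ (Fin (n + 1))} (hx : x ∈ halfSpace n) :
    HasStrictFDerivAt (fun y => f (t, y)) (innerSL ℝ (spaceGrad δ f (t, x))) x := by
  have h1 := (hf.contDiffAt (paramDomain_mem_nhds ht hx)).hasStrictFDerivAt one_ne_zero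
  rw [innerSL_spaceGrad, fderivWithin_paramDomain ht hx]
  exact h1.comp x ((hasStrictFDerivAt_const t x).prodMk (hasStrictFDerivAt_id x))

/-- The symmetry of the second derivative. -/
lemma spaceGrad_timeDeriv {f : ℝ × EuclideanSpace ℝ (Fin (n + 1)) → ℝ}
    (hf : ContDiffOn ℝ 2 f (paramDomain n δ)) {t : ℝ} (ht : t ∈ Ioo (-δ) δ)
    {x : EuclideanSpace ℝ (Fin (n + 1))} (hx : x ∈ halfSpace n) :
    spaceGrad δ (timeDeriv δ f) (t, x) = timeDeriv δ (spaceGrad δ f) (t, x) := by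
  have hfa := hf.contDiffAt (paramDomain_mem_nhds ht hx)
  have hsymm := hfa.isSymmSndFDerivAt (by simp)
  have h2 := ((hfa.fderiv_right (m := 1) (by norm_num)).differentiableAt one_ne_zero).hasFDerivAt
  have hev : fderivWithin ℝ f (paramDomain n δ) =ᶠ[𝓝 (t, x)] fderiv ℝ f := by
    filter_upwards [(isOpen_Ioo.prod isOpen_halfSpace).mem_nhds
      (show (t, x) ∈ Ioo (-δ) δ ×ˢ halfSpace n from ⟨ht, hx⟩)] with q hq
    exact fderivWithin_paramDomain hq.1 hq.2
  have h3 := h2.congr_of_eventuallyEq hev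
  have h4 : HasFDerivAt (timeDeriv δ f) _ (t, x) :=
    (ContinuousLinearMap.apply ℝ ℝ ((1 : ℝ), (0 : EuclideanSpace ℝ (Fin (n + 1))))).hasFDerivAt.comp
      (t, x) h3
  have h5 : HasFDerivAt (fun q => innerSL ℝ (spaceGrad δ f q)) _ (t, x) :=
    (((ContinuousLinearMap.compL ℝ (EuclideanSpace ℝ (Fin (n + 1)))
      (ℝ × EuclideanSpace ℝ (Fin (n + 1))) ℝ).flip
        (ContinuousLinearMap.inr ℝ ℝ _)).hasFDerivAt.comp (t, x) h3).congr_of_eventuallyEq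
      (Eventually.of_forall fun q => innerSL_spaceGrad f q)
  have h6 : DifferentiableAt ℝ (spaceGrad δ f) (t, x) :=
    ((contDiffOn_spaceGrad (b := 1) hf (by norm_num)).contDiffAt
      (paramDomain_mem_nhds ht hx)).differentiableAt one_ne_zero
  have h7 := ((innerSL ℝ (E := EuclideanSpace ℝ (Fin (n + 1)))).hasFDerivAt.comp (t, x)
    h6.hasFDerivAt).unique h5
  refine ext_inner_right ℝ fun y => ?_
  have h8 := congrArg (fun L => L ((1 : ℝ), (0 : EuclideanSpace ℝ (Fin (n + 1)))) y) h7
  have h9 := congrArg (fun L => L y) (innerSL_spaceGrad (δ := δ) (timeDeriv δ f) (t, x))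
  rw [timeDeriv, fderivWithin_paramDomain ht hx]
  rw [fderivWithin_paramDomain ht hx, h4.fderiv] at h9
  simp only [ContinuousLinearMap.comp_apply, ContinuousLinearMap.inr_apply,
    ContinuousLinearMap.apply_apply, ContinuousLinearMap.flip_apply,
    ContinuousLinearMap.compL_apply, innerSL_apply_apply] at h8 h9
  rw [h9]
  exact (hsymm.eq _ _).trans h8.symm

end Derivatives

/-! ### First variation -/

/-- The uncurried logarithmic radius `f (t, x) = log (radius)` of a family of radial graphs that
starts at the half-ball of radius `R`. -/
structure IsRadialFamily {n : ℕ} (m : ℕ) (δ R : ℝ)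
    (f : ℝ × EuclideanSpace ℝ (Fin (n + 1)) → ℝ) : Prop where
  pos : 0 < δ
  contDiffOn : ContDiffOn ℝ m f (paramDomain n δ)
  homog : ∀ t ∈ Ioo (-δ) δ, IsHomog fun x => f (t, x)
  zero : ∀ x ∈ halfSpace n, f (0, x) = Real.log R

/-- The region below the radial graph at time `t`. -/
def radialRegion {n : ℕ} (f : ℝ × EuclideanSpace ℝ (Fin (n + 1)) → ℝ) (t : ℝ) :
    Set (EuclideanSpace ℝ (Fin (n + 1))) :=
  {x | x ∈ halfSpace n ∧ ‖x‖ < Real.exp (f (t, x))}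

namespace IsRadialFamily

variable {n m : ℕ} {δ R k l α : ℝ} {f : ℝ × EuclideanSpace ℝ (Fin (n + 1)) → ℝ}

lemma mono (hf : IsRadialFamily m δ R f) {m' : ℕ} (h : m' ≤ m) : IsRadialFamily m' δ R f :=
  ⟨hf.pos, hf.contDiffOn.of_le (by exact_mod_cast h), hf.homog, hf.zero⟩

lemma zero_mem_half (hf : IsRadialFamily m δ R f) : (0 : ℝ) ∈ Ioo (-(δ / 2)) (δ / 2) :=
  ⟨by linarith [hf.pos], by linarith [hf.pos]⟩

lemma zero_mem (hf : IsRadialFamily m δ R f) : (0 : ℝ) ∈ Ioo (-δ) δ :=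
  half_mem_Ioo hf.zero_mem_half

lemma contDiffOn_one (hf : IsRadialFamily 1 δ R f) : ContDiffOn ℝ 1 f (paramDomain n δ) := by
  exact_mod_cast hf.contDiffOn

lemma contDiffOn_two (hf : IsRadialFamily 2 δ R f) : ContDiffOn ℝ 2 f (paramDomain n δ) := by
  exact_mod_cast hf.contDiffOn

lemma continuousOn_timeDeriv (hf : IsRadialFamily 1 δ R f) :
    ContinuousOn (timeDeriv δ f) (paramDomain n δ) :=
  (contDiffOn_timeDeriv (b := 0) hf.contDiffOn_one (by norm_num)).continuousOn

lemma continuousOn_spaceGrad (hf : IsRadialFamily 1 δ R f) :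
    ContinuousOn (spaceGrad δ f) (paramDomain n δ) :=
  (contDiffOn_spaceGrad (b := 0) hf.contDiffOn_one (by norm_num)).continuousOn

lemma spaceGrad_zero (hf : IsRadialFamily 1 δ R f) {x : EuclideanSpace ℝ (Fin (n + 1))}
    (hx : x ∈ halfSpace n) : spaceGrad δ f (0, x) = 0 := by
  have h1 := (hasStrictFDerivAt_spaceGrad hf.contDiffOn_one hf.zero_mem hx).hasFDerivAt
  have h2 : HasFDerivAt (fun y => f (0, y)) (0 : _ →L[ℝ] ℝ) x := by
    refine (hasFDerivAt_const (Real.log R) x).congr_of_eventuallyEq ?_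
    filter_upwards [isOpen_halfSpace.mem_nhds hx] with y hy
    exact hf.zero y hy
  have h3 := congrArg (fun L => L (spaceGrad δ f (0, x))) (h1.unique h2)
  simpa using h3

lemma continuousOn_exp (hf : IsRadialFamily 1 δ R f) (c : ℝ) :
    ContinuousOn (fun q => Real.exp (c * f q)) (paramDomain n δ) :=
  (continuousOn_const.mul hf.contDiffOn_one.continuousOn).rexp

lemma continuousOn_sqrt (hf : IsRadialFamily 1 δ R f) :
    ContinuousOn (fun q => √(1 + ‖spaceGrad δ f q‖ ^ 2)) (paramDomain n δ) :=
  (continuousOn_const.add (hf.continuousOn_spaceGrad.norm.pow 2)).sqrt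

lemma integrable_area (hα : -1 < α) (hf : IsRadialFamily 1 δ R f) (c : ℝ) {t : ℝ}
    (ht : t ∈ Ioo (-(δ / 2)) (δ / 2)) :
    Integrable (fun z => Real.exp (c * f (t, dir z)) * √(1 + ‖spaceGrad δ f (t, dir z)‖ ^ 2))
      (sphereMeasure n α) :=
  integrable_comp_dir hα hf.pos
    (f := fun q => Real.exp (c * f q) * √(1 + ‖spaceGrad δ f q‖ ^ 2))
    ((hf.continuousOn_exp c).mul hf.continuousOn_sqrt) ht

lemma wPerimeter_eq (hα : -1 < α) (hf : IsRadialFamily 1 δ R f) (k : ℝ) {t : ℝ}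
    (ht : t ∈ Ioo (-(δ / 2)) (δ / 2)) :
    wPerimeter k α (radialRegion f t) = ENNReal.ofReal (∫ z, Real.exp ((k + n + α) * f (t, dir z)) *
      √(1 + ‖spaceGrad δ f (t, dir z)‖ ^ 2) ∂(sphereMeasure n α)) := by
  have ht' := half_mem_Ioo ht
  rw [radialRegion, wPerimeter_radialRegion (W := fun x => f (t, x))
      (G := fun x => spaceGrad δ f (t, x)) k α (hf.homog t ht')
      (fun x hx => hasStrictFDerivAt_spaceGrad hf.contDiffOn_one ht' hx)
      (continuous_comp_dir hf.continuousOn_spaceGrad ht').measurable]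
  exact (ofReal_integral_eq_lintegral_ofReal (hf.integrable_area hα _ ht)
    (Eventually.of_forall fun z => by positivity)).symm

lemma toReal_wMeasure_eq (hα : -1 < α) (hl : 0 < l + n + 1 + α) (hf : IsRadialFamily 1 δ R f)
    {t : ℝ} (ht : t ∈ Ioo (-(δ / 2)) (δ / 2)) :
    (wMeasure l α (radialRegion f t)).toReal =
      ∫ z, Real.exp ((l + n + 1 + α) * f (t, dir z)) / (l + n + 1 + α) ∂(sphereMeasure n α) := by
  have ht' := half_mem_Ioo ht
  have hc : ContinuousOn (fun x => f (t, x)) (halfSpace n) := fun x hx =>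
    (hasStrictFDerivAt_spaceGrad hf.contDiffOn_one ht' hx).continuousAt.continuousWithinAt
  rw [radialRegion, wMeasure_radial hl (hf.homog t ht')
    (continuous_comp_dir hf.contDiffOn_one.continuousOn ht').measurable
    (isOpen_radialRegion hc).measurableSet,
    ← ofReal_integral_eq_lintegral_ofReal
      (integrable_comp_dir hα hf.pos (f := fun q => Real.exp ((l + n + 1 + α) * f q) / _)
        ((hf.continuousOn_exp _).div_const _) ht)
      (Eventually.of_forall fun z => by positivity),
    ENNReal.toReal_ofReal (integral_nonneg fun z => by positivity)]

lemma hasDerivAt_integral_exp (hα : -1 < α) (hf : IsRadialFamily 1 δ R f) (c : ℝ) {t : ℝ}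
    (ht : t ∈ Ioo (-(δ / 2)) (δ / 2)) :
    HasDerivAt (fun s => ∫ z, Real.exp (c * f (s, dir z)) ∂(sphereMeasure n α))
      (∫ z, Real.exp (c * f (t, dir z)) * (c * timeDeriv δ f (t, dir z)) ∂(sphereMeasure n α)) t :=
  hasDerivAt_integral_comp_dir hα hf.pos (f := fun q => Real.exp (c * f q))
    (f' := fun q => Real.exp (c * f q) * (c * timeDeriv δ f q)) (hf.continuousOn_exp c)
    ((hf.continuousOn_exp c).mul (continuousOn_const.mul hf.continuousOn_timeDeriv))
    (fun _ ht _ hx => ((hasDerivAt_timeDeriv hf.contDiffOn_one ht hx).const_mul c).exp) ht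

/-- Constancy of the volume, differentiated once. -/
lemma eventually_integral_exp_timeDeriv_eq_zero (hα : -1 < α) (hl : 0 < l + n + 1 + α)
    (hf : IsRadialFamily 1 δ R f)
    (hM : ∀ᶠ t in 𝓝 (0 : ℝ),
      wMeasure l α (radialRegion f t) = wMeasure l α (radialRegion f 0)) :
    ∀ᶠ t in 𝓝 (0 : ℝ), ∫ z, Real.exp ((l + n + 1 + α) * f (t, dir z)) * timeDeriv δ f (t, dir z)
      ∂(sphereMeasure n α) = 0 := by
  have hnhds := isOpen_Ioo.mem_nhds hf.zero_mem_half
  have hconst : ∀ᶠ t in 𝓝 (0 : ℝ),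
      ∫ z, Real.exp ((l + n + 1 + α) * f (t, dir z)) ∂(sphereMeasure n α) =
        ∫ z, Real.exp ((l + n + 1 + α) * f (0, dir z)) ∂(sphereMeasure n α) := by
    filter_upwards [hM, hnhds] with t h1 ht
    have h2 := congrArg ENNReal.toReal h1
    rw [hf.toReal_wMeasure_eq hα hl ht, hf.toReal_wMeasure_eq hα hl hf.zero_mem_half,
      integral_div, integral_div] at h2
    exact (div_left_inj' hl.ne').1 h2
  filter_upwards [hconst.eventually_nhds, hnhds] with t h1 ht
  have h3 := ((hf.hasDerivAt_integral_exp hα (l + n + 1 + α) ht).congr_of_eventuallyEq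
    (f₁ := fun _ => ∫ z, Real.exp ((l + n + 1 + α) * f (0, dir z)) ∂(sphereMeasure n α))
    (by filter_upwards [h1] with s hs using hs.symm)).unique (hasDerivAt_const t _)
  have h4 : ∫ z, Real.exp ((l + n + 1 + α) * f (t, dir z)) *
      ((l + n + 1 + α) * timeDeriv δ f (t, dir z)) ∂(sphereMeasure n α) =
      (l + n + 1 + α) * ∫ z, Real.exp ((l + n + 1 + α) * f (t, dir z)) *
        timeDeriv δ f (t, dir z) ∂(sphereMeasure n α) := by
    rw [← integral_const_mul]
    exact integral_congr_ae (Eventually.of_forall fun z => by ring)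
  rw [h4] at h3
  exact (mul_eq_zero.1 h3).resolve_left hl.ne'

lemma exp_zero (hf : IsRadialFamily m δ R f) (c : ℝ) (z : EuclideanSpace ℝ (Fin n)) :
    Real.exp (c * f (0, dir z)) = Real.exp (c * Real.log R) := by
  rw [hf.zero _ (dir_mem_halfSpace z)]

lemma integral_timeDeriv_eq_zero (hα : -1 < α) (hl : 0 < l + n + 1 + α)
    (hf : IsRadialFamily 1 δ R f)
    (hM : ∀ᶠ t in 𝓝 (0 : ℝ),
      wMeasure l α (radialRegion f t) = wMeasure l α (radialRegion f 0)) :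
    ∫ z, timeDeriv δ f (0, dir z) ∂(sphereMeasure n α) = 0 := by
  have h1 := (hf.eventually_integral_exp_timeDeriv_eq_zero hα hl hM).self_of_nhds
  simp only [hf.exp_zero] at h1
  rw [integral_const_mul] at h1
  exact (mul_eq_zero.1 h1).resolve_left (Real.exp_pos _).ne'

/-- The perimeter is at least `∫ exp (κ f)`, with equality at time `0`, and the latter has
derivative `0` at time `0`. So `p` needs no derivative under the integral sign. -/
lemma derivative_eq_zero (hα : -1 < α) (hl : 0 < l + n + 1 + α) (hf : IsRadialFamily 1 δ R f)
    (hM : ∀ᶠ t in 𝓝 (0 : ℝ),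
      wMeasure l α (radialRegion f t) = wMeasure l α (radialRegion f 0)) {c : ℝ}
    (hc : HasDerivAt (fun t => (wPerimeter k α (radialRegion f t)).toReal) c 0) : c = 0 := by
  have hnhds := isOpen_Ioo.mem_nhds hf.zero_mem_half
  have he := hf.hasDerivAt_integral_exp hα (k + n + α) hf.zero_mem_half
  have he0 : ∫ z, Real.exp ((k + n + α) * f (0, dir z)) *
      ((k + n + α) * timeDeriv δ f (0, dir z)) ∂(sphereMeasure n α) = 0 := by
    simp only [hf.exp_zero]
    rw [integral_const_mul, integral_const_mul, hf.integral_timeDeriv_eq_zero hα hl hM]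
    simp
  rw [he0] at he
  have hp : ∀ t ∈ Ioo (-(δ / 2)) (δ / 2), (wPerimeter k α (radialRegion f t)).toReal =
      ∫ z, Real.exp ((k + n + α) * f (t, dir z)) *
        √(1 + ‖spaceGrad δ f (t, dir z)‖ ^ 2) ∂(sphereMeasure n α) := fun t ht => by
    rw [hf.wPerimeter_eq hα k ht, ENNReal.toReal_ofReal (integral_nonneg fun z => by positivity)]
  have hmin : IsLocalMin (fun t => (wPerimeter k α (radialRegion f t)).toReal -
      ∫ z, Real.exp ((k + n + α) * f (t, dir z)) ∂(sphereMeasure n α)) 0 := by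
    filter_upwards [hnhds] with t ht
    rw [hp t ht, hp 0 hf.zero_mem_half]
    have h1 : ∫ z, Real.exp ((k + n + α) * f (0, dir z)) *
        √(1 + ‖spaceGrad δ f (0, dir z)‖ ^ 2) ∂(sphereMeasure n α) =
        ∫ z, Real.exp ((k + n + α) * f (0, dir z)) ∂(sphereMeasure n α) :=
      integral_congr_ae (Eventually.of_forall fun z => by
        simp [hf.spaceGrad_zero (dir_mem_halfSpace z)])
    rw [h1, sub_self, sub_nonneg]
    refine integral_mono (integrable_comp_dir hα hf.pos (hf.continuousOn_exp _) ht)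
      (integrable_comp_dir hα hf.pos (f := fun q => Real.exp ((k + n + α) * f q) *
      √(1 + ‖spaceGrad δ f q‖ ^ 2)) ((hf.continuousOn_exp _).mul hf.continuousOn_sqrt) ht)
      fun z => le_mul_of_one_le_right (Real.exp_pos _).le ?_
    rw [Real.one_le_sqrt]
    nlinarith [sq_nonneg ‖spaceGrad δ f (t, dir z)‖]
  simpa using hmin.hasDerivAt_eq_zero (hc.sub he)

end IsRadialFamily

/-! ### Second variation -/

namespace IsRadialFamily

variable {n : ℕ} {δ R k l α : ℝ} {f : ℝ × EuclideanSpace ℝ (Fin (n + 1)) → ℝ}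

lemma contDiffOn_timeDeriv_one (hf : IsRadialFamily 2 δ R f) :
    ContDiffOn ℝ 1 (timeDeriv δ f) (paramDomain n δ) :=
  contDiffOn_timeDeriv hf.contDiffOn_two (by norm_num)

lemma contDiffOn_spaceGrad_one (hf : IsRadialFamily 2 δ R f) :
    ContDiffOn ℝ 1 (spaceGrad δ f) (paramDomain n δ) :=
  contDiffOn_spaceGrad hf.contDiffOn_two (by norm_num)

lemma continuousOn_timeDeriv_timeDeriv (hf : IsRadialFamily 2 δ R f) :
    ContinuousOn (timeDeriv δ (timeDeriv δ f)) (paramDomain n δ) :=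
  (contDiffOn_timeDeriv (b := 0) hf.contDiffOn_timeDeriv_one (by norm_num)).continuousOn

lemma continuousOn_timeDeriv_spaceGrad (hf : IsRadialFamily 2 δ R f) :
    ContinuousOn (timeDeriv δ (spaceGrad δ f)) (paramDomain n δ) :=
  (contDiffOn_timeDeriv (b := 0) hf.contDiffOn_spaceGrad_one (by norm_num)).continuousOn

lemma isHomog_timeDeriv (hf : IsRadialFamily 1 δ R f) {t : ℝ} (ht : t ∈ Ioo (-δ) δ) :
    IsHomog fun x => timeDeriv δ f (t, x) := by
  intro x hx c hc
  refine (hasDerivAt_timeDeriv hf.contDiffOn_one ht (smul_mem_halfSpace hx hc)).unique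
    ((hasDerivAt_timeDeriv hf.contDiffOn_one ht hx).congr_of_eventuallyEq ?_)
  filter_upwards [isOpen_Ioo.mem_nhds ht] with s hs
  exact hf.homog s hs x hx c hc

/-- The weighted Poincaré inequality for the normal speed of the variation. -/
lemma poincare (hα : -1 < α) (hn : 0 ≤ n + α) (hf : IsRadialFamily 2 δ R f)
    (h0 : ∫ z, timeDeriv δ f (0, dir z) ∂(sphereMeasure n α) = 0) :
    (n + α) * ∫ z, timeDeriv δ f (0, dir z) ^ 2 ∂(sphereMeasure n α) ≤
      ∫ z, ‖timeDeriv δ (spaceGrad δ f) (0, dir z)‖ ^ 2 ∂(sphereMeasure n α) := by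
  have hf1 := hf.mono one_le_two
  obtain ⟨C, -, hC⟩ := exists_bound_comp_dir hf.pos hf1.continuousOn_timeDeriv
  have hd : ContDiffOn ℝ 1 (fun x => timeDeriv δ f (0, x)) (halfSpace n) :=
    hf.contDiffOn_timeDeriv_one.comp (contDiff_const.prodMk contDiff_id).contDiffOn
      fun x hx => mem_paramDomain hf.zero_mem hx
  have h := poincare_hemisphere hα hn (hf1.isHomog_timeDeriv hf.zero_mem)
    (G := fun x => timeDeriv δ (spaceGrad δ f) (0, x))
    (fun x hx => by
      rw [← spaceGrad_timeDeriv hf.contDiffOn_two hf.zero_mem hx]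
      exact (hasStrictFDerivAt_spaceGrad hf.contDiffOn_timeDeriv_one hf.zero_mem hx).hasFDerivAt)
    hd (continuous_comp_dir hf.continuousOn_timeDeriv_spaceGrad hf.zero_mem).measurable
    (fun z => hC 0 hf.zero_mem_half z) h0
  have i1 := integrable_comp_dir hα hf.pos (f := fun q => timeDeriv δ f q ^ 2)
    (hf1.continuousOn_timeDeriv.pow 2) hf.zero_mem_half
  have i2 := integrable_comp_dir hα hf.pos (f := fun q => ‖timeDeriv δ (spaceGrad δ f) q‖ ^ 2)
    (hf.continuousOn_timeDeriv_spaceGrad.norm.pow 2) hf.zero_mem_half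
  rw [← ofReal_integral_eq_lintegral_ofReal i1 (Eventually.of_forall fun z => sq_nonneg _),
    ← ofReal_integral_eq_lintegral_ofReal i2 (Eventually.of_forall fun z => sq_nonneg _),
    ← ENNReal.ofReal_mul hn] at h
  exact (ENNReal.ofReal_le_ofReal_iff (integral_nonneg fun z => sq_nonneg _)).1 h

lemma hasDerivAt_exp (hf : IsRadialFamily 1 δ R f) (c : ℝ) {t : ℝ} (ht : t ∈ Ioo (-δ) δ)
    {x : EuclideanSpace ℝ (Fin (n + 1))} (hx : x ∈ halfSpace n) :
    HasDerivAt (fun s => Real.exp (c * f (s, x)))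
      (Real.exp (c * f (t, x)) * (c * timeDeriv δ f (t, x))) t :=
  ((hasDerivAt_timeDeriv hf.contDiffOn_one ht hx).const_mul c).exp

lemma hasDerivAt_sqrt (hf : IsRadialFamily 2 δ R f) {t : ℝ} (ht : t ∈ Ioo (-δ) δ)
    {x : EuclideanSpace ℝ (Fin (n + 1))} (hx : x ∈ halfSpace n) :
    HasDerivAt (fun s => √(1 + ‖spaceGrad δ f (s, x)‖ ^ 2))
      (inner ℝ (spaceGrad δ f (t, x)) (timeDeriv δ (spaceGrad δ f) (t, x)) /
        √(1 + ‖spaceGrad δ f (t, x)‖ ^ 2)) t := by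
  have h := (((hasDerivAt_timeDeriv hf.contDiffOn_spaceGrad_one ht hx).norm_sq).const_add 1).sqrt
    (by positivity)
  convert! h using 1
  field_simp

/-- Constancy of the volume, differentiated twice. -/
lemma integral_timeDeriv_timeDeriv_eq (hα : -1 < α) (hl : 0 < l + n + 1 + α)
    (hf : IsRadialFamily 2 δ R f)
    (hM : ∀ᶠ t in 𝓝 (0 : ℝ),
      wMeasure l α (radialRegion f t) = wMeasure l α (radialRegion f 0)) :
    ∫ z, timeDeriv δ (timeDeriv δ f) (0, dir z) ∂(sphereMeasure n α) =
      -(l + n + 1 + α) * ∫ z, timeDeriv δ f (0, dir z) ^ 2 ∂(sphereMeasure n α) := by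
  have hf1 := hf.mono one_le_two
  have h0 := hf1.eventually_integral_exp_timeDeriv_eq_zero hα hl hM
  set c := l + n + 1 + α with hc
  have h1 := hasDerivAt_integral_comp_dir hα hf.pos
    (f := fun q => Real.exp (c * f q) * timeDeriv δ f q)
    (f' := fun q => Real.exp (c * f q) * (c * timeDeriv δ f q) * timeDeriv δ f q +
      Real.exp (c * f q) * timeDeriv δ (timeDeriv δ f) q)
    ((hf1.continuousOn_exp c).mul hf1.continuousOn_timeDeriv)
    ((((hf1.continuousOn_exp c).mul (continuousOn_const.mul hf1.continuousOn_timeDeriv)).mul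
      hf1.continuousOn_timeDeriv).add
      ((hf1.continuousOn_exp c).mul hf.continuousOn_timeDeriv_timeDeriv))
    (fun t ht x hx => (hf1.hasDerivAt_exp c ht hx).mul
      (hasDerivAt_timeDeriv hf.contDiffOn_timeDeriv_one ht hx)) hf.zero_mem_half
  have h2 := h1.unique ((hasDerivAt_const (0 : ℝ) (0 : ℝ)).congr_of_eventuallyEq h0)
  have h3 : ∫ z, Real.exp (c * f (0, dir z)) * (c * timeDeriv δ f (0, dir z)) *
        timeDeriv δ f (0, dir z) + Real.exp (c * f (0, dir z)) *
        timeDeriv δ (timeDeriv δ f) (0, dir z) ∂(sphereMeasure n α) =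
      Real.exp (c * Real.log R) * (c * ∫ z, timeDeriv δ f (0, dir z) ^ 2 ∂(sphereMeasure n α) +
        ∫ z, timeDeriv δ (timeDeriv δ f) (0, dir z) ∂(sphereMeasure n α)) := by
    rw [← integral_const_mul, ← integral_add, ← integral_const_mul]
    · refine integral_congr_ae (Eventually.of_forall fun z => ?_)
      simp only [hf.exp_zero]
      ring
    · exact integrable_comp_dir hα hf.pos (f := fun q => c * timeDeriv δ f q ^ 2)
        (continuousOn_const.mul (hf1.continuousOn_timeDeriv.pow 2)) hf.zero_mem_half
    · exact integrable_comp_dir hα hf.pos hf.continuousOn_timeDeriv_timeDeriv hf.zero_mem_half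
  rw [h3] at h2
  linarith [(mul_eq_zero.1 h2).resolve_left (Real.exp_pos _).ne']

/-- The derivative of the perimeter in two parts: the first is differentiable in time under the
integral, the second contains the factor `spaceGrad f`, which vanishes at time `0`. -/
lemma hasDerivAt_integral_area (hα : -1 < α) (hf : IsRadialFamily 2 δ R f) (c : ℝ) {t : ℝ}
    (ht : t ∈ Ioo (-(δ / 2)) (δ / 2)) :
    HasDerivAt (fun s => ∫ z, Real.exp (c * f (s, dir z)) *
        √(1 + ‖spaceGrad δ f (s, dir z)‖ ^ 2) ∂(sphereMeasure n α))
      ((∫ z, Real.exp (c * f (t, dir z)) * (c * timeDeriv δ f (t, dir z)) *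
          √(1 + ‖spaceGrad δ f (t, dir z)‖ ^ 2) ∂(sphereMeasure n α)) +
        ∫ z, inner ℝ (spaceGrad δ f (t, dir z)) (timeDeriv δ (spaceGrad δ f) (t, dir z)) *
          (Real.exp (c * f (t, dir z)) / √(1 + ‖spaceGrad δ f (t, dir z)‖ ^ 2))
          ∂(sphereMeasure n α)) t := by
  have hf1 := hf.mono one_le_two
  have c1 : ContinuousOn (fun q => Real.exp (c * f q) * (c * timeDeriv δ f q) *
      √(1 + ‖spaceGrad δ f q‖ ^ 2)) (paramDomain n δ) :=
    ((hf1.continuousOn_exp c).mul (continuousOn_const.mul hf1.continuousOn_timeDeriv)).mul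
      hf1.continuousOn_sqrt
  have c2 : ContinuousOn (fun q => inner ℝ (spaceGrad δ f q) (timeDeriv δ (spaceGrad δ f) q) *
      (Real.exp (c * f q) / √(1 + ‖spaceGrad δ f q‖ ^ 2))) (paramDomain n δ) :=
    (hf1.continuousOn_spaceGrad.inner hf.continuousOn_timeDeriv_spaceGrad).mul
      ((hf1.continuousOn_exp c).div hf1.continuousOn_sqrt fun q _ => by positivity)
  rw [← integral_add (integrable_comp_dir hα hf.pos c1 ht) (integrable_comp_dir hα hf.pos c2 ht)]
  refine hasDerivAt_integral_comp_dir hα hf.pos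
    (f := fun q => Real.exp (c * f q) * √(1 + ‖spaceGrad δ f q‖ ^ 2))
    ((hf1.continuousOn_exp c).mul hf1.continuousOn_sqrt) (c1.add c2) (fun t ht x hx => ?_) ht
  convert! (hf1.hasDerivAt_exp c ht hx).mul (hf.hasDerivAt_sqrt ht hx) using 1
  simp only [Pi.add_apply]
  ring

/-- The second derivative of the perimeter of a family of radial graphs at the half-ball. -/
lemma hasDerivAt_deriv_integral_area (hα : -1 < α) (hf : IsRadialFamily 2 δ R f) (c : ℝ) :
    HasDerivAt (fun t => (∫ z, Real.exp (c * f (t, dir z)) * (c * timeDeriv δ f (t, dir z)) *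
          √(1 + ‖spaceGrad δ f (t, dir z)‖ ^ 2) ∂(sphereMeasure n α)) +
        ∫ z, inner ℝ (spaceGrad δ f (t, dir z)) (timeDeriv δ (spaceGrad δ f) (t, dir z)) *
          (Real.exp (c * f (t, dir z)) / √(1 + ‖spaceGrad δ f (t, dir z)‖ ^ 2))
          ∂(sphereMeasure n α))
      (Real.exp (c * Real.log R) *
        (c * (c * ∫ z, timeDeriv δ f (0, dir z) ^ 2 ∂(sphereMeasure n α) +
          ∫ z, timeDeriv δ (timeDeriv δ f) (0, dir z) ∂(sphereMeasure n α)) +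
        ∫ z, ‖timeDeriv δ (spaceGrad δ f) (0, dir z)‖ ^ 2 ∂(sphereMeasure n α))) 0 := by
  have hf1 := hf.mono one_le_two
  have cS : ∀ q : ℝ × EuclideanSpace ℝ (Fin (n + 1)), √(1 + ‖spaceGrad δ f q‖ ^ 2) ≠ 0 :=
    fun q => by positivity
  have ce : ContinuousOn (fun q => Real.exp (c * f q) * (c * timeDeriv δ f q)) (paramDomain n δ) :=
    (hf1.continuousOn_exp c).mul (continuousOn_const.mul hf1.continuousOn_timeDeriv)
  have h1 := hasDerivAt_integral_comp_dir hα hf.pos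
    (f := fun q => Real.exp (c * f q) * (c * timeDeriv δ f q) * √(1 + ‖spaceGrad δ f q‖ ^ 2))
    (f' := fun q => (Real.exp (c * f q) * (c * timeDeriv δ f q) * (c * timeDeriv δ f q) +
        Real.exp (c * f q) * (c * timeDeriv δ (timeDeriv δ f) q)) * √(1 + ‖spaceGrad δ f q‖ ^ 2) +
      Real.exp (c * f q) * (c * timeDeriv δ f q) *
        (inner ℝ (spaceGrad δ f q) (timeDeriv δ (spaceGrad δ f) q) /
          √(1 + ‖spaceGrad δ f q‖ ^ 2)))
    (ce.mul hf1.continuousOn_sqrt)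
    ((((ce.mul (continuousOn_const.mul hf1.continuousOn_timeDeriv)).add
      ((hf1.continuousOn_exp c).mul
        (continuousOn_const.mul hf.continuousOn_timeDeriv_timeDeriv))).mul
      hf1.continuousOn_sqrt).add (ce.mul ((hf1.continuousOn_spaceGrad.inner
        hf.continuousOn_timeDeriv_spaceGrad).div hf1.continuousOn_sqrt fun q _ => cS q)))
    (fun t ht x hx => ((hf1.hasDerivAt_exp c ht hx).mul
      ((hasDerivAt_timeDeriv hf.contDiffOn_timeDeriv_one ht hx).const_mul c)).mul
      (hf.hasDerivAt_sqrt ht hx)) hf.zero_mem_half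
  have h2 := hasDerivAt_integral_inner_comp_dir hα hf.pos (u := spaceGrad δ f)
    (v := timeDeriv δ (spaceGrad δ f))
    (h := fun q => Real.exp (c * f q) / √(1 + ‖spaceGrad δ f q‖ ^ 2))
    hf1.continuousOn_spaceGrad hf.continuousOn_timeDeriv_spaceGrad
    hf.continuousOn_timeDeriv_spaceGrad
    ((hf1.continuousOn_exp c).div hf1.continuousOn_sqrt fun q _ => cS q)
    (fun t ht x hx => hasDerivAt_timeDeriv hf.contDiffOn_spaceGrad_one ht hx)
    fun x hx => hf1.spaceGrad_zero hx
  convert! h1.add h2 using 1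
  rw [mul_add]
  congr 1
  · rw [← integral_const_mul, ← integral_add, ← integral_const_mul, ← integral_const_mul]
    · refine integral_congr_ae (Eventually.of_forall fun z => ?_)
      simp only [hf.exp_zero, hf1.spaceGrad_zero (dir_mem_halfSpace z), inner_zero_left, norm_zero]
      simp
      ring
    · exact integrable_comp_dir hα hf.pos (f := fun q => c * timeDeriv δ f q ^ 2)
        (continuousOn_const.mul (hf1.continuousOn_timeDeriv.pow 2)) hf.zero_mem_half
    · exact integrable_comp_dir hα hf.pos hf.continuousOn_timeDeriv_timeDeriv hf.zero_mem_half
  · rw [← integral_const_mul]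
    refine integral_congr_ae (Eventually.of_forall fun z => ?_)
    simp only [hf.exp_zero, hf1.spaceGrad_zero (dir_mem_halfSpace z), real_inner_self_eq_norm_sq,
      norm_zero]
    simp
    ring

/-- Volume-preserving families have a nonnegative second derivative of the perimeter: it is
`R ^ κ * ∫ (‖∇V‖ ^ 2 - κ (λ - κ) V ^ 2)`, where `V` is the initial speed, `κ = k + N + α - 1` and
`λ = l + N + α` with `N = n + 1`, and the Poincaré constant `n + α` is at least `κ (λ - κ)`. -/
lemma exists_second_derivative (hα : -1 < α) (hn : 0 ≤ n + α) (hl : 0 < l + n + 1 + α)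
    (h3 : (k + n + α) * ((l + n + 1 + α) - (k + n + α)) ≤ n + α) (hf : IsRadialFamily 2 δ R f)
    (hM : ∀ᶠ t in 𝓝 (0 : ℝ),
      wMeasure l α (radialRegion f t) = wMeasure l α (radialRegion f 0)) :
    (∀ᶠ t in 𝓝 (0 : ℝ),
      DifferentiableAt ℝ (fun t => (wPerimeter k α (radialRegion f t)).toReal) t) ∧
    ∃ c, HasDerivAt (deriv fun t => (wPerimeter k α (radialRegion f t)).toReal) c 0 ∧ 0 ≤ c := by
  have hf1 := hf.mono one_le_two
  have hnhds := isOpen_Ioo.mem_nhds hf.zero_mem_half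
  have hp : ∀ t ∈ Ioo (-(δ / 2)) (δ / 2), (wPerimeter k α (radialRegion f t)).toReal =
      ∫ z, Real.exp ((k + n + α) * f (t, dir z)) *
        √(1 + ‖spaceGrad δ f (t, dir z)‖ ^ 2) ∂(sphereMeasure n α) := fun t ht => by
    rw [hf1.wPerimeter_eq hα k ht, ENNReal.toReal_ofReal (integral_nonneg fun z => by positivity)]
  have hd := fun t (ht : t ∈ Ioo (-(δ / 2)) (δ / 2)) =>
    (hf.hasDerivAt_integral_area hα (k + n + α) ht).congr_of_eventuallyEq
      (f₁ := fun t => (wPerimeter k α (radialRegion f t)).toReal)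
      (by filter_upwards [isOpen_Ioo.mem_nhds ht] with s hs using hp s hs)
  refine ⟨by filter_upwards [hnhds] with t ht using (hd t ht).differentiableAt, _,
    (hf.hasDerivAt_deriv_integral_area hα (k + n + α)).congr_of_eventuallyEq
      (by filter_upwards [hnhds] with t ht using (hd t ht).deriv), ?_⟩
  have hP := hf.poincare hα hn (hf1.integral_timeDeriv_eq_zero hα hl hM)
  rw [hf.integral_timeDeriv_timeDeriv_eq hα hl hM]
  have h0 : 0 ≤ ∫ z, timeDeriv δ f (0, dir z) ^ 2 ∂(sphereMeasure n α) :=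
    integral_nonneg fun z => sq_nonneg _
  refine mul_nonneg (Real.exp_pos _).le ?_
  nlinarith [mul_le_mul_of_nonneg_right h3 h0]

end IsRadialFamily

/-! ### Stability of the half-ball -/

/-- Every variation of a half-ball consists of radial graphs for small times. -/
lemma IsVariation.exists_isRadialFamily {n m : ℕ} (hm : 1 ≤ m) {ε : ℝ}
    {φ : ℝ → EuclideanSpace ℝ (Fin (n + 1)) → EuclideanSpace ℝ (Fin (n + 1))}
    (hφ : IsVariation (m : ℕ∞) ε φ) {R : ℝ} (hR : 0 < R) :
    ∃ δ f, IsRadialFamily (n := n) m δ R f ∧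
      ∀ᶠ t in 𝓝 (0 : ℝ), φ t '' halfBall n R = radialRegion f t := by
  obtain ⟨δ, hδ, W, hW, hhom, himg, h0⟩ := hφ.exists_radial_param hm hR
  refine ⟨δ, fun q => W q.1 q.2, ⟨hδ, hW, hhom, h0⟩, ?_⟩
  filter_upwards [Ioo_mem_nhds (neg_lt_zero.2 hδ) hδ] with t ht using himg t ht

lemma isStationary_halfBall {n : ℕ} {k l α : ℝ} (hα : -1 < α) (hl : 0 < l + n + 1 + α) {R : ℝ}
    (hR : 0 < R) : IsStationary k l α (halfBall n R) := by
  refine ⟨isCSet_halfBall hR 1, fun ε φ hφ hM => ?_⟩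
  obtain ⟨δ, f, hf, himg⟩ := IsVariation.exists_isRadialFamily (m := 1) le_rfl
    (by exact_mod_cast hφ) hR
  constructor
  · filter_upwards [himg, Ioo_mem_nhds hf.zero_mem_half.1 hf.zero_mem_half.2] with t h1 ht
    rw [h1, hf.wPerimeter_eq hα k ht]
    exact ENNReal.ofReal_ne_top
  · intro c hc
    refine hf.derivative_eq_zero (k := k) hα hl ?_ (hc.congr_of_eventuallyEq ?_)
    · filter_upwards [hM, himg] with t h1 h2
      rw [← h2, h1, himg.self_of_nhds]
    · filter_upwards [himg] with t h1
      rw [perimeterFun, h1]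

lemma isStable_halfBall {n : ℕ} {k l α : ℝ} (hα : -1 < α) (hn : 0 ≤ n + α)
    (hl : 0 < l + n + 1 + α) (h3 : (k + n + α) * ((l + n + 1 + α) - (k + n + α)) ≤ n + α) {R : ℝ}
    (hR : 0 < R) : IsStable k l α (halfBall n R) := by
  refine ⟨isCSet_halfBall hR 2, isStationary_halfBall hα hl hR, fun ε φ hφ hM => ?_⟩
  obtain ⟨δ, f, hf, himg⟩ := IsVariation.exists_isRadialFamily (m := 2) one_le_two
    (by exact_mod_cast hφ) hR
  have hp : perimeterFun k α φ (halfBall n R) =ᶠ[𝓝 0]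
      fun t => (wPerimeter k α (radialRegion f t)).toReal := by
    filter_upwards [himg] with t h1
    rw [perimeterFun, h1]
  obtain ⟨h1, c, hc, hc0⟩ := hf.exists_second_derivative (k := k) hα hn hl h3 (by
    filter_upwards [hM, himg] with t h1 h2
    rw [← h2, h1, himg.self_of_nhds])
  refine ⟨?_, ?_, c, hc.congr_of_eventuallyEq hp.deriv, hc0⟩
  · filter_upwards [himg, Ioo_mem_nhds hf.zero_mem_half.1 hf.zero_mem_half.2] with t h1 ht
    rw [h1, (hf.mono one_le_two).wPerimeter_eq hα k ht]
    exact ENNReal.ofReal_ne_top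
  · filter_upwards [h1, hp.eventually_nhds] with t h2 h3
    exact h2.congr_of_eventuallyEq h3

end WeightedIso

/-- Here `N = n + 1 ≥ 2`. -/
theorem theorem1p1 (n N : ℕ) (hN : N = n + 1) (hN2 : 2 ≤ N) (α k l : ℝ)
    (hα : α ∈ Set.Ioo (-1 : ℝ) 0)
    (hl : 0 < l + N + α)
    (h1 : k + N + α - 1 < Real.sqrt ((N - 1) * (N + α - 1)))
    (h2 : N * (k + N + α - 1) < (l + N + α) * (N - 1))
    (h3 : l + 1 ≤ k + (N + α - 1) / (k + N + α - 1)) :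
    (¬ ∃ Ω, WeightedIso.IsMinimizer k l α (WeightedIso.smoothSets n) Ω) ∧
    (¬ ∃ Ω, WeightedIso.IsMinimizer k l α (WeightedIso.finitePerimeterSets n) Ω) ∧
    ∀ R : ℝ, 0 < R → WeightedIso.IsStable k l α (WeightedIso.halfBall n R) := by
  subst hN
  push_cast at hl h2 h3
  have hα1 := hα.1
  have hn1 : (1 : ℝ) ≤ n := by exact_mod_cast (by omega : 1 ≤ n)
  have hn : 0 < n + α := by linarith
  have hl' : 0 < l + n + 1 + α := by linarith
  have h2' : (n + 1) * (k + n + α) < (l + n + 1 + α) * n := by linarith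
  rw [show (n : ℝ) + 1 + α - 1 = n + α by ring, show k + ((n : ℝ) + 1) + α - 1 = k + n + α by ring]
    at h3
  -- `κ ≤ 0` would give `λ ≤ κ` in the last hypothesis
  have hk : 0 < k + n + α := by
    by_contra! hk
    have h4 : (n + α) / (k + n + α) ≤ 0 := div_nonpos_of_nonneg_of_nonpos hn.le hk
    linarith
  have h3' : (k + n + α) * ((l + n + 1 + α) - (k + n + α)) ≤ n + α := by
    rw [mul_comm, ← le_div_iff₀ hk]
    linarith
  refine ⟨WeightedIso.not_exists_isMinimizer hl' hk h2' (fun M hM => ⟨hM.2.1, hM.1⟩)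
      fun a r hr ha => ⟨measurableSet_ball.nullMeasurableSet, WeightedIso.isCSet_ball hr ha ⊤⟩,
    WeightedIso.not_exists_isMinimizer hl' hk h2' (fun M hM => ⟨hM.1, hM.2.1⟩)
      fun a r hr ha => ⟨ha, measurableSet_ball.nullMeasurableSet,
        WeightedIso.locallyFinitePerimeter_ball a hr⟩,
    fun R hR => WeightedIso.isStable_halfBall hα1 hn.le hl' h3' hR⟩
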